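/- Let $\Omega\subset\mathbb R^d$, $d\in\{1,2,3\}$, be a bounded domain with a conforming partition into finitely many simplices, and let $V_h^k$ be the space of continuous piecewise polynomials of degree at most $k$ on it that vanish on $\partial\Omega$. Write $(\cdot,\cdot)$ and $\|\cdot\|_0$ for the inner product and norm of $L^2(\Omega)$, and let $C_p$ be a constant with $\|v\|_0\le C_p\|\nabla v\|_0$ for all $v\in H_0^1(\Omega)$. Let $\alpha_0<\alpha_L$, let $\alpha\mapsto T^\alpha$ be a smooth function on $[\alpha_0,\alpha_L]$ with $0<T_{\min}\le T^\alpha\le T$, and for every $\alpha\in[\alpha_0,\alpha_L]$ let $\nu_\alpha>0$, $f_\alpha(t,\cdot)\in L^2(\Omega)$, and let $g_\alpha:\mathbb R\to\mathbb R$ be Lipschitz with a constant $\Lambda$ independent of $\alpha$. Let $u_h^\alpha:[0,T^\alpha]\to V_h^k$ (with any initial value in $V_h^k$, e.g. the Lagrange interpolant of the initial datum) be continuous, differentiable for $0<t\le T^\alpha$, and satisfy $$(u_{h,t}^\alpha,v_h)+\nu_\alpha(\nabla u_h^\alpha,\nabla v_h)+(g_\alpha(u_h^\alpha),v_h)=(f_\alpha,v_h)\qquad\forall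 v_h\in V_h^k,\ 0<t\le T^\alpha .$$ Sampling. For integers $L,M\ge1$ put $\Delta\alpha=(\alpha_L-\alpha_0)/L$, $\alpha_l=\alpha_0+l\Delta\alpha$, $T^l=T^{\alpha_l}$, $\Delta t_l=T^l/M$, $t_j^l=j\Delta t_l$, $\Delta t=\max_{0\le l\le L}\Delta t_l$, $N=(M+1)(L+1)$, and $$D^tv^{\alpha_l}(t_j^l)=\frac{v^{\alpha_l}(t_j^l)-v^{\alpha_l}(t_{j-1}^l)}{\Delta t_l},\qquad D^\alpha v^{\alpha_l}(t_j^l)=\frac{v^{\alpha_l}(t_j^l)-v^{\alpha_{l-1}}(t_j^{l-1})}{\Delta\alpha}.$$ Let $y^1,\dots,y^N$ be the functions $\sqrt N\,u_h^{\alpha_l}(0)$ $(0\le l\le L)$, $\sqrt{L+1}\,D^tu_h^{\alpha_0}(t_j^0)$ $(1\le j\le M)$ and $D^tD^\alpha u_h^{\alpha_l}(t_j^l)$ $(1\le j\le M,\ 1\le l\le L)$. Let $\lambda_1\ge\dots\ge\lambda_{d_r}>0$ be the positive eigenvalues, with multiplicity, of the matrix with entries $\frac1N(\nabla y^i,\nabla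 y^j)$, with orthonormal eigenvectors $v_k$; let $\varphi_k=(N\lambda_k)^{-1/2}\sum_jv_k^jy^j$. For $1\le r\le d_r$ let $U^r=\mathrm{span}\{\varphi_1,\dots,\varphi_r\}$ and let $P^r$ be the $H_0^1(\Omega)$-orthogonal projection onto $U^r$ for the inner product $(\nabla\cdot,\nabla\cdot)$. For $\alpha\in[\alpha_0,\alpha_L]$ let $u_r^\alpha:[0,T^\alpha]\to U^r$ be continuous, differentiable for $0<t\le T^\alpha$, with $u_r^\alpha(0)=P^ru_h^\alpha(0)$ and $$(u_{r,t}^\alpha,v_r)+\nu_\alpha(\nabla u_r^\alpha,\nabla v_r)+(g_\alpha(u_r^\alpha),v_r)=(f_\alpha,v_r)\qquad\forall v_r\in U^r,\ 0<t\le T^\alpha.$$ **Theorem.** Let $2\le q\le M$ and $2\le m\le L+1$. Assume that $(\mu,t)\mapsto u_h^\mu(t)$ and $(\mu,t)\mapsto u_{h,t}^\mu(t)$ are of class $C^m$ on $\{(\mu,t):\alpha_0\le\mu\le\alpha_L,\ 0\le t\le T^\mu\}$ and that $t\mapsto u_h^{\alpha_j}(t)$ is of class $C^{q+1}$ on $[0,T^j]$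 for $0\le j\le L$. Then there is a constant $C>0$, depending only on $m$, $q$, $\alpha_L-\alpha_0$, $C_p$, $\Lambda$, $T$, $T_{\min}$ and a bound for the derivatives of orders $1,\dots,m$ of $\alpha\mapsto T^\alpha$, such that for every $\alpha\in[\alpha_0,\alpha_L]$ (in the sample or not), every $l\in\{0,\dots,L-m+1\}$ with $\alpha\in[\alpha_l,\alpha_{l+m-1}]$, and every $t\in[0,T^\alpha]$, $$\|u_r^\alpha(t)-u_h^\alpha(t)\|_0^2\le C_{m,q}\sum_{k=r+1}^{d_r}\lambda_k+C_{1,u_h}(\Delta t)^{2q}+C_{2,u_h}(\Delta\alpha)^{2m-1},$$ where $C_{m,q}=C\big((m+1)+qm\big)$, $$C_{1,u_h}=C\sum_{j=l}^{l+m-1}\left(\max_{0\le s\le T^j}\left\|\frac{\partial^q\nabla u_h^{\alpha_j}(s)}{\partial s^q}\right\|_0^2+\int_0^{T^j}\left(\left\|\frac{\partial^q\nabla u_h^{\alpha_j}(s)}{\partial s^q}\right\|_0^2+\left\|\frac{\partial^{q+1}\nabla u_h^{\alpha_j}(s)}{\partial s^{q+1}}\right\|_0^2\right)ds\right),$$ $$C_{2,u_h}=C\int_{\alpha_l}^{\alpha_{l+m-1}}\!\int_0^{T^\mu}\sum_{i+j\le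 m}\left(\left\|\frac{\partial^{i+j+1}\nabla u_h^\mu(s)}{\partial s^{i+1}\partial\mu^j}\right\|_0^2+\left\|\frac{\partial^{i+j}\nabla u_h^\mu(s)}{\partial s^i\partial\mu^j}\right\|_0^2\right)ds\,d\mu+C\int_{\alpha_l}^{\alpha_{l+m-1}}\sum_{i+j\le m}\left\|\frac{\partial^{i+j}\nabla u_h^\mu}{\partial s^i\partial\mu^j}\Big(\frac{T^\mu t}{T^\alpha}\Big)\right\|_0^2d\mu .$$ The constant $C$ does not depend on $d$, $\Omega$, the mesh, $k$, $\nu_\alpha$, $g_\alpha$ and $f_\alpha$ (except through $C_p$ and $\Lambda$), $u_h^\alpha$, $L$, $M$, $r$, $\alpha$, $l$ or $t$. -/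

import Mathlib

open Set MeasureTheory Filter Topology

noncomputable section

/-- The ambient space `ℝ^d` with its Euclidean norm. -/
abbrev Eu (d : ℕ) := EuclideanSpace ℝ (Fin d)

/-! ### Function spaces on `Ω` -/

/-- `(v, w)`, the inner product of `L²(Ω)`. -/
def l2Inner {d : ℕ} (Ω : Set (Eu d)) (v w : Eu d → ℝ) : ℝ := ∫ x in Ω, v x * w x

/-- `‖v‖₀²`. -/
def l2NormSq {d : ℕ} (Ω : Set (Eu d)) (v : Eu d → ℝ) : ℝ := ∫ x in Ω, v x ^ 2

/-- `(∇v, ∇w)`. It is used for continuous piecewise polynomials `v`, `w`, whose weak gradient is the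
classical gradient, defined outside the (null) union of the boundaries of the simplices. -/
def gradInner {d : ℕ} (Ω : Set (Eu d)) (v w : Eu d → ℝ) : ℝ :=
  ∫ x in Ω, inner ℝ (gradient v x) (gradient w x)

/-- `‖∇v‖₀²`. -/
def gradNormSq {d : ℕ} (Ω : Set (Eu d)) (v : Eu d → ℝ) : ℝ := ∫ x in Ω, ‖gradient v x‖ ^ 2

/-- `v ∈ H¹₀(Ω)` with weak gradient `G`: the pair `(v, G)` is the limit in `L²(Ω)` of `(φₙ, ∇φₙ)`
for test functions `φₙ ∈ C_c^∞(Ω)`. -/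
def MemH10 {d : ℕ} (Ω : Set (Eu d)) (v : Eu d → ℝ) (G : Eu d → Eu d) : Prop :=
  MemLp v 2 (volume.restrict Ω) ∧ MemLp G 2 (volume.restrict Ω) ∧
  ∃ φ : ℕ → Eu d → ℝ,
    (∀ n, ContDiff ℝ (⊤ : ℕ∞) (φ n) ∧ HasCompactSupport (φ n) ∧ tsupport (φ n) ⊆ Ω) ∧
    Tendsto (fun n => ∫ x in Ω, (φ n x - v x) ^ 2) atTop (𝓝 0) ∧
    Tendsto (fun n => ∫ x in Ω, ‖gradient (φ n) x - G x‖ ^ 2) atTop (𝓝 0)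

/-- Poincare's inequality `‖v‖₀ ≤ Cp ‖∇v‖₀` holds on `H¹₀(Ω)`. -/
def PoincareIneq {d : ℕ} (Ω : Set (Eu d)) (Cp : ℝ) : Prop :=
  ∀ (v : Eu d → ℝ) (G : Eu d → Eu d), MemH10 Ω v G →
    √(∫ x in Ω, v x ^ 2) ≤ Cp * √(∫ x in Ω, ‖G x‖ ^ 2)

/-! ### Finite element space -/

/-- `K` is a conforming partition of `closure Ω` into finitely many `d`-simplices (together with all
their faces). -/
structure IsTriangulation {d : ℕ} (K : Geometry.SimplicialComplex ℝ (Eu d))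
    (Ω : Set (Eu d)) : Prop where
  finite : K.faces.Finite
  pure : ∀ s ∈ K.faces, ∃ s' ∈ K.faces, s ⊆ s' ∧ s'.card = d + 1
  cover : K.space = closure Ω

/-- The space `V_h^k` of continuous piecewise polynomials of degree at most `k` that vanish on the
boundary of `Ω`; its elements are extended by zero outside `Ω`. -/
def feSpace {d : ℕ} (K : Geometry.SimplicialComplex ℝ (Eu d)) (Ω : Set (Eu d)) (k : ℕ) :
    Set (Eu d → ℝ) :=
  {v | ContinuousOn v (closure Ω) ∧ (∀ x, x ∉ Ω → v x = 0) ∧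
    ∀ s ∈ K.faces, s.card = d + 1 →
      ∃ p : MvPolynomial (Fin d) ℝ, p.totalDegree ≤ k ∧
        ∀ x ∈ convexHull ℝ (s : Set (Eu d)), v x = MvPolynomial.eval (fun i => x i) p}

/-! ### Semi-discrete Galerkin problem -/

/-- `u : [0, T] → W` solves the semi-discrete Galerkin problem on the space `W`:
`(u_t, v) + ν (∇u, ∇v) + (g(u), v) = (f, v)` for all `v ∈ W` and `0 < t ≤ T`, and `u` is continuous
up to `t = 0`. In a finite-dimensional space of functions, continuity and differentiability in time
are the pointwise ones. With `W = V_h^k` this is the finite element method, with `W` the span of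
the first POD modes it is the reduced order model. -/
structure IsGalerkinSolution {d : ℕ} (Ω : Set (Eu d)) (W : Set (Eu d → ℝ)) (T ν : ℝ)
    (g : ℝ → ℝ) (f : ℝ → Eu d → ℝ) (u : ℝ → Eu d → ℝ) : Prop where
  mem : ∀ t ∈ Icc 0 T, u t ∈ W
  cont : ∀ x, ContinuousOn (fun t => u t x) (Icc 0 T)
  diff : ∀ x, ∀ t ∈ Ioc 0 T, DifferentiableWithinAt ℝ (fun s => u s x) (Icc 0 T) t
  eqn : ∀ t ∈ Ioc 0 T, ∀ v ∈ W,
    l2Inner Ω (fun x => derivWithin (fun s => u s x) (Icc 0 T) t) v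
      + ν * gradInner Ω (u t) v + l2Inner Ω (fun x => g (u t x)) v = l2Inner Ω (f t) v

/-! ### Sampling of parameter and time, difference quotients -/

/-- Parameter interval `[α₀, αL]`, curve `α ↦ T^α` of final times, `L` parameter steps and `M` time
steps. -/
structure SampleGrid where
  α₀ : ℝ
  αL : ℝ
  T : ℝ → ℝ
  L : ℕ
  M : ℕ

namespace SampleGrid

variable (G : SampleGrid)

/-- `Δα`. -/
def paramStep : ℝ := (G.αL - G.α₀) / G.L

/-- `α_l = α₀ + l Δα`. -/
def paramNode (l : ℕ) : ℝ := G.α₀ + l * G.paramStep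

/-- `T^l = T^{α_l}`. -/
def finalTime (l : ℕ) : ℝ := G.T (G.paramNode l)

/-- `Δt_l = T^l / M`. -/
def timeStep (l : ℕ) : ℝ := G.finalTime l / G.M

/-- `t_j^l = j Δt_l`. -/
def timeNode (l j : ℕ) : ℝ := j * G.timeStep l

/-- `Δt = max_{0 ≤ l ≤ L} Δt_l`. -/
def maxTimeStep : ℝ :=
  (Finset.range (G.L + 1)).sup' Finset.nonempty_range_add_one G.timeStep

/-- `N = (M+1)(L+1)`. -/
def numSnapshots : ℕ := (G.M + 1) * (G.L + 1)

/-- The set `I` of all `(μ, t)` with `α₀ ≤ μ ≤ αL` and `0 ≤ t ≤ T^μ`. -/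
def region : Set (ℝ × ℝ) := {p | p.1 ∈ Icc G.α₀ G.αL ∧ p.2 ∈ Icc 0 (G.T p.1)}

/-- Values `z l j = u^{α_l}(t_j^l)` at the nodes. -/
def sample {d : ℕ} (u : ℝ → ℝ → Eu d → ℝ) (l j : ℕ) : Eu d → ℝ :=
  u (G.paramNode l) (G.timeNode l j)

/-- Backward difference quotient in time, used for `j ≥ 1`. -/
def Dt {d : ℕ} (z : ℕ → ℕ → Eu d → ℝ) (l j : ℕ) : Eu d → ℝ :=
  (G.timeStep l)⁻¹ • (z l j - z l (j - 1))

/-- Backward difference quotient in the parameter, used for `l ≥ 1`. -/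
def Dα {d : ℕ} (z : ℕ → ℕ → Eu d → ℝ) (l j : ℕ) : Eu d → ℝ :=
  G.paramStep⁻¹ • (z l j - z (l - 1) j)

/-- The `N` snapshots, indexed by `(j, l)`: `√N u^{α_l}(t_0)`, `√(L+1) D^t u^{α₀}(t_j^0)` and
`D^t D^α u^{α_l}(t_j^l)`, for `j, l ≥ 1`. -/
def snapshot {d : ℕ} (u : ℝ → ℝ → Eu d → ℝ) (i : Fin (G.M + 1) × Fin (G.L + 1)) : Eu d → ℝ :=
  if (i.1 : ℕ) = 0 then √(G.numSnapshots : ℝ) • G.sample u i.2 0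
  else if (i.2 : ℕ) = 0 then √((G.L : ℝ) + 1) • G.Dt (G.sample u) 0 i.1
  else G.Dt (G.Dα (G.sample u)) i.2 i.1

/-- The correlation matrix `s_{ij} = (∇yⁱ, ∇yʲ) / N` of the snapshots. -/
def correlation {d : ℕ} (Ω : Set (Eu d)) (u : ℝ → ℝ → Eu d → ℝ) :
    Matrix (Fin (G.M + 1) × Fin (G.L + 1)) (Fin (G.M + 1) × Fin (G.L + 1)) ℝ :=
  Matrix.of fun i j =>
    (1 / (G.numSnapshots : ℝ)) * gradInner Ω (G.snapshot u i) (G.snapshot u j)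

/-- The POD mode `φ_k = N^{-1/2} λ_k^{-1/2} ∑_j v_k^j y^j`. -/
def podMode {d : ℕ} (u : ℝ → ℝ → Eu d → ℝ) (lam : ℝ)
    (vec : EuclideanSpace ℝ (Fin (G.M + 1) × Fin (G.L + 1))) : Eu d → ℝ :=
  ((1 / √(G.numSnapshots : ℝ)) * (1 / √lam)) • ∑ i, vec i • G.snapshot u i

end SampleGrid

/-- `lam 0 ≥ lam 1 ≥ ⋯ > 0` are all the positive eigenvalues, with multiplicity, of the positive
semidefinite matrix `S`, and `vec` are associated orthonormal eigenvectors. -/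
structure IsPosEigensystem {ι : Type*} [Fintype ι] (S : Matrix ι ι ℝ) {dr : ℕ}
    (lam : Fin dr → ℝ) (vec : Fin dr → EuclideanSpace ℝ ι) : Prop where
  antitone : Antitone lam
  pos : ∀ k, 0 < lam k
  orthonormal : Orthonormal ℝ vec
  eigen : ∀ k i, ∑ j, S i j * vec k j = lam k * vec k i
  complete : S.rank = dr

/-- The reduced space `U^r`, spanned by the first `r` POD modes. -/
def podSpace {d : ℕ} (G : SampleGrid) (u : ℝ → ℝ → Eu d → ℝ) {dr : ℕ} (lam : Fin dr → ℝ)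
    (vec : Fin dr → EuclideanSpace ℝ (Fin (G.M + 1) × Fin (G.L + 1))) (r : ℕ) :
    Submodule ℝ (Eu d → ℝ) :=
  Submodule.span ℝ {φ | ∃ k : Fin dr, (k : ℕ) < r ∧ φ = G.podMode u (lam k) (vec k)}

/-- `p` is the `H¹₀(Ω)`-orthogonal projection of `v` onto `U`, for the inner product `(∇·, ∇·)`. -/
def IsH10Projection {d : ℕ} (Ω : Set (Eu d)) (U : Submodule ℝ (Eu d → ℝ))
    (v p : Eu d → ℝ) : Prop :=
  p ∈ U ∧ ∀ w ∈ U, ∫ x in Ω, inner ℝ (gradient v x - gradient p x) (gradient w x) = 0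

/-! ### Derivatives in time and parameter -/

/-- `∂ⁿu^μ(t)/∂tⁿ` as a function of `x`, one-sided at the end points of `[0, T^μ]`. -/
def timeDeriv {d : ℕ} (T : ℝ → ℝ) (n : ℕ) (u : ℝ → ℝ → Eu d → ℝ) (μ t : ℝ) : Eu d → ℝ :=
  fun x => iteratedDerivWithin n (fun s => u μ s x) (Icc 0 (T μ)) t

/-- `∂^{i+j}u^μ(t)/∂tⁱ∂μʲ` as a function of `x`, for `(μ, t)` in the set `I`: the derivative of
order `i + j` within `I`, evaluated at `i` vectors in the direction of `t` and `j` in that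
of `μ`. -/
def mixedDeriv {d : ℕ} (I : Set (ℝ × ℝ)) (i j : ℕ) (u : ℝ → ℝ → Eu d → ℝ) (μ t : ℝ) :
    Eu d → ℝ :=
  fun x => iteratedFDerivWithin ℝ (i + j) (fun p : ℝ × ℝ => u p.1 p.2 x) I (μ, t)
    (fun k : Fin (i + j) => if (k : ℕ) < i then ((0 : ℝ), (1 : ℝ)) else ((1 : ℝ), (0 : ℝ)))

/-- `∑_{i+j ≤ m} ‖∂^{i+j}∇u^μ(t)/∂tⁱ∂μʲ‖₀²`. -/
def mixedSum {d : ℕ} (Ω : Set (Eu d)) (I : Set (ℝ × ℝ)) (m : ℕ) (u : ℝ → ℝ → Eu d → ℝ)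
    (μ t : ℝ) : ℝ :=
  ∑ n ∈ Finset.range (m + 1), ∑ ij ∈ Finset.HasAntidiagonal.antidiagonal n,
    gradNormSq Ω (mixedDeriv I ij.1 ij.2 u μ t)

/-- `C_{1,u}` without its factor `C`:
`∑_{j=l}^{l+m-1} ( max_{[0,T^j]} ‖∂_t^q ∇u^{α_j}‖₀²
  + ∫_0^{T^j} (‖∂_t^q ∇u^{α_j}‖₀² + ‖∂_t^{q+1} ∇u^{α_j}‖₀²) dt )`. -/
def timeConst {d : ℕ} (Ω : Set (Eu d)) (G : SampleGrid) (m q l : ℕ)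
    (u : ℝ → ℝ → Eu d → ℝ) : ℝ :=
  ∑ j ∈ Finset.Ico l (l + m),
    (sSup ((fun t => gradNormSq Ω (timeDeriv G.T q u (G.paramNode j) t)) ''
        Icc 0 (G.finalTime j))
      + ∫ t in (0 : ℝ)..G.finalTime j,
          (gradNormSq Ω (timeDeriv G.T q u (G.paramNode j) t)
            + gradNormSq Ω (timeDeriv G.T (q + 1) u (G.paramNode j) t)))

/-- `C_{2,u}` without its factor `C`:
`∫_{α_l}^{α_{l+m-1}} ∫_0^{T^μ} ∑_{i+j≤m} (‖∂_t^i ∂_μ^j ∇u_t^μ(t)‖₀² + ‖∂_t^i ∂_μ^j ∇u^μ(t)‖₀²) dt dμ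
 + ∫_{α_l}^{α_{l+m-1}} ∑_{i+j≤m} ‖∂_t^i ∂_μ^j ∇u^μ(T^μ t/T^α)‖₀² dμ`. -/
def paramConst {d : ℕ} (Ω : Set (Eu d)) (G : SampleGrid) (m l : ℕ)
    (u : ℝ → ℝ → Eu d → ℝ) (α t : ℝ) : ℝ :=
  (∫ μ in G.paramNode l..G.paramNode (l + m - 1), ∫ s in (0 : ℝ)..G.T μ,
      (mixedSum Ω G.region m (timeDeriv G.T 1 u) μ s + mixedSum Ω G.region m u μ s))
  + ∫ μ in G.paramNode l..G.paramNode (l + m - 1),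
      mixedSum Ω G.region m u μ (G.T μ * t / G.T α)

end

/-!
The error of the reduced order solution is split, by the `H¹₀`-projection onto `U^r`, into a projection
error of the finite element solution and a discrete error in `U^r`. In the error equation the
diffusion term sees the discrete error only, because the projection is orthogonal for
`(∇·, ∇·)`, so it has a good sign whatever `ν` is; Gronwall's inequality then bounds the discrete
error by the projection errors of `u_h` and `∂ₜ u_h`, integrated over time (`galerkin_error_le`). The
rest of the proof estimates these projection errors, for the complementary projection `Q`, in three
steps.

* On the snapshots: the sum of `‖Q y^j‖²` is at most `N` times the sum of the eigenvalues left out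
  (`IsPosEigensystem.sum_norm_sq_le`). Telescoping in the parameter turns this into a bound, uniform in
  the parameter node, for the initial value and the mean square of the difference quotients in time
  (`grid_bounds`).
* At a sampled parameter: interpolation of degree `q` on blocks of `q + 1` time nodes bounds the `L²`
  norm of `∂ₜ Q u_h` by its difference quotients and `(Δt)^q` times the `L²` norm of the derivative of
  order `q + 1` (`exists_time_const`); together with the initial value this bounds `Q u_h`
  uniformly in time (`exists_node_const`). The term with the maximum of `∂ₜ^q ∇u_h` in the
  constant of the theorem enters as a nonnegative summand.
* Between the samples: at `(α, t)` one interpolates with `m` parameter nodes along the curve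
  `μ ↦ (μ, T^μ t / T^α)`, which stays in the domain of the family
  (`exists_param_const`). The derivative of order `m` along the curve is bounded through Faà di
  Bruno's formula by the full derivatives of the family, and these, by the symmetry of second
  derivatives, by the mixed derivatives `∂ₜⁱ ∂_μʲ`
  (`norm_iteratedFDerivWithin_le_mixedSq`). Integration over `t` and the substitution
  `s = T^μ t / T^α` yield the double integral (`exists_param_const_integral`).

Both interpolation estimates rest on `exists_interp_const`: interpolatory weights with bounds
uniform in the point, applied to Taylor's formula with a remainder
in `L¹`. The resulting constants
do not depend on the space, which is an arbitrary inner product space `E` in `exists_galerkin_const`.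

It remains to place the finite element space in this frame. Its elements are Lipschitz functions on
`ℝ^d` that vanish outside `Ω` (`exists_lipschitzWith_of_mem_feSpace`). For such functions the
weak gradient is the almost everywhere gradient, and Poincaré's inequality holds: it passes from test
functions to Lipschitz functions with compact support in `Ω` by mollification, and to the others
by truncation at small values (`PoincareIneq.of_lipschitz`). Hence `(∇·, ∇·)` is an inner
product, for which the space is isometric to some `ℝⁿ`. Coordinates are linear combinations of
finitely many point values, so smoothness and derivatives, which are taken pointwise in `x`, carry
over to coordinates (`LipCoordinates`).
-/

namespace PODError

section

/-! ### Interpolation of smooth functions of one real variable -/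

open Finset in
/-- Cauchy's inequality `(∫ g)² ≤ (b - a) ∫ g²`. -/
theorem sq_integral_le {a b : ℝ} (hab : a < b) {g : ℝ → ℝ} (hg : ContinuousOn g (Icc a b)) :
    (∫ s in a..b, g s) ^ 2 ≤ (b - a) * ∫ s in a..b, g s ^ 2 := by
  set I := ∫ s in a..b, g s with hI
  have h0 : 0 < b - a := sub_pos.2 hab
  have hgi : IntervalIntegrable g volume a b := hg.intervalIntegrable_of_Icc hab.le
  have hg2 : IntervalIntegrable (fun s => g s ^ 2) volume a b :=
    (hg.pow 2).intervalIntegrable_of_Icc hab.le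
  have h1 : 0 ≤ ∫ s in a..b, (g s - I / (b - a)) ^ 2 :=
    intervalIntegral.integral_nonneg hab.le fun s _ => sq_nonneg _
  have h2 : ∫ s in a..b, (g s - I / (b - a)) ^ 2
      = (∫ s in a..b, g s ^ 2) - 2 * (I / (b - a)) * I + (b - a) * (I / (b - a)) ^ 2 := by
    have : (fun s => (g s - I / (b - a)) ^ 2)
        = fun s => (g s ^ 2 - 2 * (I / (b - a)) * g s) + (I / (b - a)) ^ 2 := by
      funext s; ring
    rw [this, intervalIntegral.integral_add (hg2.sub (hgi.const_mul _)) (by simp),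
      intervalIntegral.integral_sub hg2 (hgi.const_mul _), intervalIntegral.integral_const_mul,
      intervalIntegral.integral_const, smul_eq_mul]
  rw [h2] at h1
  have h3 : (∫ s in a..b, g s ^ 2) - 2 * (I / (b - a)) * I + (b - a) * (I / (b - a)) ^ 2
      = (∫ s in a..b, g s ^ 2) - I ^ 2 / (b - a) := by
    field_simp; ring
  rw [h3, sub_nonneg, div_le_iff₀ h0] at h1
  linarith

variable {E : Type*} [NormedAddCommGroup E] [NormedSpace ℝ E]

/-- `F 0, F 1, …, F n` are successive derivatives on `[a, b]`, the last one continuous. -/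
structure IsDerivChain (F : ℕ → ℝ → E) (n : ℕ) (a b : ℝ) : Prop where
  deriv : ∀ k < n, ∀ x ∈ Icc a b, HasDerivWithinAt (F k) (F (k + 1) x) (Icc a b) x
  cont : ContinuousOn (F n) (Icc a b)

theorem IsDerivChain.continuousOn {F : ℕ → ℝ → E} {n : ℕ} {a b : ℝ} (h : IsDerivChain F n a b)
    {k : ℕ} (hk : k ≤ n) : ContinuousOn (F k) (Icc a b) := by
  rcases hk.lt_or_eq with hk | rfl
  · exact fun x hx => (h.deriv k hk x hx).continuousWithinAt
  · exact h.cont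

theorem IsDerivChain.mono {F : ℕ → ℝ → E} {n : ℕ} {a b a' b' : ℝ} (h : IsDerivChain F n a b)
    (ha : a ≤ a') (hb : b' ≤ b) : IsDerivChain F n a' b' :=
  ⟨fun k hk x hx => (h.deriv k hk x ⟨ha.trans hx.1, hx.2.trans hb⟩).mono (Icc_subset_Icc ha hb),
    h.cont.mono (Icc_subset_Icc ha hb)⟩

theorem IsDerivChain.map {F : ℕ → ℝ → E} {n : ℕ} {a b : ℝ} (h : IsDerivChain F n a b)
    {E' : Type*} [NormedAddCommGroup E'] [NormedSpace ℝ E'] (Q : E →L[ℝ] E') :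
    IsDerivChain (fun k x => Q (F k x)) n a b :=
  ⟨fun k hk x hx => Q.hasFDerivAt.comp_hasDerivWithinAt x (h.deriv k hk x hx),
    Q.continuous.comp_continuousOn h.cont⟩

/-- Successive derivatives of a `C^n` function form a chain. -/
theorem isDerivChain_iteratedDerivWithin {f : ℝ → E} {n : ℕ} {a b : ℝ} (hab : a < b)
    (hf : ContDiffOn ℝ n f (Icc a b)) :
    IsDerivChain (fun k => iteratedDerivWithin k f (Icc a b)) n a b := by
  have hu := uniqueDiffOn_Icc hab
  refine ⟨fun k hk x hx => ?_, hf.continuousOn_iteratedDerivWithin le_rfl hu⟩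
  have := (hf.differentiableOn_iteratedDerivWithin (m := k) (by exact_mod_cast hk) hu x hx)
  simpa [iteratedDerivWithin_succ] using this.hasDerivWithinAt

/-- The oscillation of a function is bounded by the `L¹` norm of its derivative. -/
theorem norm_sub_le_integral [CompleteSpace E] {a b : ℝ} {f f' : ℝ → E}
    (hf : ∀ x ∈ Icc a b, HasDerivWithinAt f (f' x) (Icc a b) x) (hf' : ContinuousOn f' (Icc a b))
    {x y : ℝ} (hx : x ∈ Icc a b) (hy : y ∈ Icc a b) :
    ‖f y - f x‖ ≤ ∫ s in a..b, ‖f' s‖ := by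
  have hab : a ≤ b := hx.1.trans hx.2
  have hsub : uIcc x y ⊆ Icc a b := by
    rw [← uIcc_of_le hab]
    exact uIcc_subset_uIcc (by rwa [uIcc_of_le hab]) (by rwa [uIcc_of_le hab])
  have hint : IntervalIntegrable (fun s => ‖f' s‖) volume a b :=
    hf'.norm.intervalIntegrable_of_Icc hab
  have hFTC : ∫ s in x..y, f' s = f y - f x := by
    refine intervalIntegral.integral_eq_sub_of_hasDeriv_right
      (fun s hs => ((hf s (hsub hs)).continuousWithinAt).mono hsub) (fun s hs => ?_)
      (hf'.mono hsub).intervalIntegrable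
    have hs' : s ∈ Ioo a b := by
      refine ⟨(le_min hx.1 hy.1).trans_lt hs.1, hs.2.trans_le (max_le hx.2 hy.2)⟩
    exact ((hf s (Ioo_subset_Icc_self hs')).hasDerivAt (Icc_mem_nhds hs'.1 hs'.2)).hasDerivWithinAt
  rw [← hFTC]
  refine (intervalIntegral.norm_integral_le_abs_integral_norm).trans ?_
  refine (intervalIntegral.abs_integral_mono_interval (μ := volume)
    (f := fun s => ‖f' s‖) (c := a) (d := b) ?_ ?_ hint).trans ?_
  · rw [uIoc_of_le hab]
    intro s hs
    rw [mem_uIoc] at hs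
    rcases hs with hs | hs
    · exact ⟨hx.1.trans_lt hs.1, hs.2.trans hy.2⟩
    · exact ⟨hy.1.trans_lt hs.1, hs.2.trans hx.2⟩
  · exact Eventually.of_forall fun s => norm_nonneg _
  · rw [abs_of_nonneg (intervalIntegral.integral_nonneg hab fun s _ => norm_nonneg _)]

open Finset Nat in
/-- Taylor's formula with the remainder bounded by the `L¹` norm of the highest derivative. -/
theorem IsDerivChain.taylor [CompleteSpace E] {a b : ℝ} (m : ℕ) :
    ∀ {F : ℕ → ℝ → E}, IsDerivChain F (m + 1) a b → ∀ {x y : ℝ}, x ∈ Icc a b → y ∈ Icc a b →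
    ‖F 0 y - ∑ k ∈ range (m + 1), ((y - x) ^ k / (k ! : ℝ)) • F k x‖
      ≤ (b - a) ^ m * ∫ s in a..b, ‖F (m + 1) s‖ := by
  induction m with
  | zero =>
    intro F h x y hx hy
    simpa using norm_sub_le_integral (h.deriv 0 one_pos) h.cont hx hy
  | succ m ih =>
    intro F h x y hx hy
    have hab : a ≤ b := hx.1.trans hx.2
    have hshift : IsDerivChain (fun k => F (k + 1)) (m + 1) a b :=
      ⟨fun k hk => h.deriv (k + 1) (by omega), h.cont⟩
    set I := ∫ s in a..b, ‖F (m + 1 + 1) s‖ with hI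
    have hI0 : 0 ≤ I := intervalIntegral.integral_nonneg hab fun s _ => norm_nonneg _
    let G : ℝ → E := fun y => F 0 y - ∑ k ∈ range (m + 1 + 1), ((y - x) ^ k / (k ! : ℝ)) • F k x
    have hG : ∀ z ∈ Icc a b, HasDerivWithinAt G
        (F 1 z - ∑ k ∈ range (m + 1), ((z - x) ^ k / (k ! : ℝ)) • F (k + 1) x) (Icc a b) z := by
      intro z hz
      refine (h.deriv 0 (by omega) z hz).sub ?_
      have h1 : ∀ k ∈ range (m + 1 + 1), HasDerivWithinAt
          (fun y : ℝ => ((y - x) ^ k / (k ! : ℝ)) • F k x)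
          ((((k : ℝ) * (z - x) ^ (k - 1)) / (k ! : ℝ)) • F k x) (Icc a b) z := by
        intro k _
        have : HasDerivAt (fun y : ℝ => (y - x) ^ k) ((k : ℝ) * (z - x) ^ (k - 1)) z := by
          simpa using HasDerivAt.fun_pow ((hasDerivAt_id z).sub_const x) k
        exact ((this.div_const _).smul_const _).hasDerivWithinAt
      have h2 := HasDerivWithinAt.fun_sum h1
      convert h2 using 1
      rw [Finset.sum_range_succ' _ (m + 1)]
      simp only [Nat.cast_zero, zero_mul, zero_div, zero_smul, add_zero]
      refine Finset.sum_congr rfl fun k _ => ?_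
      congr 1
      rw [Nat.factorial_succ]
      have : (k ! : ℝ) ≠ 0 := by exact_mod_cast Nat.factorial_ne_zero k
      have h3 : ((k : ℝ) + 1) ≠ 0 := by positivity
      push_cast
      field_simp
    have hbd : ∀ z ∈ Icc a b,
        ‖F 1 z - ∑ k ∈ range (m + 1), ((z - x) ^ k / (k ! : ℝ)) • F (k + 1) x‖
          ≤ (b - a) ^ m * I := fun z hz => ih hshift hx hz
    have hGx : G x = 0 := by
      simp only [G, sub_self]
      rw [Finset.sum_range_succ' _ (m + 1)]
      simp
    have := (convex_Icc a b).norm_image_sub_le_of_norm_hasDerivWithin_le hG hbd hx hy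
    rw [hGx, sub_zero] at this
    refine this.trans ?_
    have hyx : ‖y - x‖ ≤ b - a := by
      rw [Real.norm_eq_abs, abs_le]; constructor <;> linarith [hx.1, hx.2, hy.1, hy.2]
    calc (b - a) ^ m * I * ‖y - x‖ ≤ (b - a) ^ m * I * (b - a) := by
          have : 0 ≤ b - a := sub_nonneg.2 hab
          gcongr
      _ = (b - a) ^ (m + 1) * I := by ring

open Polynomial Finset Nat in
/-- Weights, bounded uniformly on `[0, n]`, of the interpolatory formula for the `p`-th derivative
at `ξ` on the nodes `0, …, n`; they are the `p`-th derivatives of the Lagrange basis. -/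
theorem exists_weights (n p : ℕ) :
    ∃ C : ℝ, 0 < C ∧ ∀ ξ ∈ Icc (0 : ℝ) n, ∃ c : ℕ → ℝ, (∀ i ∈ range (n + 1), |c i| ≤ C) ∧
      ∀ k ≤ n, ∑ i ∈ range (n + 1), c i * ((i : ℝ) - ξ) ^ k = if k = p then (k ! : ℝ) else 0 := by
  let v : ℕ → ℝ := fun i => (i : ℝ)
  let w : ℕ → ℝ → ℝ := fun i ξ => (derivative^[p] (Lagrange.basis (range (n + 1)) v i)).eval ξ
  have hb : ∀ i, ∃ C : ℝ, ∀ ξ ∈ Icc (0 : ℝ) n, |w i ξ| ≤ C := fun i =>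
    isCompact_Icc.exists_bound_of_continuousOn (Polynomial.continuous _).continuousOn
  choose C hC using hb
  refine ⟨∑ i ∈ range (n + 1), |C i| + 1, by positivity, fun ξ hξ => ⟨fun i => w i ξ, ?_, ?_⟩⟩
  · intro i hi
    have h1 := Finset.single_le_sum (f := fun i => |C i|) (fun i _ => abs_nonneg _) hi
    have h2 := hC i ξ hξ
    have h3 := le_abs_self (C i)
    linarith
  · intro k hk
    have hinj : Set.InjOn v (range (n + 1) : Finset ℕ) := fun i _ j _ h => Nat.cast_injective h
    have hdeg : ((X - Polynomial.C ξ) ^ k : ℝ[X]).degree < #(range (n + 1)) := by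
      rw [degree_pow, degree_X_sub_C, card_range]
      simp only [nsmul_eq_mul, mul_one]
      exact_mod_cast Nat.lt_succ_of_le hk
    have h1 := Lagrange.eq_interpolate hinj hdeg
    rw [Lagrange.interpolate_apply] at h1
    have h2 := congrArg (fun P : ℝ[X] => (derivative^[p] P).eval ξ) h1
    simp only [iterate_derivative_X_sub_pow, iterate_derivative_sum, eval_finsetSum,
      iterate_derivative_C_mul, eval_mul, eval_C, eval_pow, eval_sub, eval_X,
      sub_self, nsmul_eq_mul] at h2
    have h3 : ∑ i ∈ range (n + 1), w i ξ * ((i : ℝ) - ξ) ^ k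
        = ∑ i ∈ range (n + 1), (v i - ξ) ^ k * w i ξ :=
      Finset.sum_congr rfl fun i _ => mul_comm _ _
    rw [h3, ← h2]
    rcases lt_trichotomy k p with h | h | h
    · simp [Nat.descFactorial_eq_zero_iff_lt.2 h, h.ne]
    · simp [h, Nat.descFactorial_self]
    · simp [h.ne', (Nat.sub_pos_of_lt h).ne']

open Finset Nat in
/-- Interpolation at `n + 1` equidistant nodes bounds the `p`-th derivative by the nodal values and
the `L²` norm of the derivative of order `n + 1`. -/
theorem exists_interp_const (n p : ℕ) (hp : p ≤ n) :
    ∃ C : ℝ, 0 < C ∧ ∀ {E : Type} [NormedAddCommGroup E] [NormedSpace ℝ E] [CompleteSpace E]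
      (F : ℕ → ℝ → E) (a h : ℝ), 0 < h → 0 < n → IsDerivChain F (n + 1) a (a + n * h) →
      ∀ x ∈ Icc a (a + n * h),
        h ^ (2 * p) * ‖F p x‖ ^ 2 ≤ C * (∑ i ∈ range (n + 1), ‖F 0 (a + i * h)‖ ^ 2
          + h ^ (2 * n + 1) * ∫ s in a..(a + n * h), ‖F (n + 1) s‖ ^ 2) := by
  obtain ⟨C, hC, hw⟩ := exists_weights n p
  refine ⟨2 * C ^ 2 * (n + 1) + 2 * (C * (n + 1) * (n : ℝ) ^ n) ^ 2 * n + 1, by positivity, ?_⟩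
  intro E _ _ _ F a h hh hn hF x hx
  set b := a + n * h with hb
  have hn' : (0 : ℝ) < n := by exact_mod_cast hn
  have hba : b - a = n * h := by rw [hb]; ring
  have hab : a < b := by rw [← sub_pos, hba]; positivity
  set ξ := (x - a) / h with hξ
  have hξm : ξ ∈ Icc (0 : ℝ) n := by
    refine ⟨div_nonneg (by linarith [hx.1]) hh.le, ?_⟩
    rw [hξ, div_le_iff₀ hh]; linarith [hx.2]
  obtain ⟨c, hc, hmom⟩ := hw ξ hξm
  have hnode : ∀ i ∈ range (n + 1), a + i * h ∈ Icc a b := by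
    intro i hi
    have hi' : (i : ℝ) ≤ n := by exact_mod_cast Nat.lt_succ_iff.1 (mem_range.1 hi)
    exact ⟨by simp only [le_add_iff_nonneg_right]; positivity, by rw [hb]; gcongr⟩
  set I := ∫ s in a..b, ‖F (n + 1) s‖ with hI
  have hI0 : 0 ≤ I := intervalIntegral.integral_nonneg hab.le fun s _ => norm_nonneg _
  let R : ℕ → E := fun i =>
    F 0 (a + i * h) - ∑ k ∈ range (n + 1), ((a + i * h - x) ^ k / (k ! : ℝ)) • F k x
  have hR : ∀ i ∈ range (n + 1), ‖R i‖ ≤ (n * h) ^ n * I := by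
    intro i hi
    rw [← hba]
    exact hF.taylor n hx (hnode i hi)
  -- the Taylor polynomials are reproduced up to the factor `h ^ p`
  have hrep : ∑ i ∈ range (n + 1), c i • ∑ k ∈ range (n + 1),
      ((a + i * h - x) ^ k / (k ! : ℝ)) • F k x = h ^ p • F p x := by
    simp only [Finset.smul_sum, smul_smul]
    rw [Finset.sum_comm]
    have : ∀ k ∈ range (n + 1), ∑ i ∈ range (n + 1),
        (c i * ((a + i * h - x) ^ k / (k ! : ℝ))) • F k x
          = if k = p then h ^ p • F p x else 0 := by
      intro k hk
      rw [← Finset.sum_smul]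
      have h1 : ∀ i : ℕ, c i * ((a + i * h - x) ^ k / (k ! : ℝ))
          = (h ^ k / (k ! : ℝ)) * (c i * ((i : ℝ) - ξ) ^ k) := by
        intro i
        have : a + i * h - x = h * ((i : ℝ) - ξ) := by rw [hξ]; field_simp; ring
        rw [this, mul_pow]; ring
      simp only [h1]
      rw [← Finset.mul_sum, hmom k (Nat.lt_succ_iff.1 (mem_range.1 hk))]
      split_ifs with hkp
      · subst hkp
        have : (k ! : ℝ) ≠ 0 := by exact_mod_cast Nat.factorial_ne_zero k
        rw [div_mul_cancel₀ _ this]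
      · simp
    rw [Finset.sum_congr rfl this, Finset.sum_ite_eq' (range (n + 1)) p,
      if_pos (mem_range.2 (Nat.lt_succ_of_le hp))]
  -- `h ^ p F_p(x)` is the quadrature of the nodal values minus that of the Taylor remainders
  have hid : h ^ p • F p x = ∑ i ∈ range (n + 1), c i • F 0 (a + i * h)
      - ∑ i ∈ range (n + 1), c i • R i := by
    rw [← hrep, ← Finset.sum_sub_distrib]
    refine Finset.sum_congr rfl fun i _ => ?_
    rw [← smul_sub]; simp [R]
  have hA : ‖∑ i ∈ range (n + 1), c i • F 0 (a + i * h)‖ ^ 2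
      ≤ C ^ 2 * (n + 1) * ∑ i ∈ range (n + 1), ‖F 0 (a + i * h)‖ ^ 2 := by
    have h1 : ‖∑ i ∈ range (n + 1), c i • F 0 (a + i * h)‖
        ≤ C * ∑ i ∈ range (n + 1), ‖F 0 (a + i * h)‖ := by
      rw [Finset.mul_sum]
      refine (norm_sum_le _ _).trans (Finset.sum_le_sum fun i hi => ?_)
      rw [norm_smul, Real.norm_eq_abs]
      exact mul_le_mul_of_nonneg_right (hc i hi) (norm_nonneg _)
    have h2 := sq_sum_le_card_mul_sum_sq (s := range (n + 1)) (f := fun i => ‖F 0 (a + i * h)‖)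
    rw [card_range] at h2
    push_cast at h2
    calc _ ≤ (C * ∑ i ∈ range (n + 1), ‖F 0 (a + i * h)‖) ^ 2 := by gcongr
      _ = C ^ 2 * (∑ i ∈ range (n + 1), ‖F 0 (a + i * h)‖) ^ 2 := by ring
      _ ≤ C ^ 2 * (((n : ℝ) + 1) * ∑ i ∈ range (n + 1), ‖F 0 (a + i * h)‖ ^ 2) := by gcongr
      _ = _ := by ring
  have hB : ‖∑ i ∈ range (n + 1), c i • R i‖ ≤ C * (n + 1) * (n : ℝ) ^ n * (h ^ n * I) := by
    refine (norm_sum_le _ _).trans ?_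
    have : ∀ i ∈ range (n + 1), ‖c i • R i‖ ≤ C * ((n * h) ^ n * I) := by
      intro i hi
      rw [norm_smul, Real.norm_eq_abs]
      exact mul_le_mul (hc i hi) (hR i hi) (norm_nonneg _) hC.le
    refine (Finset.sum_le_sum this).trans (le_of_eq ?_)
    rw [Finset.sum_const, card_range, nsmul_eq_mul, mul_pow]; push_cast; ring
  have hI2 : I ^ 2 ≤ n * h * ∫ s in a..b, ‖F (n + 1) s‖ ^ 2 := by
    rw [← hba]; exact sq_integral_le hab hF.cont.norm
  set J := ∫ s in a..b, ‖F (n + 1) s‖ ^ 2 with hJ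
  have hJ0 : 0 ≤ J := intervalIntegral.integral_nonneg hab.le fun s _ => sq_nonneg _
  set S := ∑ i ∈ range (n + 1), ‖F 0 (a + i * h)‖ ^ 2 with hS
  have hS0 : 0 ≤ S := Finset.sum_nonneg fun i _ => sq_nonneg _
  have hB2 : ‖∑ i ∈ range (n + 1), c i • R i‖ ^ 2
      ≤ (C * (n + 1) * (n : ℝ) ^ n) ^ 2 * n * (h ^ (2 * n + 1) * J) := by
    calc _ ≤ (C * (n + 1) * (n : ℝ) ^ n * (h ^ n * I)) ^ 2 := by gcongr
      _ = (C * (n + 1) * (n : ℝ) ^ n) ^ 2 * (h ^ n) ^ 2 * I ^ 2 := by ring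
      _ ≤ (C * (n + 1) * (n : ℝ) ^ n) ^ 2 * (h ^ n) ^ 2 * (n * h * J) := by gcongr
      _ = _ := by ring
  have hnorm : h ^ (2 * p) * ‖F p x‖ ^ 2 = ‖h ^ p • F p x‖ ^ 2 := by
    rw [norm_smul, mul_pow, Real.norm_of_nonneg (by positivity)]; ring
  have hsq : ‖h ^ p • F p x‖ ^ 2 ≤ 2 * ‖∑ i ∈ range (n + 1), c i • F 0 (a + i * h)‖ ^ 2
      + 2 * ‖∑ i ∈ range (n + 1), c i • R i‖ ^ 2 := by
    rw [hid]
    have h1 := norm_sub_le (∑ i ∈ range (n + 1), c i • F 0 (a + i * h))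
      (∑ i ∈ range (n + 1), c i • R i)
    refine (pow_le_pow_left₀ (norm_nonneg _) h1 2).trans ?_
    nlinarith [sq_nonneg (‖∑ i ∈ range (n + 1), c i • F 0 (a + i * h)‖
      - ‖∑ i ∈ range (n + 1), c i • R i‖)]
  rw [hnorm]
  have hK : 0 ≤ h ^ (2 * n + 1) * J := by positivity
  have e1 : 0 ≤ C ^ 2 * ((n : ℝ) + 1) := by positivity
  have e2 : 0 ≤ (C * (n + 1) * (n : ℝ) ^ n) ^ 2 * n := by positivity
  rw [mul_assoc 2, mul_assoc 2]
  generalize h ^ (2 * n + 1) * J = K at *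
  generalize C ^ 2 * ((n : ℝ) + 1) = c1 at *
  generalize (C * (n + 1) * (n : ℝ) ^ n) ^ 2 * n = c2 at *
  linarith [mul_nonneg e1 hK, mul_nonneg e2 hS0]

end

open Finset in
/-- Windows of length `q` inside `{0, …, M - 1}`, one for each `i`, cover every index at most `2q`
times when the `i`-th window contains `i`. -/
theorem sum_window_le {M q : ℕ} {a : ℕ → ℝ} (ha : ∀ k, 0 ≤ a k) {b : ℕ → ℕ}
    (hb : ∀ i < M, b i ≤ i ∧ i < b i + q ∧ b i + q ≤ M) :
    ∑ i ∈ range M, ∑ κ ∈ range q, a (b i + κ) ≤ 2 * q * ∑ k ∈ range M, a k := by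
  have h1 : ∀ i ∈ range M, ∑ κ ∈ range q, a (b i + κ)
      ≤ ∑ k ∈ range M, if k < i + q ∧ i < k + q then a k else 0 := by
    intro i hi
    obtain ⟨h1, h2, h3⟩ := hb i (mem_range.1 hi)
    have h4 : ∑ κ ∈ range q, a (b i + κ) = ∑ k ∈ (range q).image (b i + ·), a k :=
      (Finset.sum_image fun x _ y _ h => by simpa using h).symm
    rw [← Finset.sum_filter, h4]
    refine Finset.sum_le_sum_of_subset_of_nonneg (fun k hk => ?_) fun k _ _ => ha k
    simp only [Finset.mem_image, Finset.mem_range, Finset.mem_filter] at hk ⊢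
    omega
  refine (Finset.sum_le_sum h1).trans ?_
  rw [Finset.sum_comm, Finset.mul_sum]
  refine Finset.sum_le_sum fun k _ => ?_
  rw [← Finset.sum_filter, Finset.sum_const, nsmul_eq_mul]
  refine mul_le_mul_of_nonneg_right ?_ (ha k)
  have h5 : #{i ∈ range M | k < i + q ∧ i < k + q} ≤ #(Finset.Ico (k + 1 - q) (k + q)) := by
    refine Finset.card_le_card fun i hi => ?_
    simp only [Finset.mem_filter, Finset.mem_Ico] at hi ⊢
    omega
  rw [Nat.card_Ico] at h5
  have h6 : #{i ∈ range M | k < i + q ∧ i < k + q} ≤ 2 * q := by omega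
  exact_mod_cast h6

open Finset in
/-- The `L²` norm of a time derivative is bounded by the difference quotients at the equidistant
nodes, up to a term of order `h ^ (2 q)`: interpolation on blocks of `q + 1` nodes. -/
theorem exists_time_const (q : ℕ) (hq : 1 ≤ q) :
    ∃ C : ℝ, 0 < C ∧ ∀ {E : Type} [NormedAddCommGroup E] [NormedSpace ℝ E] [CompleteSpace E]
      (F : ℕ → ℝ → E) (T : ℝ) (M : ℕ), 0 < T → q ≤ M → IsDerivChain F (q + 1) 0 T →
      ∫ s in (0 : ℝ)..T, ‖F 1 s‖ ^ 2 ≤ C * ((T / M)⁻¹ * ∑ j ∈ range M,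
          ‖F 0 ((j + 1 : ℕ) * (T / M)) - F 0 (j * (T / M))‖ ^ 2
        + (T / M) ^ (2 * q) * ∫ s in (0 : ℝ)..T, ‖F (q + 1) s‖ ^ 2) := by
  obtain ⟨C, hC, hint⟩ := exists_interp_const q 1 hq
  refine ⟨C * ((q + 1) * q + 1) * (2 * q), by positivity, ?_⟩
  intro E _ _ _ F T M hT hqM hF
  have hM0 : (0 : ℝ) < M := by exact_mod_cast (by omega : 0 < M)
  set h := T / M with hh
  have hh0 : 0 < h := by positivity
  have hMh : M * h = T := by rw [hh]; field_simp
  let δ : ℕ → ℝ := fun k => ‖F 0 ((k + 1 : ℕ) * h) - F 0 (k * h)‖ ^ 2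
  let J : ℕ → ℝ := fun k => ∫ s in (k * h)..((k + 1 : ℕ) * h), ‖F (q + 1) s‖ ^ 2
  let a : ℕ → ℝ := fun k => δ k + h ^ (2 * q + 1) * J k
  have hJ0 : ∀ k, 0 ≤ J k := fun k =>
    intervalIntegral.integral_nonneg (by gcongr; simp) fun s _ => sq_nonneg _
  have hδ0 : ∀ k, 0 ≤ δ k := fun k => sq_nonneg _
  have ha0 : ∀ k, 0 ≤ a k := fun k => by have := hJ0 k; have := hδ0 k; positivity
  have hnode : ∀ k ≤ M, (k : ℝ) * h ∈ Icc 0 T := fun k hk =>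
    ⟨by positivity, by rw [← hMh]; gcongr⟩
  have hsubI : ∀ k l : ℕ, k ≤ l → l ≤ M → Icc (k * h) (l * h) ⊆ Icc 0 T := fun k l hkl hl =>
    Icc_subset_Icc (hnode k (hkl.trans hl)).1 (hnode l hl).2
  have hii : ∀ p ≤ q + 1, ∀ k < M,
      IntervalIntegrable (fun s => ‖F p s‖ ^ 2) volume (k * h) ((k + 1 : ℕ) * h) := by
    intro p hp k hk
    refine ContinuousOn.intervalIntegrable_of_Icc (by gcongr; simp) ?_
    exact ((hF.continuousOn hp).norm.pow 2).mono (hsubI k (k + 1) (by omega) hk)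
  -- the block of `q` intervals that starts at `b i` contains the interval `i`
  let b : ℕ → ℕ := fun i => min i (M - q)
  have hb : ∀ i < M, b i ≤ i ∧ i < b i + q ∧ b i + q ≤ M := fun i hi => by
    simp only [b]; omega
  have hpt : ∀ i < M, ∀ x ∈ Icc (i * h) ((i + 1 : ℕ) * h),
      ‖F 1 x‖ ^ 2 ≤ (h ^ 2)⁻¹ * (C * ((q + 1) * q + 1) * ∑ κ ∈ range q, a (b i + κ)) := by
    intro i hi x hx
    obtain ⟨hb1, hb2, hb3⟩ := hb i hi
    set β := b i
    have hend : (β : ℝ) * h + q * h = ((β + q : ℕ) : ℝ) * h := by push_cast; ring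
    have hxm : x ∈ Icc ((β : ℝ) * h) (β * h + q * h) := by
      rw [hend]
      refine ⟨le_trans ?_ hx.1, hx.2.trans ?_⟩
      · gcongr
      · have : ((i + 1 : ℕ) : ℝ) ≤ ((β + q : ℕ) : ℝ) := by exact_mod_cast (by omega : i + 1 ≤ β + q)
        exact mul_le_mul_of_nonneg_right this hh0.le
    have hchain : IsDerivChain F (q + 1) (β * h) (β * h + q * h) := by
      refine hF.mono (hnode β (by omega)).1 ?_
      rw [hend]; exact (hnode _ hb3).2
    -- subtracting a constant leaves the derivative and turns nodal values into increments
    have hchain' : IsDerivChain (fun k s => if k = 0 then F 0 s - F 0 (β * h) else F k s) (q + 1)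
        (β * h) (β * h + q * h) := by
      refine ⟨fun k hk s hs => ?_, by simpa using hchain.cont⟩
      rcases Nat.eq_zero_or_pos k with rfl | hk0
      · simpa using (hchain.deriv 0 hk s hs).sub_const (F 0 (β * h))
      · simpa [hk0.ne'] using hchain.deriv k hk s hs
    have h1 := hint _ _ h hh0 hq hchain' x hxm
    simp only [one_ne_zero, if_false, if_true, Nat.add_eq_zero_iff, and_false, mul_one] at h1
    have h2 : ∀ κ ∈ range (q + 1), ‖F 0 (β * h + κ * h) - F 0 (β * h)‖ ^ 2
        ≤ q * ∑ k ∈ range q, δ (β + k) := by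
      intro κ hκ
      have hκ' : κ ≤ q := Nat.lt_succ_iff.1 (mem_range.1 hκ)
      have e1 : F 0 (β * h + κ * h) - F 0 (β * h)
          = ∑ k ∈ range κ, (F 0 ((β + k + 1 : ℕ) * h) - F 0 ((β + k : ℕ) * h)) := by
        have := Finset.sum_range_sub (fun k => F 0 ((β + k : ℕ) * h)) κ
        simp only [← add_assoc] at this
        rw [this]
        simp [add_mul]
      rw [e1]
      calc _ ≤ (∑ k ∈ range κ, ‖F 0 ((β + k + 1 : ℕ) * h) - F 0 ((β + k : ℕ) * h)‖) ^ 2 := by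
            gcongr; exact norm_sum_le _ _
        _ ≤ κ * ∑ k ∈ range κ, δ (β + k) := by
            simpa [δ] using sq_sum_le_card_mul_sum_sq (s := range κ)
              (f := fun k => ‖F 0 ((β + k + 1 : ℕ) * h) - F 0 ((β + k : ℕ) * h)‖)
        _ ≤ q * ∑ k ∈ range q, δ (β + k) := by
            refine mul_le_mul (by exact_mod_cast hκ') ?_ (Finset.sum_nonneg fun k _ => hδ0 _)
              (by positivity)
            exact Finset.sum_le_sum_of_subset_of_nonneg (Finset.range_mono hκ')
              fun k _ _ => hδ0 _
    have h3 : ∫ s in (β * h)..(β * h + q * h), ‖F (q + 1) s‖ ^ 2 = ∑ k ∈ range q, J (β + k) := by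
      have := intervalIntegral.sum_integral_adjacent_intervals
        (f := fun s => ‖F (q + 1) s‖ ^ 2) (a := fun k : ℕ => ((β + k : ℕ) : ℝ) * h) (n := q)
        (fun k hk => hii (q + 1) le_rfl (β + k) (by omega))
      rw [hend]
      simpa [J, add_assoc] using this.symm
    have h4 := Finset.sum_le_sum h2
    rw [Finset.sum_const, card_range, nsmul_eq_mul] at h4
    rw [h3] at h1
    rw [le_inv_mul_iff₀ (by positivity)]
    have h5 : ∑ k ∈ range q, a (β + k)
        = ∑ k ∈ range q, δ (β + k) + h ^ (2 * q + 1) * ∑ k ∈ range q, J (β + k) := by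
      simp only [a]; rw [Finset.sum_add_distrib, Finset.mul_sum]
    refine h1.trans ?_
    rw [h5, mul_assoc]
    refine mul_le_mul_of_nonneg_left ?_ hC.le
    have hS : 0 ≤ ∑ k ∈ range q, δ (β + k) := Finset.sum_nonneg fun k _ => hδ0 _
    have hJs : 0 ≤ h ^ (2 * q + 1) * ∑ k ∈ range q, J (β + k) :=
      mul_nonneg (by positivity) (Finset.sum_nonneg fun k _ => hJ0 _)
    have hqq : (0 : ℝ) ≤ (q + 1) * q := by positivity
    push_cast at h4
    nlinarith [mul_nonneg hqq hJs]
  have hsum : ∀ p ≤ q + 1, ∑ i ∈ range M, ∫ s in (i * h)..((i + 1 : ℕ) * h), ‖F p s‖ ^ 2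
      = ∫ s in (0 : ℝ)..T, ‖F p s‖ ^ 2 := by
    intro p hp
    have := intervalIntegral.sum_integral_adjacent_intervals
      (f := fun s => ‖F p s‖ ^ 2) (a := fun k : ℕ => (k : ℝ) * h) (n := M) (hii p hp)
    rw [this]; simp [hMh]
  have hloc : ∀ i ∈ range M, ∫ s in (i * h)..((i + 1 : ℕ) * h), ‖F 1 s‖ ^ 2
      ≤ h⁻¹ * (C * ((q + 1) * q + 1) * ∑ κ ∈ range q, a (b i + κ)) := by
    intro i hi
    have hi' := mem_range.1 hi
    have := intervalIntegral.integral_mono_on (by gcongr; simp) (hii 1 (by omega) i hi')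
      (by simp) (hpt i hi')
    refine this.trans (le_of_eq ?_)
    rw [intervalIntegral.integral_const, smul_eq_mul]
    push_cast
    field_simp
    ring
  have hJsum := hsum (q + 1) le_rfl
  rw [← hsum 1 (by omega)]
  refine (Finset.sum_le_sum hloc).trans ?_
  rw [← Finset.mul_sum, ← Finset.mul_sum]
  calc _ ≤ h⁻¹ * (C * ((q + 1) * q + 1) * (2 * q * ∑ k ∈ range M, a k)) := by
        gcongr
        exact sum_window_le ha0 hb
    _ = _ := by
        have h5 : ∑ k ∈ range M, a k
            = ∑ k ∈ range M, δ k + h ^ (2 * q + 1) * ∫ s in (0 : ℝ)..T, ‖F (q + 1) s‖ ^ 2 := by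
          rw [← hJsum]; simp only [a]; rw [Finset.sum_add_distrib, Finset.mul_sum]
        rw [h5, pow_succ]
        simp only [δ]
        field_simp

section

/-! ### Mixed derivatives of functions of two variables -/

variable {E : Type*} [NormedAddCommGroup E] [NormedSpace ℝ E]

/-- The word `e₁ ⋯ e₁ e₂ ⋯ e₂` of length `n` that starts with `i` letters `e₁`. -/
def sortedWord {X : Type*} (e₁ e₂ : X) (n i : ℕ) : Fin n → X :=
  fun k => if (k : ℕ) < i then e₁ else e₂

theorem cons_sortedWord {X : Type*} (e₁ e₂ : X) (n i : ℕ) :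
    (Fin.cons e₁ (sortedWord e₁ e₂ n i) : Fin (n + 1) → X) = sortedWord e₁ e₂ (n + 1) (i + 1) := by
  funext k
  refine Fin.cases ?_ (fun k => ?_) k <;> simp [sortedWord]

theorem cons_sortedWord_zero {X : Type*} (e₁ e₂ : X) (n : ℕ) :
    (Fin.cons e₂ (sortedWord e₁ e₂ n 0) : Fin (n + 1) → X) = sortedWord e₁ e₂ (n + 1) 0 := by
  funext k
  refine Fin.cases ?_ (fun k => ?_) k <;> simp [sortedWord]

section Symmetry

variable {X : Type*} [NormedAddCommGroup X] [NormedSpace ℝ X] {s : Set X} {f : X → E} {m : ℕ}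

theorem iteratedFDerivWithin_cons (hs : UniqueDiffOn ℝ s) (hf : ContDiffOn ℝ m f s) {n : ℕ}
    (hn : n + 1 ≤ m) {x : X} (hx : x ∈ s) (v : X) (w : Fin n → X) :
    iteratedFDerivWithin ℝ (n + 1) f s x (Fin.cons v w)
      = fderivWithin ℝ (fun y => iteratedFDerivWithin ℝ n f s y w) s x v := by
  rw [iteratedFDerivWithin_succ_apply_left, Fin.cons_zero, Fin.tail_cons,
    fderivWithin_continuousMultilinear_apply_const_apply (hs x hx)]
  exact hf.differentiableOn_iteratedFDerivWithin (by exact_mod_cast hn) hs x hx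

theorem iteratedFDerivWithin_cons_congr (hs : UniqueDiffOn ℝ s) (hf : ContDiffOn ℝ m f s) {n : ℕ}
    (hn : n + 1 ≤ m) {w w' : Fin n → X}
    (h : ∀ y ∈ s, iteratedFDerivWithin ℝ n f s y w = iteratedFDerivWithin ℝ n f s y w')
    {x : X} (hx : x ∈ s) (v : X) :
    iteratedFDerivWithin ℝ (n + 1) f s x (Fin.cons v w)
      = iteratedFDerivWithin ℝ (n + 1) f s x (Fin.cons v w') := by
  rw [iteratedFDerivWithin_cons hs hf hn hx, iteratedFDerivWithin_cons hs hf hn hx,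
    fderivWithin_congr h (h x hx)]

/-- The two outermost directions commute: this is the symmetry of the second derivative of
`y ↦ D^n f(y) w`. On the boundary of `s` it needs `s ⊆ closure (interior s)`. -/
theorem iteratedFDerivWithin_cons_swap (hs : UniqueDiffOn ℝ s) (hs' : s ⊆ closure (interior s))
    (hf : ContDiffOn ℝ m f s) {n : ℕ} (hn : n + 2 ≤ m) {x : X} (hx : x ∈ s) (v v' : X)
    (w : Fin n → X) :
    iteratedFDerivWithin ℝ (n + 2) f s x (Fin.cons v (Fin.cons v' w : Fin (n + 1) → X))
      = iteratedFDerivWithin ℝ (n + 2) f s x (Fin.cons v' (Fin.cons v w : Fin (n + 1) → X)) := by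
  let φ : X → E := fun y => iteratedFDerivWithin ℝ n f s y w
  have hφ : ContDiffOn ℝ 2 φ s := fun y hy =>
    (ContinuousMultilinearMap.apply ℝ (fun _ : Fin n => X) E w).contDiff.contDiffAt.comp_contDiffWithinAt y
      ((hf y hy).iteratedFDerivWithin_right (m := 2) (i := n) hs
        (by rw [add_comm]; exact_mod_cast hn) hy)
  have hd : DifferentiableOn ℝ (fderivWithin ℝ φ s) s :=
    (hφ.fderivWithin (m := 1) hs (by norm_num)).differentiableOn one_ne_zero
  have key : ∀ a b : X, iteratedFDerivWithin ℝ (n + 2) f s x (Fin.cons a (Fin.cons b w : Fin (n + 1) → X))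
      = fderivWithin ℝ (fderivWithin ℝ φ s) s x a b := by
    intro a b
    have h1 : ∀ y ∈ s, iteratedFDerivWithin ℝ (n + 1) f s y (Fin.cons b w) = fderivWithin ℝ φ s y b :=
      fun y hy => iteratedFDerivWithin_cons hs hf (by omega) hy b w
    rw [iteratedFDerivWithin_cons hs hf (by omega) hx, fderivWithin_congr h1 (h1 x hx),
      fderivWithin_clm_apply (hs x hx) (hd x hx) (differentiableWithinAt_const b)]
    simp
  rw [key, key]
  exact (hφ x hx).isSymmSndFDerivWithinAt (by simp) hs (hs' hx) hx v v'

/-- By symmetry of second derivatives, iterated derivatives along two directions may be taken in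
any order. -/
theorem exists_iteratedFDerivWithin_eq_sortedWord (hs : UniqueDiffOn ℝ s)
    (hs' : s ⊆ closure (interior s)) (hf : ContDiffOn ℝ m f s) (e₁ e₂ : X) :
    ∀ (n : ℕ), n ≤ m → ∀ v : Fin n → X, (∀ k, v k = e₁ ∨ v k = e₂) → ∃ i ≤ n, ∀ x ∈ s,
      iteratedFDerivWithin ℝ n f s x v
        = iteratedFDerivWithin ℝ n f s x (sortedWord e₁ e₂ n i) := by
  intro n
  induction n with
  | zero => exact fun _ v _ => ⟨0, le_rfl, fun x _ => by congr 1; exact Subsingleton.elim _ _⟩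
  | succ n ih =>
    intro hn v hv
    obtain ⟨i, hi, h⟩ := ih (by omega) (Fin.tail v) fun k => hv k.succ
    have h1 : ∀ x ∈ s, iteratedFDerivWithin ℝ (n + 1) f s x v
        = iteratedFDerivWithin ℝ (n + 1) f s x (Fin.cons (v 0) (sortedWord e₁ e₂ n i)) := by
      intro x hx
      rw [← iteratedFDerivWithin_cons_congr hs hf hn h hx (v 0), Fin.cons_self_tail]
    rcases hv 0 with h0 | h0
    · refine ⟨i + 1, by omega, fun x hx => ?_⟩
      rw [h1 x hx, h0, cons_sortedWord]
    rcases i with _ | i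
    · refine ⟨0, by omega, fun x hx => ?_⟩
      rw [h1 x hx, h0, cons_sortedWord_zero]
    obtain ⟨n, rfl⟩ : ∃ n', n = n' + 1 := ⟨n - 1, by omega⟩
    obtain ⟨i', hi', h'⟩ := ih (by omega) (Fin.cons e₂ (sortedWord e₁ e₂ n i)) (by
      intro k
      refine Fin.cases (Or.inr rfl) (fun k => ?_) k
      simp only [Fin.cons_succ, sortedWord]
      split_ifs <;> simp)
    refine ⟨i' + 1, by omega, fun x hx => ?_⟩
    rw [h1 x hx, h0, ← cons_sortedWord, iteratedFDerivWithin_cons_swap hs hs' hf hn hx,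
      iteratedFDerivWithin_cons_congr hs hf hn h' hx, cons_sortedWord]

end Symmetry

/-- `∑_{i+j ≤ m} ‖∂ₜⁱ ∂_μʲ w‖²` for a function `w` of `(μ, t)` with values in a normed space. -/
noncomputable def mixedSq (s : Set (ℝ × ℝ)) (m : ℕ) (w : ℝ × ℝ → E) (p : ℝ × ℝ) : ℝ :=
  ∑ n ∈ Finset.range (m + 1), ∑ ij ∈ Finset.HasAntidiagonal.antidiagonal n,
    ‖iteratedFDerivWithin ℝ (ij.1 + ij.2) w s p
      (sortedWord ((0 : ℝ), (1 : ℝ)) ((1 : ℝ), (0 : ℝ)) (ij.1 + ij.2) ij.1)‖ ^ 2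

theorem mixedSq_nonneg (s : Set (ℝ × ℝ)) (m : ℕ) (w : ℝ × ℝ → E) (p : ℝ × ℝ) :
    0 ≤ mixedSq s m w p :=
  Finset.sum_nonneg fun _ _ => Finset.sum_nonneg fun _ _ => sq_nonneg _

theorem continuousOn_mixedSq {s : Set (ℝ × ℝ)} (hs : UniqueDiffOn ℝ s) {m : ℕ} {w : ℝ × ℝ → E}
    (hw : ContDiffOn ℝ m w s) : ContinuousOn (mixedSq s m w) s := by
  refine continuousOn_finsetSum _ fun n hn => continuousOn_finsetSum _ fun ij hij => ?_
  have h1 : ij.1 + ij.2 ≤ m := by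
    have := Finset.HasAntidiagonal.mem_antidiagonal.1 hij
    have := Finset.mem_range.1 hn
    omega
  have h2 := hw.continuousOn_iteratedFDerivWithin (m := ij.1 + ij.2) (by exact_mod_cast h1) hs
  exact (((ContinuousMultilinearMap.apply ℝ (fun _ : Fin (ij.1 + ij.2) => ℝ × ℝ) E
    _).continuous.comp_continuousOn h2).norm).pow 2

/-- A multilinear map on `ℝ²` is bounded by its values on the words in the two basis vectors. -/
theorem opNorm_le_of_words {n : ℕ} (φ : ContinuousMultilinearMap ℝ (fun _ : Fin n => ℝ × ℝ) E)
    {K : ℝ} (hK : 0 ≤ K)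
    (h : ∀ b : Fin n → Bool, ‖φ fun k => if b k then ((0 : ℝ), (1 : ℝ)) else ((1 : ℝ), (0 : ℝ))‖ ≤ K) :
    ‖φ‖ ≤ 2 ^ n * K := by
  refine φ.opNorm_le_bound (by positivity) fun v => ?_
  let c : Fin n → Bool → ℝ := fun k b => if b then (v k).2 else (v k).1
  let e : Bool → ℝ × ℝ := fun b => if b then ((0 : ℝ), (1 : ℝ)) else ((1 : ℝ), (0 : ℝ))
  have hv : v = fun k => ∑ b : Bool, c k b • e b := by
    funext k
    simp [c, e]
  have hφ : φ v = ∑ r : Fin n → Bool, (∏ k, c k (r k)) • φ fun k => e (r k) := by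
    conv_lhs => rw [hv]
    have h1 := φ.toMultilinearMap.map_sum (fun k b => c k b • e b)
    have h2 : ∀ r : Fin n → Bool, φ (fun k => c k (r k) • e (r k))
        = (∏ k, c k (r k)) • φ fun k => e (r k) := fun r =>
      φ.toMultilinearMap.map_smul_univ (fun k => c k (r k)) (fun k => e (r k))
    exact h1.trans (Finset.sum_congr rfl fun r _ => h2 r)
  rw [hφ]
  have hb : ∀ r ∈ (Finset.univ : Finset (Fin n → Bool)),
      ‖(∏ k, c k (r k)) • φ fun k => e (r k)‖ ≤ K * ∏ k, ‖v k‖ := by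
    intro r _
    rw [norm_smul, norm_prod, mul_comm]
    refine mul_le_mul (h r) (Finset.prod_le_prod (fun _ _ => norm_nonneg _) fun k _ => ?_)
      (Finset.prod_nonneg fun _ _ => norm_nonneg _) hK
    simp only [c]
    split_ifs
    · exact norm_snd_le _
    · exact norm_fst_le _
  refine (norm_sum_le_of_le _ hb).trans (le_of_eq ?_)
  simp [mul_assoc]

/-- The full derivatives are controlled by the mixed derivatives `∂ₜⁱ ∂_μʲ`, since the order of
differentiation is irrelevant. -/
theorem norm_iteratedFDerivWithin_le_mixedSq {s : Set (ℝ × ℝ)} (hs : UniqueDiffOn ℝ s)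
    (hs' : s ⊆ closure (interior s)) {m : ℕ} {w : ℝ × ℝ → E} (hw : ContDiffOn ℝ m w s) {n : ℕ}
    (hn : n ≤ m) {p : ℝ × ℝ} (hp : p ∈ s) :
    ‖iteratedFDerivWithin ℝ n w s p‖ ≤ 2 ^ m * √(mixedSq s m w p) := by
  have h1 : ‖iteratedFDerivWithin ℝ n w s p‖ ≤ 2 ^ n * √(mixedSq s m w p) := by
    refine opNorm_le_of_words _ (Real.sqrt_nonneg _) fun b => ?_
    obtain ⟨i, hi, h⟩ := exists_iteratedFDerivWithin_eq_sortedWord hs hs' hw ((0 : ℝ), (1 : ℝ))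
      ((1 : ℝ), (0 : ℝ)) n hn
      (fun k => if b k then ((0 : ℝ), (1 : ℝ)) else ((1 : ℝ), (0 : ℝ)))
      (fun k => by split_ifs <;> simp)
    rw [h p hp]
    refine Real.le_sqrt_of_sq_le ?_
    obtain ⟨j, rfl⟩ := Nat.exists_eq_add_of_le hi
    have h2 := Finset.single_le_sum (s := Finset.range (m + 1))
      (f := fun n => ∑ ij ∈ Finset.HasAntidiagonal.antidiagonal n,
        ‖iteratedFDerivWithin ℝ (ij.1 + ij.2) w s p
          (sortedWord ((0 : ℝ), (1 : ℝ)) ((1 : ℝ), (0 : ℝ)) (ij.1 + ij.2) ij.1)‖ ^ 2)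
      (fun _ _ => Finset.sum_nonneg fun _ _ => sq_nonneg _) (Finset.mem_range.2 (Nat.lt_succ_of_le hn))
    refine le_trans ?_ h2
    exact Finset.single_le_sum (s := Finset.HasAntidiagonal.antidiagonal (i + j))
      (f := fun ij => ‖iteratedFDerivWithin ℝ (ij.1 + ij.2) w s p
          (sortedWord ((0 : ℝ), (1 : ℝ)) ((1 : ℝ), (0 : ℝ)) (ij.1 + ij.2) ij.1)‖ ^ 2)
      (fun _ _ => sq_nonneg _) (Finset.HasAntidiagonal.mem_antidiagonal.2 (rfl : (i, j).1 + (i, j).2 = i + j))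
  refine h1.trans ?_
  gcongr
  norm_num

end

section

/-! ### Interpolation in the parameter -/

variable {E : Type} [NormedAddCommGroup E] [NormedSpace ℝ E]

/-- Rescaling time turns the region into the rectangle `[α₀, α_L] × [0, 1]`. -/
theorem region_eq_image {G : SampleGrid} (hT : ∀ α ∈ Icc G.α₀ G.αL, 0 < G.T α) :
    G.region = (fun p : ℝ × ℝ => (p.1, G.T p.1 * p.2)) '' (Icc G.α₀ G.αL ×ˢ Icc 0 1) := by
  ext ⟨μ, t⟩
  constructor
  · rintro ⟨h1, h2⟩
    have h3 := hT μ h1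
    refine ⟨(μ, t / G.T μ), ⟨h1, div_nonneg h2.1 h3.le, (div_le_one h3).2 h2.2⟩, ?_⟩
    simp only [Prod.mk.injEq, true_and]
    field_simp
  · rintro ⟨⟨μ', τ⟩, ⟨h1, h2⟩, h3⟩
    simp only [Prod.mk.injEq] at h3
    obtain ⟨rfl, rfl⟩ := h3
    have h4 := hT μ' h1
    exact ⟨h1, mul_nonneg h4.le h2.1, mul_le_of_le_one_right h4.le h2.2⟩

/-- Derivatives within the region are unique: it is the image of a rectangle under a map with
invertible derivative. -/
theorem uniqueDiffOn_region {G : SampleGrid} (hα : G.α₀ < G.αL)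
    (hT : ∀ α ∈ Icc G.α₀ G.αL, 0 < G.T α) (hTd : DifferentiableOn ℝ G.T (Icc G.α₀ G.αL)) :
    UniqueDiffOn ℝ G.region := by
  rw [region_eq_image hT]
  let φ' : ℝ × ℝ → ℝ × ℝ →L[ℝ] ℝ × ℝ := fun p =>
    (ContinuousLinearMap.fst ℝ ℝ ℝ).prod (G.T p.1 • ContinuousLinearMap.snd ℝ ℝ ℝ
      + p.2 • ((fderivWithin ℝ G.T (Icc G.α₀ G.αL) p.1).comp (ContinuousLinearMap.fst ℝ ℝ ℝ)))
  refine ((uniqueDiffOn_Icc hα).prod (uniqueDiffOn_Icc one_pos)).image (f' := φ') ?_ ?_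
  · rintro p ⟨h1, h2⟩
    have h3 : HasFDerivWithinAt (fun q : ℝ × ℝ => G.T q.1)
        ((fderivWithin ℝ G.T (Icc G.α₀ G.αL) p.1).comp (ContinuousLinearMap.fst ℝ ℝ ℝ))
        (Icc G.α₀ G.αL ×ˢ Icc 0 1) p :=
      (hTd p.1 h1).hasFDerivWithinAt.comp p hasFDerivWithinAt_fst fun q hq => hq.1
    exact hasFDerivWithinAt_fst.prodMk (h3.mul hasFDerivWithinAt_snd)
  · rintro p ⟨h1, h2⟩
    refine Function.Surjective.denseRange fun y => ?_
    have h4 := (hT p.1 h1).ne'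
    refine ⟨(y.1, (y.2 - p.2 * fderivWithin ℝ G.T (Icc G.α₀ G.αL) p.1 y.1) / G.T p.1), ?_⟩
    ext
    · simp [φ']
    · simp [φ']
      field_simp
      ring

/-- This is what makes second derivatives symmetric up to the boundary of the region. -/
theorem region_subset_closure_interior {G : SampleGrid} (hα : G.α₀ < G.αL)
    (hT : ∀ α ∈ Icc G.α₀ G.αL, 0 < G.T α) (hTc : ContinuousOn G.T (Icc G.α₀ G.αL)) :
    G.region ⊆ closure (interior G.region) := by
  have hcl : closure (Ioo G.α₀ G.αL ×ˢ Ioo (0 : ℝ) 1) = Icc G.α₀ G.αL ×ˢ Icc 0 1 := by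
    rw [closure_prod_eq, closure_Ioo hα.ne, closure_Ioo zero_ne_one]
  have hcont : ContinuousOn (fun p : ℝ × ℝ => (p.1, G.T p.1 * p.2)) (Icc G.α₀ G.αL ×ˢ Icc 0 1) :=
    continuousOn_fst.prodMk ((hTc.comp continuousOn_fst fun p hp => hp.1).mul continuousOn_snd)
  have hopen : IsOpen {p : ℝ × ℝ | p.1 ∈ Ioo G.α₀ G.αL ∧ 0 < p.2 ∧ p.2 < G.T p.1} := by
    have h1 : IsOpen (Ioo G.α₀ G.αL ×ˢ Ioi (0 : ℝ)) := isOpen_Ioo.prod isOpen_Ioi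
    have h2 : ContinuousOn (fun p : ℝ × ℝ => G.T p.1 - p.2) (Ioo G.α₀ G.αL ×ˢ Ioi (0 : ℝ)) :=
      (hTc.comp continuousOn_fst fun p hp => Ioo_subset_Icc_self hp.1).sub continuousOn_snd
    convert h2.isOpen_inter_preimage h1 isOpen_Ioi (t := Ioi 0) using 1
    ext p
    simp [and_assoc]
  have hsub : (fun p : ℝ × ℝ => (p.1, G.T p.1 * p.2)) '' (Ioo G.α₀ G.αL ×ˢ Ioo (0 : ℝ) 1)
      ⊆ interior G.region := by
    refine Subset.trans ?_ (interior_maximal (t := {p : ℝ × ℝ | p.1 ∈ Ioo G.α₀ G.αL ∧ 0 < p.2 ∧ p.2 < G.T p.1}) ?_ hopen)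
    · rintro _ ⟨p, ⟨h1, h2⟩, rfl⟩
      have h3 := hT p.1 (Ioo_subset_Icc_self h1)
      exact ⟨h1, mul_pos h3 h2.1, mul_lt_of_lt_one_right h3 h2.2⟩
    · rintro p ⟨h1, h2, h3⟩
      exact ⟨Ioo_subset_Icc_self h1, h2.le, h3.le⟩
  rw [region_eq_image hT, ← hcl] at *
  exact (hcont.image_closure).trans (closure_mono hsub)

/-- The curve `μ ↦ (μ, T^μ t / T^α)`, along which functions on the region are interpolated, stays in
the region. -/
theorem mapsTo_region {G : SampleGrid} (hT : ∀ α ∈ Icc G.α₀ G.αL, 0 < G.T α) {α t : ℝ}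
    (hα : α ∈ Icc G.α₀ G.αL) (ht : t ∈ Icc 0 (G.T α)) :
    MapsTo (fun μ => (μ, G.T μ * t / G.T α)) (Icc G.α₀ G.αL) G.region := by
  intro μ hμ
  have h1 := hT μ hμ
  have h2 := hT α hα
  refine ⟨hμ, div_nonneg (mul_nonneg h1.le ht.1) h2.le, ?_⟩
  rw [div_le_iff₀ h2]
  exact mul_le_mul_of_nonneg_left ht.2 h1.le

/-- Geometric bounds for the derivatives of the curve `μ ↦ (μ, T^μ θ)`, in the form that Faà di Bruno's
formula asks for. -/
theorem norm_iteratedFDerivWithin_curve_le {a b : ℝ} (hab : a < b) {T : ℝ → ℝ} {m : ℕ}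
    (hT : ContDiffOn ℝ m T (Icc a b)) {B : ℝ}
    (hB : ∀ α ∈ Icc a b, ∀ i : ℕ, 1 ≤ i → i ≤ m → |iteratedDerivWithin i T (Icc a b) α| ≤ B)
    {θ : ℝ} (hθ : |θ| ≤ 1) {i : ℕ} (hi : 1 ≤ i) (him : i ≤ m) {μ : ℝ} (hμ : μ ∈ Icc a b) :
    ‖iteratedFDerivWithin ℝ i (fun μ => (μ, T μ * θ)) (Icc a b) μ‖ ≤ (1 + |B|) ^ i := by
  have hu := uniqueDiffOn_Icc hab
  have h0 : (1 : ℝ) + |B| ≤ (1 + |B|) ^ i := le_self_pow₀ (by linarith [abs_nonneg B]) (by omega)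
  have hTθ : ContDiffOn ℝ m (fun μ => T μ * θ) (Icc a b) := hT.mul contDiffOn_const
  rw [iteratedFDerivWithin_prodMk (n := m) (f := fun μ : ℝ => μ) contDiffWithinAt_id (hTθ μ hμ) hu hμ
    (by exact_mod_cast him), ContinuousMultilinearMap.opNorm_prod]
  refine max_le ?_ ?_ |>.trans h0
  · rw [norm_iteratedFDerivWithin_eq_norm_iteratedDerivWithin,
      iteratedDerivWithin_fun_id hμ hu]
    split_ifs
    · omega
    · simp
    · simp; positivity
  · rw [norm_iteratedFDerivWithin_eq_norm_iteratedDerivWithin,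
      iteratedDerivWithin_mul_const_field, norm_mul, Real.norm_eq_abs, Real.norm_eq_abs]
    have h1 := hB μ hμ i hi him
    calc |iteratedDerivWithin i T (Icc a b) μ| * |θ| ≤ |B| * 1 :=
          mul_le_mul (h1.trans (le_abs_self B)) hθ (abs_nonneg _) (abs_nonneg _)
      _ ≤ 1 + |B| := by linarith

theorem paramNode_add (G : SampleGrid) (l i : ℕ) :
    G.paramNode (l + i) = G.paramNode l + i * G.paramStep := by
  simp only [SampleGrid.paramNode]; push_cast; ring

theorem paramStep_pos {G : SampleGrid} (hα : G.α₀ < G.αL) (hL : 0 < G.L) : 0 < G.paramStep :=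
  div_pos (sub_pos.2 hα) (by exact_mod_cast hL)

theorem paramNode_mem {G : SampleGrid} (hα : G.α₀ < G.αL) {l : ℕ} (hL : 0 < G.L) (hl : l ≤ G.L) :
    G.paramNode l ∈ Icc G.α₀ G.αL := by
  have h1 := paramStep_pos hα hL
  have h2 : (G.L : ℝ) * G.paramStep = G.αL - G.α₀ := by
    have : (G.L : ℝ) ≠ 0 := by exact_mod_cast hL.ne'
    rw [SampleGrid.paramStep]; field_simp
  have h3 : (l : ℝ) * G.paramStep ≤ G.L * G.paramStep := by gcongr
  have h4 : 0 ≤ (l : ℝ) * G.paramStep := by positivity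
  constructor <;> simp only [SampleGrid.paramNode] <;> linarith

/-- Interpolation of degree `m - 1` in the parameter, along the curve `μ ↦ (μ, T^μ t / T^α)`. -/
theorem exists_param_const (m : ℕ) (hm : 2 ≤ m) (B : ℝ) :
    ∃ C : ℝ, 0 < C ∧ ∀ {E : Type} [NormedAddCommGroup E] [NormedSpace ℝ E] [CompleteSpace E]
      (G : SampleGrid), G.α₀ < G.αL → ContDiffOn ℝ m G.T (Icc G.α₀ G.αL) →
      (∀ α ∈ Icc G.α₀ G.αL, 0 < G.T α) →
      (∀ α ∈ Icc G.α₀ G.αL, ∀ i : ℕ, 1 ≤ i → i ≤ m →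
        |iteratedDerivWithin i G.T (Icc G.α₀ G.αL) α| ≤ B) →
      ∀ (w : ℝ × ℝ → E), ContDiffOn ℝ m w G.region → ∀ (Q : E →L[ℝ] E), (∀ v, ‖Q v‖ ≤ ‖v‖) →
      ∀ (l : ℕ), l + m - 1 ≤ G.L → ∀ α ∈ Icc (G.paramNode l) (G.paramNode (l + m - 1)),
      ∀ t ∈ Icc 0 (G.T α),
        ‖Q (w (α, t))‖ ^ 2 ≤ C * (∑ j ∈ Finset.Ico l (l + m),
            ‖Q (w (G.paramNode j, G.T (G.paramNode j) * t / G.T α))‖ ^ 2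
          + G.paramStep ^ (2 * m - 1) * ∫ μ in G.paramNode l..G.paramNode (l + m - 1),
              mixedSq G.region m w (μ, G.T μ * t / G.T α)) := by
  obtain ⟨C, hC, hint⟩ := exists_interp_const (m - 1) 0 (Nat.zero_le _)
  let D : ℝ := (m.factorial * 2 ^ m * (1 + |B|) ^ m) ^ 2
  have hD : 0 ≤ D := sq_nonneg _
  refine ⟨C * (1 + D), by positivity, ?_⟩
  intro E _ _ _ G hα hTc hT hB w hw Q hQ l hl α hαm t ht
  have hL : 0 < G.L := by omega
  have hh := paramStep_pos hα hL
  have hu := uniqueDiffOn_Icc hα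
  have hlm : l + m - 1 = l + (m - 1) := by omega
  have hnl : G.paramNode l ∈ Icc G.α₀ G.αL := paramNode_mem hα hL (by omega)
  have hnr : G.paramNode (l + m - 1) ∈ Icc G.α₀ G.αL := paramNode_mem hα hL hl
  have hαm' : α ∈ Icc G.α₀ G.αL := ⟨hnl.1.trans hαm.1, hαm.2.trans hnr.2⟩
  have hregu := uniqueDiffOn_region hα hT (hTc.differentiableOn (by simp; omega))
  have hregc := region_subset_closure_interior hα hT hTc.continuousOn
  have hmaps := mapsTo_region hT hαm' ht
  -- the curve passes through `(α, t)` and meets the sampled parameters at the interpolation nodes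
  let γ : ℝ → ℝ × ℝ := fun μ => (μ, G.T μ * t / G.T α)
  have hγeq : γ = fun μ => (μ, G.T μ * (t / G.T α)) := by funext μ; simp [γ, mul_div_assoc]
  have hγ : ContDiffOn ℝ m γ (Icc G.α₀ G.αL) := by
    rw [hγeq]; exact contDiffOn_id.prodMk (hTc.mul contDiffOn_const)
  have hTα := hT α hαm'
  have hθ : |t / G.T α| ≤ 1 := by
    rw [abs_of_nonneg (div_nonneg ht.1 hTα.le)]; exact (div_le_one hTα).2 ht.2
  have hf : ContDiffOn ℝ m (w ∘ γ) (Icc G.α₀ G.αL) := hw.comp hγ hmaps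
  have hchain := ((isDerivChain_iteratedDerivWithin hα hf).map Q).mono hnl.1 hnr.2
  have hend : G.paramNode (l + m - 1) = G.paramNode l + (m - 1 : ℕ) * G.paramStep := by
    rw [hlm, paramNode_add]
  have hmm : m - 1 + 1 = m := by omega
  have hbd : ∀ μ ∈ Icc G.α₀ G.αL, ‖Q (iteratedDerivWithin m (w ∘ γ) (Icc G.α₀ G.αL) μ)‖ ^ 2
      ≤ D * mixedSq G.region m w (γ μ) := by
    intro μ hμ
    have h1 := norm_iteratedFDerivWithin_comp_le hw hγ le_rfl hregu hu hmaps hμ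
      (fun i hi => norm_iteratedFDerivWithin_le_mixedSq hregu hregc hw hi (hmaps hμ))
      (fun i hi him => by
        rw [hγeq]; exact norm_iteratedFDerivWithin_curve_le hα hTc hB hθ hi him hμ)
    rw [norm_iteratedFDerivWithin_eq_norm_iteratedDerivWithin] at h1
    have h2 := (hQ _).trans h1
    calc _ ≤ (m.factorial * (2 ^ m * √(mixedSq G.region m w (γ μ))) * (1 + |B|) ^ m) ^ 2 := by
          gcongr
      _ = D * √(mixedSq G.region m w (γ μ)) ^ 2 := by simp only [D]; ring
      _ = _ := by rw [Real.sq_sqrt (mixedSq_nonneg _ _ _ _)]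
  have hcontS : ContinuousOn (fun μ => mixedSq G.region m w (γ μ)) (Icc G.α₀ G.αL) :=
    (continuousOn_mixedSq hregu hw).comp hγ.continuousOn hmaps
  have hle : G.paramNode l ≤ G.paramNode (l + m - 1) := hαm.1.trans hαm.2
  have hsub : Icc (G.paramNode l) (G.paramNode (l + m - 1)) ⊆ Icc G.α₀ G.αL :=
    Icc_subset_Icc hnl.1 hnr.2
  have hI := intervalIntegral.integral_mono_on (μ := volume) hle
    ((hchain.cont.norm.pow 2).intervalIntegrable_of_Icc hle)
    (((hcontS.mono hsub).const_smul D).intervalIntegrable_of_Icc hle)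
    (fun μ hμ => hbd μ (hsub hμ))
  rw [hend] at hchain hαm
  have h1 := hint _ (G.paramNode l) G.paramStep hh (by omega)
    (by rw [hmm]; exact hchain) α hαm
  rw [← hend, hmm] at h1
  simp only [mul_zero, pow_zero, one_mul, iteratedDerivWithin_zero] at h1
  have hγα : γ α = (α, t) := by simp only [γ]; rw [mul_div_cancel_left₀ _ hTα.ne']
  rw [Function.comp_apply, hγα] at h1
  have hsum : ∑ i ∈ Finset.range m, ‖Q ((w ∘ γ) (G.paramNode l + i * G.paramStep))‖ ^ 2
      = ∑ j ∈ Finset.Ico l (l + m),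
            ‖Q (w (G.paramNode j, G.T (G.paramNode j) * t / G.T α))‖ ^ 2 := by
    rw [Finset.sum_Ico_eq_sum_range]
    simp [γ, paramNode_add]
  have hexp : 2 * (m - 1) + 1 = 2 * m - 1 := by omega
  rw [hsum, hexp] at h1
  refine h1.trans ?_
  rw [mul_assoc]
  refine mul_le_mul_of_nonneg_left ?_ hC.le
  simp only [smul_eq_mul, Pi.smul_apply, Pi.pow_apply, intervalIntegral.integral_const_mul] at hI
  have hS0 : 0 ≤ ∑ j ∈ Finset.Ico l (l + m),
      ‖Q (w (G.paramNode j, G.T (G.paramNode j) * t / G.T α))‖ ^ 2 :=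
    Finset.sum_nonneg fun _ _ => sq_nonneg _
  have hJ0 : 0 ≤ ∫ μ in G.paramNode l..G.paramNode (l + m - 1),
      mixedSq G.region m w (μ, G.T μ * t / G.T α) :=
    intervalIntegral.integral_nonneg hle fun _ _ => mixedSq_nonneg _ _ _ _
  have hp : 0 ≤ G.paramStep ^ (2 * m - 1) := by positivity
  have h3 := mul_le_mul_of_nonneg_left hI hp
  have h4 := mul_nonneg hp hJ0
  have h5 := mul_nonneg hD hS0
  simp only [γ] at h3 ⊢
  linarith

end

/-! ### The spectral tail of the correlation matrix -/

section POD

theorem inner_sum_smul_sum {ι : Type*} [Fintype ι] {E : Type*} [NormedAddCommGroup E]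
    [InnerProductSpace ℝ E] (a b : ι → ℝ) (y : ι → E) :
    inner ℝ (∑ i, a i • y i) (∑ j, b j • y j) = ∑ i, a i * ∑ j, inner ℝ (y i) (y j) * b j := by
  rw [sum_inner]
  refine Finset.sum_congr rfl fun i _ => ?_
  rw [real_inner_smul_left, inner_sum]
  congr 1
  exact Finset.sum_congr rfl fun j _ => by rw [real_inner_smul_right, mul_comm]

variable {ι : Type*} [Fintype ι] [DecidableEq ι] {E : Type*} [NormedAddCommGroup E]
  [InnerProductSpace ℝ E] {S : Matrix ι ι ℝ} {dr : ℕ} {lam : Fin dr → ℝ}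
  {vec : Fin dr → EuclideanSpace ℝ ι}

/-- The eigenvectors span the range of `S`, because their number is the rank of `S`. -/
theorem _root_.IsPosEigensystem.range_toLpLin (h : IsPosEigensystem S lam vec) :
    LinearMap.range (Matrix.toLpLin 2 2 S) = Submodule.span ℝ (Set.range vec) := by
  symm
  apply Submodule.eq_of_le_of_finrank_eq
  · rw [Submodule.span_le]
    rintro _ ⟨k, rfl⟩
    refine ⟨(lam k)⁻¹ • vec k, ?_⟩
    ext i
    have := h.eigen k i
    rw [map_smul]
    simp only [PiLp.smul_apply, smul_eq_mul, Matrix.toLpLin_apply, Matrix.mulVec, dotProduct]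
    rw [this]
    have := (h.pos k).ne'
    field_simp
  · rw [finrank_span_eq_card h.orthonormal.linearIndependent, Fintype.card_fin, ← h.complete,
      Matrix.toLpLin_eq_toLin, ← Matrix.rank_eq_finrank_range_toLin]

/-- A symmetric `S` vanishes on the orthogonal complement of its range. -/
theorem _root_.IsPosEigensystem.mulVec_eq_zero (h : IsPosEigensystem S lam vec)
    (hS : ∀ i j, S i j = S j i) {c : ι → ℝ} (hc : ∀ k, ∑ i, vec k i * c i = 0) (i : ι) :
    ∑ j, S i j * c j = 0 := by
  have h1 : Matrix.toLpLin 2 2 S (EuclideanSpace.single i 1) ∈ Submodule.span ℝ (Set.range vec) := by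
    rw [← h.range_toLpLin]; exact ⟨_, rfl⟩
  obtain ⟨a, ha⟩ := (Submodule.mem_span_range_iff_exists_fun ℝ).1 h1
  have h2 : ∀ j, S i j = ∑ k, a k * vec k j := by
    intro j
    have := congrArg (fun v : EuclideanSpace ℝ ι => v j) ha
    simp only [Matrix.toLpLin_apply] at this
    rw [hS i j]
    simpa using this.symm
  simp only [h2, Finset.sum_mul]
  rw [Finset.sum_comm]
  refine Finset.sum_eq_zero fun k _ => ?_
  simp only [mul_assoc]
  rw [← Finset.mul_sum, hc k, mul_zero]

/-- The part of the snapshots that is not captured by the first `r` modes is the tail of the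
eigenvalues. -/
theorem _root_.IsPosEigensystem.sum_norm_sq_le (h : IsPosEigensystem S lam vec) {N : ℝ} (hN : 0 < N)
    {y : ι → E} (hS : ∀ i j, S i j = 1 / N * inner ℝ (y i) (y j)) {r : ℕ} {Q : E →L[ℝ] E}
    (hQ : ∀ v, ‖Q v‖ ≤ ‖v‖) (hQ0 : ∀ k : Fin dr, (k : ℕ) < r → Q (∑ i, vec k i • y i) = 0) :
    ∑ i, ‖Q (y i)‖ ^ 2 ≤ N * ∑ k ∈ Finset.univ.filter (fun k : Fin dr => r ≤ (k : ℕ)), lam k := by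
  let z : Fin dr → E := fun k => ∑ i, vec k i • y i
  have hSy : ∀ i j, inner ℝ (y i) (y j) = N * S i j := fun i j => by
    rw [hS]; field_simp
  have hsymm : ∀ i j, S i j = S j i := fun i j => by rw [hS, hS, real_inner_comm]
  have horth : ∀ k l, ∑ i, vec k i * vec l i = if k = l then 1 else 0 := by
    intro k l
    have := (orthonormal_iff_ite.1 h.orthonormal) l k
    simp only [PiLp.inner_apply, RCLike.inner_apply, conj_trivial] at this
    rw [this]; simp [eq_comm]
  have hz : ∀ k l, inner ℝ (z k) (z l) = if k = l then N * lam k else 0 := by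
    intro k l
    have h1 : inner ℝ (z k) (z l) = ∑ i, vec k i * (N * ∑ j, S i j * vec l j) := by
      simp only [z, inner_sum_smul_sum, hSy, Finset.mul_sum, mul_assoc]
    rw [h1]
    simp only [h.eigen]
    have h2 : ∑ i, vec k i * (N * (lam l * vec l i)) = N * lam l * ∑ i, vec k i * vec l i := by
      rw [Finset.mul_sum]; exact Finset.sum_congr rfl fun i _ => by ring
    rw [h2, horth]
    split_ifs with hkl
    · subst hkl; ring
    · ring
  -- the snapshots lie in the span of the modes, since the kernel of `S` consists of relations
  have hy : ∀ i, y i = ∑ k, vec k i • z k := by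
    intro i
    let c : ι → ℝ := fun j => (if j = i then 1 else 0) - ∑ k, vec k i * vec k j
    have hc : ∀ k, ∑ j, vec k j * c j = 0 := by
      intro k
      simp only [c, mul_sub, Finset.sum_sub_distrib, Finset.mul_sum]
      rw [Finset.sum_comm]
      have : ∀ l, ∑ j, vec k j * (vec l i * vec l j) = vec l i * (if k = l then 1 else 0) := by
        intro l
        rw [← horth, Finset.mul_sum]; exact Finset.sum_congr rfl fun j _ => by ring
      simp [this]
    have hc0 := h.mulVec_eq_zero hsymm hc
    have h0 : ∑ j, c j • y j = 0 := by
      rw [← inner_self_eq_zero (𝕜 := ℝ)]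
      rw [inner_sum_smul_sum]
      refine Finset.sum_eq_zero fun j _ => ?_
      simp only [hSy, mul_assoc]
      rw [← Finset.mul_sum, hc0, mul_zero, mul_zero]
    simp only [c, sub_smul, Finset.sum_sub_distrib, ite_smul, one_smul, zero_smul,
      Finset.sum_ite_eq', Finset.mem_univ, if_true, sub_eq_zero] at h0
    rw [h0]
    simp only [z, Finset.smul_sum, smul_smul, Finset.sum_smul]
    rw [Finset.sum_comm]
  have hQy : ∀ i, ‖Q (y i)‖ ^ 2 ≤
      ∑ k ∈ Finset.univ.filter (fun k : Fin dr => r ≤ (k : ℕ)), N * lam k * vec k i ^ 2 := by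
    intro i
    set A := Finset.univ.filter (fun k : Fin dr => r ≤ (k : ℕ)) with hA
    have h1 : Q (y i) = Q (∑ k ∈ A, vec k i • z k) := by
      conv_lhs => rw [hy i]
      simp only [map_sum, map_smul]
      symm
      refine Finset.sum_subset (Finset.subset_univ _) fun k _ hk => ?_
      have : Q (z k) = 0 := hQ0 k (by simpa [hA] using hk)
      rw [this, smul_zero]
    have h2 : ‖∑ k ∈ A, vec k i • z k‖ ^ 2 = ∑ k ∈ A, N * lam k * vec k i ^ 2 := by
      rw [← real_inner_self_eq_norm_sq]
      simp only [sum_inner, inner_sum, inner_smul_left, inner_smul_right, conj_trivial, hz]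
      refine Finset.sum_congr rfl fun k hk => ?_
      simp only [mul_ite, mul_zero, Finset.sum_ite_eq', hk, if_true]
      ring
    rw [h1, ← h2]
    gcongr
    exact hQ _
  refine (Finset.sum_le_sum fun i _ => hQy i).trans (le_of_eq ?_)
  rw [Finset.sum_comm, Finset.mul_sum]
  refine Finset.sum_congr rfl fun k _ => ?_
  rw [← Finset.mul_sum]
  have := horth k k
  simp only [← pow_two, if_true] at this
  rw [this, mul_one]

end POD

section

/-! ### From the snapshots to the difference quotients at a fixed parameter -/

variable {E : Type*} [NormedAddCommGroup E] [NormedSpace ℝ E]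

/-- The snapshots built from nodal values `x l j` in a normed space, indexed by time `j` and
parameter `l`. -/
noncomputable def gridSnapshot (G : SampleGrid) (x : ℕ → ℕ → E) (j l : ℕ) : E :=
  if j = 0 then √(G.numSnapshots : ℝ) • x l 0
  else if l = 0 then √((G.L : ℝ) + 1) • (G.timeStep 0)⁻¹ • (x 0 j - x 0 (j - 1))
  else (G.timeStep l)⁻¹ • (G.paramStep⁻¹ • (x l j - x (l - 1) j)
    - G.paramStep⁻¹ • (x l (j - 1) - x (l - 1) (j - 1)))

theorem map_gridSnapshot {E' : Type*} [NormedAddCommGroup E'] [NormedSpace ℝ E'] (G : SampleGrid)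
    (x : ℕ → ℕ → E) (j l : ℕ) (Q : E →ₗ[ℝ] E') :
    Q (gridSnapshot G x j l) = gridSnapshot G (fun l j => Q (x l j)) j l := by
  simp only [gridSnapshot]
  split_ifs <;> simp only [map_smul, map_sub]

open Finset in
/-- If the squared norms of the snapshots sum up to at most `N σ`, then `σ` bounds, uniformly in the
parameter node, the initial values and the mean squares of the difference quotients in time. -/
theorem grid_bounds {G : SampleGrid} (hα : G.α₀ < G.αL) (hL : 0 < G.L) (hM : 0 < G.M)
    {Tmin Tmax : ℝ} (hTmin : 0 < Tmin) (hT : ∀ l ≤ G.L, Tmin ≤ G.finalTime l ∧ G.finalTime l ≤ Tmax)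
    {x : ℕ → ℕ → E} {σ : ℝ} (hσ : 0 ≤ σ)
    (hx : ∑ i : Fin (G.M + 1) × Fin (G.L + 1), ‖gridSnapshot G x i.1 i.2‖ ^ 2
      ≤ (G.numSnapshots : ℝ) * σ) {l : ℕ} (hl : l ≤ G.L) :
    ‖x l 0‖ ^ 2 ≤ σ ∧
    (G.finalTime l / G.M)⁻¹ * ∑ j ∈ range G.M, ‖x l (j + 1) - x l j‖ ^ 2
      ≤ 4 * Tmax ^ 2 / Tmin * (1 + 2 * (G.αL - G.α₀) ^ 2) * σ := by
  have hL' : (0 : ℝ) < G.L := by exact_mod_cast hL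
  have hM' : (0 : ℝ) < G.M := by exact_mod_cast hM
  have hN : (G.numSnapshots : ℝ) = (G.M + 1) * (G.L + 1) := by
    simp [SampleGrid.numSnapshots]
  have hN0 : (0 : ℝ) < G.numSnapshots := by rw [hN]; positivity
  have hΔ := paramStep_pos hα hL
  let f : ℕ → ℕ → ℝ := fun j l => ‖gridSnapshot G x j l‖ ^ 2
  have hf0 : ∀ j l, 0 ≤ f j l := fun j l => sq_nonneg _
  have hsum : ∑ j ∈ range (G.M + 1), ∑ l ∈ range (G.L + 1), f j l ≤ (G.numSnapshots : ℝ) * σ := by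
    refine le_trans (le_of_eq ?_) hx
    rw [Fintype.sum_prod_type, Finset.sum_range]
    refine Finset.sum_congr rfl fun j _ => ?_
    rw [Finset.sum_range]
  constructor
  · have h1 : f 0 l ≤ ∑ j ∈ range (G.M + 1), ∑ l ∈ range (G.L + 1), f j l :=
      (Finset.single_le_sum (f := fun l => f 0 l) (fun l _ => hf0 0 l)
        (mem_range.2 (Nat.lt_succ_of_le hl))).trans
      (Finset.single_le_sum (f := fun j => ∑ l ∈ range (G.L + 1), f j l)
        (fun j _ => Finset.sum_nonneg fun l _ => hf0 j l) (mem_range.2 (Nat.succ_pos _)))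
    have h2 : f 0 l = (G.numSnapshots : ℝ) * ‖x l 0‖ ^ 2 := by
      simp only [f, gridSnapshot, if_true]
      rw [norm_smul, mul_pow, Real.norm_of_nonneg (Real.sqrt_nonneg _), Real.sq_sqrt hN0.le]
    rw [h2] at h1
    exact le_of_mul_le_mul_left (h1.trans hsum) hN0
  · set τ := Tmax / G.M with hτ
    have hTl := hT l hl
    have hTm : 0 < Tmax := hTmin.trans_le (hTl.1.trans hTl.2)
    have hτ0 : 0 < τ := by positivity
    have hstep : ∀ l ≤ G.L, 0 < G.timeStep l ∧ G.timeStep l ≤ τ := by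
      intro l hl
      have := hT l hl
      exact ⟨div_pos (hTmin.trans_le this.1) hM', by
        rw [SampleGrid.timeStep, hτ]; exact div_le_div_of_nonneg_right this.2 hM'.le⟩
    let d : ℕ → ℕ → E := fun l j => x l (j + 1) - x l j
    have hd0 : ∀ j, ‖d 0 j‖ ^ 2 ≤ τ ^ 2 / (G.L + 1) * f (j + 1) 0 := by
      intro j
      have h1 : f (j + 1) 0 = (G.L + 1) * ((G.timeStep 0) ^ 2)⁻¹ * ‖d 0 j‖ ^ 2 := by
        simp only [f, gridSnapshot, Nat.succ_ne_zero, if_false, if_true, Nat.add_sub_cancel]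
        rw [norm_smul, norm_smul, Real.norm_of_nonneg (Real.sqrt_nonneg _), norm_inv, mul_pow,
          mul_pow, Real.sq_sqrt (by positivity), inv_pow, Real.norm_eq_abs, sq_abs, mul_assoc]
      have h2 := (hstep 0 (Nat.zero_le _)).1
      rw [h1]
      calc ‖d 0 j‖ ^ 2 = G.timeStep 0 ^ 2 / (G.L + 1)
            * ((G.L + 1) * ((G.timeStep 0) ^ 2)⁻¹ * ‖d 0 j‖ ^ 2) := by field_simp
        _ ≤ _ := by gcongr; exact (hstep 0 (Nat.zero_le _)).2
    have hd1 : ∀ j, ∀ i < G.L, ‖d (i + 1) j - d i j‖ ^ 2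
        ≤ τ ^ 2 * G.paramStep ^ 2 * f (j + 1) (i + 1) := by
      intro j i hi
      have h1 : f (j + 1) (i + 1) = ((G.timeStep (i + 1)) ^ 2)⁻¹ * (G.paramStep ^ 2)⁻¹
          * ‖d (i + 1) j - d i j‖ ^ 2 := by
        simp only [f, gridSnapshot, Nat.succ_ne_zero, if_false, Nat.add_sub_cancel]
        have e : x (i + 1) (j + 1) - x i (j + 1) - (x (i + 1) j - x i j) = d (i + 1) j - d i j := by
          simp only [d]; abel
        rw [← smul_sub, e, norm_smul, norm_smul, norm_inv, norm_inv, mul_pow, mul_pow, inv_pow,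
          inv_pow, Real.norm_eq_abs, Real.norm_eq_abs, sq_abs, sq_abs, mul_assoc]
      have h2 := (hstep (i + 1) hi).1
      rw [h1]
      calc ‖d (i + 1) j - d i j‖ ^ 2 = G.timeStep (i + 1) ^ 2 * G.paramStep ^ 2
            * (((G.timeStep (i + 1)) ^ 2)⁻¹ * (G.paramStep ^ 2)⁻¹
            * ‖d (i + 1) j - d i j‖ ^ 2) := by field_simp
        _ ≤ _ := by gcongr; exact (hstep (i + 1) hi).2
    -- increments in time at the node `l` are those at the node `0` plus a telescoping sum in the
    -- parameter, whose terms are mixed difference quotients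
    have hd : ∀ j, ‖d l j‖ ^ 2 ≤ 2 * τ ^ 2 * (1 / (G.L + 1) + G.L * G.paramStep ^ 2)
        * ∑ i ∈ range (G.L + 1), f (j + 1) i := by
      intro j
      have h1 : d l j = d 0 j + ∑ i ∈ range l, (d (i + 1) j - d i j) := by
        rw [Finset.sum_range_sub (fun i => d i j)]; abel
      have h2 : ‖∑ i ∈ range l, (d (i + 1) j - d i j)‖ ^ 2
          ≤ G.L * (τ ^ 2 * G.paramStep ^ 2 * ∑ i ∈ range G.L, f (j + 1) (i + 1)) := by
        calc _ ≤ (∑ i ∈ range l, ‖d (i + 1) j - d i j‖) ^ 2 := by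
              gcongr; exact norm_sum_le _ _
          _ ≤ l * ∑ i ∈ range l, ‖d (i + 1) j - d i j‖ ^ 2 := by
              simpa using sq_sum_le_card_mul_sum_sq (s := range l)
                (f := fun i => ‖d (i + 1) j - d i j‖)
          _ ≤ G.L * ∑ i ∈ range G.L, ‖d (i + 1) j - d i j‖ ^ 2 := by
              refine mul_le_mul (by exact_mod_cast hl) ?_
                (Finset.sum_nonneg fun k _ => sq_nonneg _) (by positivity)
              exact Finset.sum_le_sum_of_subset_of_nonneg (Finset.range_mono hl)
                fun k _ _ => sq_nonneg _
          _ ≤ _ := by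
              refine mul_le_mul_of_nonneg_left ?_ hL'.le
              rw [Finset.mul_sum]
              exact Finset.sum_le_sum fun i hi => hd1 j i (mem_range.1 hi)
      have h3 : ‖d l j‖ ^ 2 ≤ 2 * ‖d 0 j‖ ^ 2
          + 2 * ‖∑ i ∈ range l, (d (i + 1) j - d i j)‖ ^ 2 := by
        rw [h1]
        have := norm_add_le (d 0 j) (∑ i ∈ range l, (d (i + 1) j - d i j))
        refine (pow_le_pow_left₀ (norm_nonneg _) this 2).trans ?_
        linarith [sq_nonneg (‖d 0 j‖ - ‖∑ i ∈ range l, (d (i + 1) j - d i j)‖)]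
      have h4 : 0 ≤ ∑ i ∈ range G.L, f (j + 1) (i + 1) := Finset.sum_nonneg fun i _ => hf0 _ _
      have h5 := hf0 (j + 1) 0
      rw [Finset.sum_range_succ']
      have h6 := hd0 j
      calc ‖d l j‖ ^ 2 ≤ 2 * (τ ^ 2 / (G.L + 1) * f (j + 1) 0)
            + 2 * (G.L * (τ ^ 2 * G.paramStep ^ 2 * ∑ i ∈ range G.L, f (j + 1) (i + 1))) := by
            linarith
        _ = 2 * τ ^ 2 * (1 / (G.L + 1) * f (j + 1) 0
            + G.L * G.paramStep ^ 2 * ∑ i ∈ range G.L, f (j + 1) (i + 1)) := by ring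
        _ ≤ 2 * τ ^ 2 * ((1 / (G.L + 1) + G.L * G.paramStep ^ 2) * (∑ i ∈ range G.L, f (j + 1) (i + 1)
            + f (j + 1) 0)) := by
            have e1 : (0 : ℝ) ≤ 1 / (G.L + 1) := by positivity
            have e2 : (0 : ℝ) ≤ G.L * G.paramStep ^ 2 := by positivity
            have e3 := mul_nonneg e1 h4
            have e4 := mul_nonneg e2 h5
            refine mul_le_mul_of_nonneg_left ?_ (by positivity)
            linarith
        _ = _ := by ring
    have htot : ∑ j ∈ range G.M, ∑ i ∈ range (G.L + 1), f (j + 1) i ≤ (G.numSnapshots : ℝ) * σ := by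
      rw [Finset.sum_range_succ'] at hsum
      have : 0 ≤ ∑ l ∈ range (G.L + 1), f 0 l := Finset.sum_nonneg fun _ _ => hf0 _ _
      linarith
    have hLΔ : (G.L : ℝ) * G.paramStep ^ 2 = (G.αL - G.α₀) ^ 2 / G.L := by
      rw [SampleGrid.paramStep]; field_simp
    -- the weights of the snapshots are such that `N` cancels up to the factor `M`
    have hcoef : (1 / (G.L + 1) + G.L * G.paramStep ^ 2) * (G.numSnapshots : ℝ)
        ≤ (1 + 2 * (G.αL - G.α₀) ^ 2) * (2 * G.M) := by
      rw [hLΔ, hN]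
      have h1 : (1 : ℝ) ≤ G.L := by exact_mod_cast hL
      have h2 : (1 : ℝ) ≤ G.M := by exact_mod_cast hM
      have h3 : (1 / ((G.L : ℝ) + 1) + (G.αL - G.α₀) ^ 2 / G.L) * ((G.M + 1) * (G.L + 1))
          = (1 + (G.αL - G.α₀) ^ 2 * ((G.L + 1) / G.L)) * (G.M + 1) := by field_simp
      have h4 : ((G.L : ℝ) + 1) / G.L ≤ 2 := by rw [div_le_iff₀ hL']; linarith
      rw [h3]
      have h5 : (G.αL - G.α₀) ^ 2 * (((G.L : ℝ) + 1) / G.L) ≤ (G.αL - G.α₀) ^ 2 * 2 := by gcongr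
      refine mul_le_mul (by linarith) (by linarith) (by positivity) (by positivity)
    have hinv : (G.finalTime l / G.M)⁻¹ ≤ G.M / Tmin := by
      rw [inv_div]
      exact div_le_div_of_nonneg_left hM'.le hTmin hTl.1
    calc (G.finalTime l / G.M)⁻¹ * ∑ j ∈ range G.M, ‖d l j‖ ^ 2
        ≤ G.M / Tmin * ∑ j ∈ range G.M, (2 * τ ^ 2 * (1 / (G.L + 1) + G.L * G.paramStep ^ 2)
          * ∑ i ∈ range (G.L + 1), f (j + 1) i) := by
          refine mul_le_mul hinv (Finset.sum_le_sum fun j _ => hd j)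
            (Finset.sum_nonneg fun _ _ => sq_nonneg _) (by positivity)
      _ ≤ G.M / Tmin * (2 * τ ^ 2 * (1 / (G.L + 1) + G.L * G.paramStep ^ 2)
          * ((G.numSnapshots : ℝ) * σ)) := by
          rw [← Finset.mul_sum]; gcongr
      _ = G.M / Tmin * (2 * τ ^ 2 * (((1 / (G.L + 1) + G.L * G.paramStep ^ 2)
          * (G.numSnapshots : ℝ)) * σ)) := by ring
      _ ≤ G.M / Tmin * (2 * τ ^ 2 * ((1 + 2 * (G.αL - G.α₀) ^ 2) * (2 * G.M) * σ)) := by gcongr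
      _ = _ := by rw [hτ]; field_simp; ring

end

section

/-! ### Integration over the rescaled time intervals -/

theorem integral_rescale {T T' : ℝ} (hT : 0 < T) (hT' : 0 < T') (f : ℝ → ℝ) :
    ∫ t in (0 : ℝ)..T, f (T' * t / T) = T / T' * ∫ s in (0 : ℝ)..T', f s := by
  have h1 : ∀ t : ℝ, T' * t / T = (T' / T) * t := fun t => by ring
  simp only [h1]
  rw [intervalIntegral.integral_comp_mul_left _ (div_ne_zero hT'.ne' hT.ne'), mul_zero,
    div_mul_cancel₀ _ hT.ne', smul_eq_mul, inv_div]

theorem rescaled_continuousOn {G : SampleGrid} (hT : ∀ α ∈ Icc G.α₀ G.αL, 0 < G.T α)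
    (hTc : ContinuousOn G.T (Icc G.α₀ G.αL)) {S : ℝ × ℝ → ℝ} (hS : ContinuousOn S G.region)
    {α : ℝ} (hα : α ∈ Icc G.α₀ G.αL) {a b : ℝ} (ha : G.α₀ ≤ a) (hb : b ≤ G.αL) :
    ContinuousOn (fun p : ℝ × ℝ => S (p.2, G.T p.2 * p.1 / G.T α))
      (Icc 0 (G.T α) ×ˢ Icc a b) := by
  have hsub : Icc a b ⊆ Icc G.α₀ G.αL := Icc_subset_Icc ha hb
  refine hS.comp (continuousOn_snd.prodMk ?_) fun p hp => mapsTo_region hT hα hp.1 (hsub hp.2)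
  exact ((hTc.comp continuousOn_snd fun p hp => hsub hp.2).mul continuousOn_fst).div_const _

/-- Fubini and the substitution `s = T^μ t / T^α`. -/
theorem integral_rescaled_le {G : SampleGrid} {Tmin Tmax : ℝ} (hTmin : 0 < Tmin)
    (hT : ∀ α ∈ Icc G.α₀ G.αL, Tmin ≤ G.T α ∧ G.T α ≤ Tmax)
    (hTc : ContinuousOn G.T (Icc G.α₀ G.αL)) {S : ℝ × ℝ → ℝ} (hS : ContinuousOn S G.region)
    (hS0 : ∀ p ∈ G.region, 0 ≤ S p) {α : ℝ} (hα : α ∈ Icc G.α₀ G.αL) {a b : ℝ} (ha : G.α₀ ≤ a)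
    (hb : b ≤ G.αL) (hab : a ≤ b) :
    IntervalIntegrable (fun t => ∫ μ in a..b, S (μ, G.T μ * t / G.T α)) volume 0 (G.T α) ∧
    ∫ t in (0 : ℝ)..G.T α, ∫ μ in a..b, S (μ, G.T μ * t / G.T α)
      ≤ Tmax / Tmin * ∫ μ in a..b, ∫ s in (0 : ℝ)..G.T μ, S (μ, s) := by
  have hT0 : ∀ α ∈ Icc G.α₀ G.αL, 0 < G.T α := fun α hα => hTmin.trans_le (hT α hα).1
  have hTα := hT0 α hα
  have hTmax : 0 < Tmax := hTα.trans_le (hT α hα).2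
  have hcont := rescaled_continuousOn hT0 hTc hS hα ha hb
  have hint : IntegrableOn (fun p : ℝ × ℝ => S (p.2, G.T p.2 * p.1 / G.T α))
      (Ioc 0 (G.T α) ×ˢ Ioc a b) :=
    (hcont.integrableOn_compact (isCompact_Icc.prod isCompact_Icc)).mono_set
      (prod_mono Ioc_subset_Icc_self Ioc_subset_Icc_self)
  have hint' : Integrable (fun p : ℝ × ℝ => S (p.2, G.T p.2 * p.1 / G.T α))
      ((volume.restrict (Ioc 0 (G.T α))).prod (volume.restrict (Ioc a b))) := by
    rw [Measure.prod_restrict]; exact hint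
  have hsub : Icc a b ⊆ Icc G.α₀ G.αL := Icc_subset_Icc ha hb
  constructor
  · rw [intervalIntegrable_iff_integrableOn_Ioc_of_le hTα.le]
    simp only [intervalIntegral.integral_of_le hab]
    exact hint'.integral_prod_left
  · rw [intervalIntegral_intervalIntegral_swap
      (F := fun t μ => S (μ, G.T μ * t / G.T α))
      (by rw [uIoc_of_le hTα.le, uIoc_of_le hab]; exact hint)]
    have hg : IntervalIntegrable (fun μ => ∫ t in (0 : ℝ)..G.T α, S (μ, G.T μ * t / G.T α))
        volume a b := by
      rw [intervalIntegrable_iff_integrableOn_Ioc_of_le hab]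
      simp only [intervalIntegral.integral_of_le hTα.le]
      exact hint'.integral_prod_right
    have heq : ∀ μ ∈ Icc a b, ∫ s in (0 : ℝ)..G.T μ, S (μ, s)
        = (G.T μ / G.T α) * ∫ t in (0 : ℝ)..G.T α, S (μ, G.T μ * t / G.T α) := by
      intro μ hμ
      have h1 := hT0 μ (hsub hμ)
      rw [integral_rescale hTα h1 (fun s => S (μ, s)), ← mul_assoc]
      field_simp
    have hg' : IntervalIntegrable (fun μ => ∫ s in (0 : ℝ)..G.T μ, S (μ, s)) volume a b := by
      have h1 : IntervalIntegrable (fun μ => (G.T μ / G.T α)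
          * ∫ t in (0 : ℝ)..G.T α, S (μ, G.T μ * t / G.T α)) volume a b :=
        hg.continuousOn_mul (by rw [uIcc_of_le hab]; exact (hTc.mono hsub).div_const _)
      refine h1.congr fun μ hμ => ?_
      rw [uIoc_of_le hab] at hμ
      exact (heq μ (Ioc_subset_Icc_self hμ)).symm
    rw [← intervalIntegral.integral_const_mul]
    refine intervalIntegral.integral_mono_on hab hg (hg'.const_mul _) fun μ hμ => ?_
    have h1 := hT μ (hsub hμ)
    have h2 := hT0 μ (hsub hμ)
    have h3 : 0 ≤ ∫ s in (0 : ℝ)..G.T μ, S (μ, s) :=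
      intervalIntegral.integral_nonneg h2.le fun s hs => hS0 _ ⟨hsub hμ, hs⟩
    rw [integral_rescale hTα h2 (fun s => S (μ, s))]
    refine mul_le_mul_of_nonneg_right ?_ h3
    exact div_le_div₀ hTmax.le (hT α hα).2 hTmin h1.1

/-! ### Gronwall's inequality and the error equation -/

/-- Gronwall's inequality for a function that vanishes at `0` and is differentiable in the open
interval only. -/
theorem gronwall_integral {T A : ℝ} (hA : 0 ≤ A) {h h' k : ℝ → ℝ}
    (hc : ContinuousOn h (Icc 0 T)) (hd : ∀ t ∈ Ioo 0 T, HasDerivAt h (h' t) t)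
    (hk : ContinuousOn k (Icc 0 T)) (hk0 : ∀ t ∈ Icc 0 T, 0 ≤ k t)
    (hle : ∀ t ∈ Ioo 0 T, h' t ≤ A * h t + k t) (h0 : h 0 = 0) {t : ℝ} (ht : t ∈ Icc 0 T) :
    h t ≤ Real.exp (A * T) * ∫ s in (0 : ℝ)..T, k s := by
  have hT : 0 ≤ T := ht.1.trans ht.2
  let K : ℝ → ℝ := fun t => ∫ s in (0 : ℝ)..t, k s
  let φ : ℝ → ℝ := fun t => Real.exp (-A * t) * h t - K t
  have hki : IntervalIntegrable k volume 0 T := hk.intervalIntegrable_of_Icc hT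
  have hKc : ContinuousOn K (Icc 0 T) := by
    have := intervalIntegral.continuousOn_primitive_interval' hki left_mem_uIcc
    rwa [uIcc_of_le hT] at this
  have hka : ∀ t ∈ Ioo 0 T, ContinuousAt k t := fun t ht =>
    hk.continuousAt (Icc_mem_nhds ht.1 ht.2)
  have hKd : ∀ t ∈ Ioo 0 T, HasDerivAt K (k t) t := fun t ht =>
    intervalIntegral.integral_hasDerivAt_right
      ((hk.mono (Icc_subset_Icc_right ht.2.le)).intervalIntegrable_of_Icc ht.1.le)
      (ContinuousAt.stronglyMeasurableAtFilter isOpen_Ioo hka t ht) (hka t ht)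
  have hφd : ∀ t ∈ Ioo 0 T, HasDerivAt φ
      (Real.exp (-A * t) * (-A) * h t + Real.exp (-A * t) * h' t - k t) t := by
    intro t ht
    have h1 : HasDerivAt (fun t : ℝ => Real.exp (-A * t)) (Real.exp (-A * t) * (-A)) t := by
      simpa using ((hasDerivAt_id t).const_mul (-A)).exp
    exact (h1.mul (hd t ht)).sub (hKd t ht)
  have hanti : AntitoneOn φ (Icc 0 T) := by
    refine antitoneOn_of_deriv_nonpos (convex_Icc 0 T)
      (((Real.continuous_exp.comp (continuous_const.mul continuous_id)).continuousOn.mul hc).sub hKc)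
      (fun t ht => ?_) fun t ht => ?_
    · rw [interior_Icc] at ht
      exact (hφd t ht).differentiableAt.differentiableWithinAt
    · rw [interior_Icc] at ht
      rw [(hφd t ht).deriv]
      have h1 := hle t ht
      have h2 : Real.exp (-A * t) ≤ 1 := Real.exp_le_one_iff.2 (by nlinarith [ht.1])
      have h3 := hk0 t (Ioo_subset_Icc_self ht)
      have h4 := mul_le_mul_of_nonneg_left h1 (Real.exp_pos (-A * t)).le
      have h5 := mul_le_mul_of_nonneg_right h2 h3
      linarith
  have h1 := hanti (left_mem_Icc.2 hT) ht ht.1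
  have h2 : φ 0 = 0 := by simp [φ, K, h0]
  rw [h2] at h1
  have h3 : K t ≤ ∫ s in (0 : ℝ)..T, k s :=
    intervalIntegral.integral_mono_interval le_rfl ht.1 ht.2
      ((ae_restrict_iff' measurableSet_Ioc).2 (ae_of_all _ fun s hs => hk0 s ⟨hs.1.le, hs.2⟩)) hki
  have h4 : Real.exp (-A * t) * h t ≤ ∫ s in (0 : ℝ)..T, k s := by
    simp only [φ] at h1; linarith
  have h5 : 0 ≤ ∫ s in (0 : ℝ)..T, k s := intervalIntegral.integral_nonneg hT hk0
  have h6 : h t = Real.exp (A * t) * (Real.exp (-A * t) * h t) := by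
    rw [← mul_assoc, ← Real.exp_add]; simp
  rw [h6]
  calc Real.exp (A * t) * (Real.exp (-A * t) * h t)
      ≤ Real.exp (A * t) * ∫ s in (0 : ℝ)..T, k s := by gcongr
    _ ≤ _ := by
        refine mul_le_mul_of_nonneg_right (Real.exp_le_exp.2 ?_) h5
        exact mul_le_mul_of_nonneg_left ht.2 hA

variable {E H : Type*} [NormedAddCommGroup E] [InnerProductSpace ℝ E] [FiniteDimensional ℝ E]
  [NormedAddCommGroup H] [InnerProductSpace ℝ H]

/-- The error of a Galerkin solution in a subspace `U` is bounded by the projection errors of the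
reference solution and of its time derivative. The inner product of `E` is that of the gradients,
`κ` embeds `E` into `L²`, and `n` stands for the difference of the nonlinear terms. -/
theorem galerkin_error_le {T ν Λ Cp : ℝ} (hν : 0 ≤ ν) (hΛ : 0 ≤ Λ) (κ : E →L[ℝ] H)
    (hκ : ∀ v, ‖κ v‖ ≤ Cp * ‖v‖) (U : Submodule ℝ E) {uh uh' ur ur' : ℝ → E}
    (huh : ∀ t ∈ Icc 0 T, HasDerivWithinAt uh (uh' t) (Icc 0 T) t)
    (huh' : ContinuousOn uh' (Icc 0 T)) (hurc : ContinuousOn ur (Icc 0 T))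
    (hur : ∀ t ∈ Ioo 0 T, HasDerivAt ur (ur' t) t) (hurU : ∀ t ∈ Icc 0 T, ur t ∈ U)
    (h0 : ur 0 = U.starProjection (uh 0)) (n : ℝ → E → ℝ)
    (hn : ∀ t ∈ Ioo 0 T, ∀ v, |n t v| ≤ Λ * (‖κ (ur t - uh t)‖ * ‖κ v‖))
    (heq : ∀ t ∈ Ioo 0 T, ∀ v ∈ U,
      inner ℝ (κ (ur' t - uh' t)) (κ v) + ν * inner ℝ (ur t - uh t) v + n t v = 0)
    {t : ℝ} (ht : t ∈ Icc 0 T) :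
    ‖κ (ur t - uh t)‖ ^ 2 ≤ 2 * Cp ^ 2 * ‖Uᗮ.starProjection (uh t)‖ ^ 2
      + 2 * Real.exp ((3 * Λ + 1) * T) * Cp ^ 2 *
        ∫ s in (0 : ℝ)..T, (Λ * ‖Uᗮ.starProjection (uh s)‖ ^ 2 + ‖Uᗮ.starProjection (uh' s)‖ ^ 2) := by
  set P := U.starProjection with hP
  set Q := Uᗮ.starProjection with hQ
  have hPQ : ∀ v, P v = v - Q v := fun v => by
    rw [eq_sub_iff_add_eq]; exact U.starProjection_add_starProjection_orthogonal v
  -- the discrete error, which lies in `U` and vanishes initially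
  let e : ℝ → E := fun t => ur t - P (uh t)
  have heU : ∀ t ∈ Icc 0 T, e t ∈ U := fun t ht =>
    U.sub_mem (hurU t ht) (U.starProjection_apply_mem _)
  have hec : ContinuousOn e (Icc 0 T) := hurc.sub (P.continuous.comp_continuousOn
    fun t ht => (huh t ht).continuousWithinAt)
  have hed : ∀ t ∈ Ioo 0 T, HasDerivAt e (ur' t - P (uh' t)) t := fun t ht =>
    (hur t ht).sub (P.hasFDerivAt.comp_hasDerivAt t
      ((huh t (Ioo_subset_Icc_self ht)).hasDerivAt (Icc_mem_nhds ht.1 ht.2)))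
  have hdiff : ∀ t, ur t - uh t = e t - Q (uh t) := fun t => by
    simp only [e, hPQ]; abel
  let h : ℝ → ℝ := fun t => ‖κ (e t)‖ ^ 2
  have hhd : ∀ t ∈ Ioo 0 T,
      HasDerivAt h (2 * inner ℝ (κ (e t)) (κ (ur' t - P (uh' t)))) t := fun t ht =>
    (κ.hasFDerivAt.comp_hasDerivAt t (hed t ht)).norm_sq
  let k : ℝ → ℝ := fun t => Cp ^ 2 * (Λ * ‖Q (uh t)‖ ^ 2 + ‖Q (uh' t)‖ ^ 2)
  have huhc : ContinuousOn uh (Icc 0 T) := fun t ht => (huh t ht).continuousWithinAt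
  have hkc : ContinuousOn k (Icc 0 T) := continuousOn_const.mul
    ((continuousOn_const.mul ((Q.continuous.comp_continuousOn huhc).norm.pow 2)).add
      ((Q.continuous.comp_continuousOn huh').norm.pow 2))
  have hk0 : ∀ t, 0 ≤ k t := fun t => by positivity
  have hle : ∀ t ∈ Ioo 0 T, 2 * inner ℝ (κ (e t)) (κ (ur' t - P (uh' t)))
      ≤ (3 * Λ + 1) * h t + k t := by
    intro t ht
    have htI := Ioo_subset_Icc_self ht
    have h1 := heq t ht (e t) (heU t htI)
    have h2 : inner ℝ (ur t - uh t) (e t) = ‖e t‖ ^ 2 := by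
      rw [hdiff, inner_sub_left, real_inner_self_eq_norm_sq,
        U.inner_left_of_mem_orthogonal (heU t htI) (Uᗮ.starProjection_apply_mem _), sub_zero]
    have h3 : inner ℝ (κ (e t)) (κ (ur' t - P (uh' t)))
        = inner ℝ (κ (ur' t - uh' t)) (κ (e t)) + inner ℝ (κ (Q (uh' t))) (κ (e t)) := by
      rw [real_inner_comm, ← inner_add_left, ← map_add, hPQ]
      congr 3; abel
    set x := ‖κ (e t)‖ with hx
    have hx0 : 0 ≤ x := norm_nonneg _
    have ha : ‖κ (Q (uh t))‖ ≤ Cp * ‖Q (uh t)‖ := hκ _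
    have hb : ‖κ (Q (uh' t))‖ ≤ Cp * ‖Q (uh' t)‖ := hκ _
    have h4 : inner ℝ (κ (Q (uh' t))) (κ (e t)) ≤ (Cp * ‖Q (uh' t)‖) * x :=
      (real_inner_le_norm _ _).trans (mul_le_mul_of_nonneg_right hb hx0)
    have h5 : ‖κ (ur t - uh t)‖ ≤ x + Cp * ‖Q (uh t)‖ := by
      rw [hdiff, map_sub]; exact (norm_sub_le _ _).trans (by linarith)
    have h6 : - n t (e t) ≤ Λ * ((x + Cp * ‖Q (uh t)‖) * x) := by
      refine (neg_le_abs _).trans ((hn t ht _).trans ?_)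
      gcongr
    -- the projection error is orthogonal to `e`, so the diffusion term only has a good sign
    have h7 : 0 ≤ ν * ‖e t‖ ^ 2 := by positivity
    rw [h2] at h1
    rw [h3]
    have h8 : k t = Λ * (Cp * ‖Q (uh t)‖) ^ 2 + (Cp * ‖Q (uh' t)‖) ^ 2 := by simp only [k]; ring
    have h9 : h t = x ^ 2 := rfl
    rw [h8, h9]
    generalize Cp * ‖Q (uh t)‖ = a at *
    generalize Cp * ‖Q (uh' t)‖ = b at *
    have h10 : 0 ≤ Λ * (x - a) ^ 2 := by positivity
    nlinarith [sq_nonneg (x - b)]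
  have hgr := gronwall_integral (by positivity : (0 : ℝ) ≤ 3 * Λ + 1)
    ((κ.continuous.comp_continuousOn hec).norm.pow 2) hhd hkc (fun t _ => hk0 t) hle
    (by simp [e, h0]) ht
  have hfin : ‖κ (ur t - uh t)‖ ^ 2 ≤ 2 * (Cp ^ 2 * ‖Q (uh t)‖ ^ 2) + 2 * h t := by
    have h1 : ‖κ (ur t - uh t)‖ ≤ ‖κ (e t)‖ + Cp * ‖Q (uh t)‖ := by
      rw [hdiff, map_sub]; exact (norm_sub_le _ _).trans (by linarith [hκ (Q (uh t))])
    refine (pow_le_pow_left₀ (norm_nonneg _) h1 2).trans ?_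
    simp only [h]
    nlinarith [sq_nonneg (‖κ (e t)‖ - Cp * ‖Q (uh t)‖)]
  simp only [k] at hgr
  rw [intervalIntegral.integral_const_mul] at hgr
  change h t ≤ _ at hgr
  linarith

end

/-! ### Projection errors in and between the samples -/

section Projection

variable {E : Type} [NormedAddCommGroup E] [NormedSpace ℝ E]

/-- A family `W (μ, t)` in a normed space on the region of a sample grid, with time derivative `Wt`,
that has the smoothness which the error estimate asks for. -/
structure IsSmoothFamily (G : SampleGrid) (m q : ℕ) (Tmin Tmax B : ℝ) (W Wt : ℝ × ℝ → E) :
    Prop where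
  lt : G.α₀ < G.αL
  T_contDiff : ContDiffOn ℝ m G.T (Icc G.α₀ G.αL)
  T_mem : ∀ α ∈ Icc G.α₀ G.αL, Tmin ≤ G.T α ∧ G.T α ≤ Tmax
  T_deriv : ∀ α ∈ Icc G.α₀ G.αL, ∀ i : ℕ, 1 ≤ i → i ≤ m →
    |iteratedDerivWithin i G.T (Icc G.α₀ G.αL) α| ≤ B
  contDiff : ContDiffOn ℝ m W G.region
  contDiff' : ContDiffOn ℝ m Wt G.region
  hasDeriv : ∀ μ ∈ Icc G.α₀ G.αL, ∀ t ∈ Icc 0 (G.T μ),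
    HasDerivWithinAt (fun s => W (μ, s)) (Wt (μ, t)) (Icc 0 (G.T μ)) t
  node_contDiff : ∀ j ≤ G.L, ContDiffOn ℝ (q + 1 : ℕ) (fun s => W (G.paramNode j, s))
    (Icc 0 (G.finalTime j))

/-- `∫₀^{T^j} ‖∂ₜ^{q+1} W(α_j, ·)‖²`. -/
noncomputable def nodeEnergy (G : SampleGrid) (q : ℕ) (W : ℝ × ℝ → E) (j : ℕ) : ℝ :=
  ∫ s in (0 : ℝ)..G.finalTime j,
    ‖iteratedDerivWithin (q + 1) (fun s => W (G.paramNode j, s)) (Icc 0 (G.finalTime j)) s‖ ^ 2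

/-- `σ` bounds the mean square of the snapshots of `Q W`. -/
def SnapshotBound (G : SampleGrid) (W : ℝ × ℝ → E) (Q : E →L[ℝ] E) (σ : ℝ) : Prop :=
  ∑ i : Fin (G.M + 1) × Fin (G.L + 1),
    ‖gridSnapshot G (fun l j => Q (W (G.paramNode l, G.timeNode l j))) i.1 i.2‖ ^ 2
      ≤ (G.numSnapshots : ℝ) * σ

/-- A function of time is bounded uniformly by its initial value and the `L²` norm of its derivative. -/
theorem norm_sq_le_of_deriv [CompleteSpace E] {T : ℝ} {w w' : ℝ → E} (hT : 0 < T)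
    (hw : ∀ t ∈ Icc 0 T, HasDerivWithinAt w (w' t) (Icc 0 T) t) (hw' : ContinuousOn w' (Icc 0 T))
    {s : ℝ} (hs : s ∈ Icc 0 T) :
    ‖w s‖ ^ 2 ≤ 2 * ‖w 0‖ ^ 2 + 2 * T * ∫ t in (0 : ℝ)..T, ‖w' t‖ ^ 2 := by
  have h1 := norm_sub_le_integral hw hw' (left_mem_Icc.2 hT.le) hs
  have h2 := sq_integral_le hT hw'.norm
  have h3 : ‖w s‖ ≤ ‖w 0‖ + ∫ t in (0 : ℝ)..T, ‖w' t‖ := by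
    have : w s = w 0 + (w s - w 0) := by abel
    rw [this]
    exact (norm_add_le _ _).trans (by linarith)
  have h4 := pow_le_pow_left₀ (norm_nonneg _) h3 2
  rw [sub_zero] at h2
  nlinarith [sq_nonneg (‖w 0‖ - ∫ t in (0 : ℝ)..T, ‖w' t‖)]

theorem timeStep_le_max (G : SampleGrid) {j : ℕ} (hj : j ≤ G.L) :
    G.timeStep j ≤ G.maxTimeStep :=
  Finset.le_sup' G.timeStep (Finset.mem_range.2 (Nat.lt_succ_of_le hj))

/-- Projection errors at a sampled parameter: the snapshots control the initial value and the
difference quotients in time, these the time derivative in `L²`, and both together the function. -/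
theorem exists_node_const (m q : ℕ) (hq : 2 ≤ q) (len Tmin Tmax B : ℝ) (hTmin : 0 < Tmin) :
    ∃ C : ℝ, 0 < C ∧ ∀ {E : Type} [NormedAddCommGroup E] [NormedSpace ℝ E] [CompleteSpace E]
      (G : SampleGrid) (W Wt : ℝ × ℝ → E), G.αL - G.α₀ = len → q ≤ G.M → 0 < G.L →
      IsSmoothFamily G m q Tmin Tmax B W Wt → ∀ (Q : E →L[ℝ] E), (∀ v, ‖Q v‖ ≤ ‖v‖) →
      ∀ σ : ℝ, 0 ≤ σ → SnapshotBound G W Q σ → ∀ j ≤ G.L,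
        (∫ s in (0 : ℝ)..G.finalTime j, ‖Q (Wt (G.paramNode j, s))‖ ^ 2)
          ≤ C * (σ + G.maxTimeStep ^ (2 * q) * nodeEnergy G q W j) ∧
        ∀ s ∈ Icc 0 (G.finalTime j), ‖Q (W (G.paramNode j, s))‖ ^ 2
          ≤ C * (σ + G.maxTimeStep ^ (2 * q) * nodeEnergy G q W j) := by
  obtain ⟨C, hC, htime⟩ := exists_time_const q (by omega)
  let D : ℝ := 4 * Tmax ^ 2 / Tmin * (1 + 2 * len ^ 2)
  have hD : 0 ≤ D := by positivity
  let K : ℝ := C * (D + 1)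
  have hK : 0 < K := by positivity
  refine ⟨K + (2 + 2 * |Tmax| * K), by positivity, ?_⟩
  intro E _ _ _ G W Wt hlen hqM hL hW Q hQ σ hσ hx j hj
  have hM : 0 < G.M := by omega
  have hnode := paramNode_mem hW.lt hL hj
  have hTj : Tmin ≤ G.finalTime j ∧ G.finalTime j ≤ Tmax := hW.T_mem _ hnode
  have hTj0 : 0 < G.finalTime j := hTmin.trans_le hTj.1
  obtain ⟨hx0, hxd⟩ := grid_bounds hW.lt hL hM hTmin
    (fun l hl => hW.T_mem _ (paramNode_mem hW.lt hL hl)) hσ hx hj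
  have hu := uniqueDiffOn_Icc hTj0
  have hchain := isDerivChain_iteratedDerivWithin hTj0 (hW.node_contDiff j hj)
  have hWt : ∀ s ∈ Icc 0 (G.finalTime j),
      iteratedDerivWithin 1 (fun s => W (G.paramNode j, s)) (Icc 0 (G.finalTime j)) s
        = Wt (G.paramNode j, s) := fun s hs => by
    rw [iteratedDerivWithin_one]
    exact (hW.hasDeriv _ hnode s hs).derivWithin (hu s hs)
  have hWtc : ContinuousOn (fun s => Q (Wt (G.paramNode j, s))) (Icc 0 (G.finalTime j)) :=
    Q.continuous.comp_continuousOn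
      ((hchain.continuousOn (by omega : 1 ≤ q + 1)).congr fun s hs => (hWt s hs).symm)
  have h1 := htime _ _ G.M hTj0 hqM (hchain.map Q)
  have h2 : ∫ s in (0 : ℝ)..G.finalTime j, ‖Q (iteratedDerivWithin 1
      (fun s => W (G.paramNode j, s)) (Icc 0 (G.finalTime j)) s)‖ ^ 2
        = ∫ s in (0 : ℝ)..G.finalTime j, ‖Q (Wt (G.paramNode j, s))‖ ^ 2 := by
    refine intervalIntegral.integral_congr fun s hs => ?_
    rw [uIcc_of_le hTj0.le] at hs
    simp only [hWt s hs]
  have h3 : ∫ s in (0 : ℝ)..G.finalTime j, ‖Q (iteratedDerivWithin (q + 1)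
      (fun s => W (G.paramNode j, s)) (Icc 0 (G.finalTime j)) s)‖ ^ 2 ≤ nodeEnergy G q W j := by
    refine intervalIntegral.integral_mono_on (μ := volume) hTj0.le
      (((hchain.map Q).cont.norm.pow 2).intervalIntegrable_of_Icc hTj0.le)
      ((hchain.cont.norm.pow 2).intervalIntegrable_of_Icc hTj0.le) fun s _ => ?_
    exact pow_le_pow_left₀ (norm_nonneg _) (hQ _) 2
  have h4 : (G.finalTime j / G.M) ^ (2 * q) ≤ G.maxTimeStep ^ (2 * q) :=
    pow_le_pow_left₀ (div_nonneg hTj0.le (Nat.cast_nonneg _)) (timeStep_le_max G hj) _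
  have hE0 : 0 ≤ nodeEnergy G q W j :=
    intervalIntegral.integral_nonneg hTj0.le fun _ _ => sq_nonneg _
  set R := σ + G.maxTimeStep ^ (2 * q) * nodeEnergy G q W j with hR
  have hmax0 : 0 ≤ G.maxTimeStep ^ (2 * q) * nodeEnergy G q W j :=
    mul_nonneg ((by positivity : (0 : ℝ) ≤ (G.finalTime j / G.M) ^ (2 * q)).trans h4) hE0
  have hR0 : 0 ≤ R := add_nonneg hσ hmax0
  have hder : ∫ s in (0 : ℝ)..G.finalTime j, ‖Q (Wt (G.paramNode j, s))‖ ^ 2 ≤ K * R := by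
    rw [← h2]
    refine h1.trans ?_
    rw [hlen] at hxd
    have h5 : (G.finalTime j / G.M) ^ (2 * q) * ∫ s in (0 : ℝ)..G.finalTime j,
        ‖Q (iteratedDerivWithin (q + 1) (fun s => W (G.paramNode j, s))
          (Icc 0 (G.finalTime j)) s)‖ ^ 2 ≤ G.maxTimeStep ^ (2 * q) * nodeEnergy G q W j :=
      mul_le_mul h4 h3 (intervalIntegral.integral_nonneg hTj0.le fun _ _ => sq_nonneg _)
        ((by positivity : (0 : ℝ) ≤ (G.finalTime j / G.M) ^ (2 * q)).trans h4)
    have h6 : (G.finalTime j / G.M)⁻¹ * ∑ i ∈ Finset.range G.M,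
        ‖Q (iteratedDerivWithin 0 (fun s => W (G.paramNode j, s)) (Icc 0 (G.finalTime j))
            ((i + 1 : ℕ) * (G.finalTime j / G.M)))
          - Q (iteratedDerivWithin 0 (fun s => W (G.paramNode j, s)) (Icc 0 (G.finalTime j))
            (i * (G.finalTime j / G.M)))‖ ^ 2 ≤ D * σ := by
      simp only [iteratedDerivWithin_zero]
      exact hxd
    simp only [K, hR, mul_assoc]
    refine mul_le_mul_of_nonneg_left ?_ hC.le
    have h7 := mul_nonneg hD hmax0
    linarith
  refine ⟨hder.trans (mul_le_mul_of_nonneg_right ?_ hR0), fun s hs => ?_⟩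
  · have : 0 ≤ 2 * |Tmax| * K := by positivity
    linarith
  · have h5 := norm_sq_le_of_deriv (w := fun s => Q (W (G.paramNode j, s))) hTj0
      (fun t ht => Q.hasFDerivAt.comp_hasDerivWithinAt t (hW.hasDeriv _ hnode t ht)) hWtc hs
    have h6 : ‖Q (W (G.paramNode j, 0))‖ ^ 2 ≤ R := by
      have : G.timeNode j 0 = 0 := by simp [SampleGrid.timeNode]
      rw [this] at hx0
      linarith
    have h7 : 2 * G.finalTime j * ∫ t in (0 : ℝ)..G.finalTime j, ‖Q (Wt (G.paramNode j, t))‖ ^ 2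
        ≤ 2 * |Tmax| * (K * R) :=
      mul_le_mul (by linarith [le_abs_self Tmax]) hder
        (intervalIntegral.integral_nonneg hTj0.le fun _ _ => sq_nonneg _) (by positivity)
    have h8 : 0 ≤ K * R := by positivity
    refine h5.trans ?_
    linarith

/-- Interpolation in the parameter, integrated over time. -/
theorem exists_param_const_integral (m : ℕ) (hm : 2 ≤ m) (Tmin Tmax B : ℝ) (hTmin : 0 < Tmin) :
    ∃ C : ℝ, 0 < C ∧ ∀ {E : Type} [NormedAddCommGroup E] [NormedSpace ℝ E] [CompleteSpace E]
      (G : SampleGrid), G.α₀ < G.αL → ContDiffOn ℝ m G.T (Icc G.α₀ G.αL) →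
      (∀ α ∈ Icc G.α₀ G.αL, Tmin ≤ G.T α ∧ G.T α ≤ Tmax) →
      (∀ α ∈ Icc G.α₀ G.αL, ∀ i : ℕ, 1 ≤ i → i ≤ m →
        |iteratedDerivWithin i G.T (Icc G.α₀ G.αL) α| ≤ B) →
      ∀ (w : ℝ × ℝ → E), ContDiffOn ℝ m w G.region → ∀ (Q : E →L[ℝ] E), (∀ v, ‖Q v‖ ≤ ‖v‖) →
      ∀ (S : ℝ × ℝ → ℝ), ContinuousOn S G.region →
      (∀ p ∈ G.region, mixedSq G.region m w p ≤ S p) →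
      ∀ (l : ℕ), l + m - 1 ≤ G.L → ∀ α ∈ Icc (G.paramNode l) (G.paramNode (l + m - 1)),
        ∫ t in (0 : ℝ)..G.T α, ‖Q (w (α, t))‖ ^ 2 ≤ C * (∑ j ∈ Finset.Ico l (l + m),
            (∫ s in (0 : ℝ)..G.finalTime j, ‖Q (w (G.paramNode j, s))‖ ^ 2)
          + G.paramStep ^ (2 * m - 1) * ∫ μ in G.paramNode l..G.paramNode (l + m - 1),
              ∫ s in (0 : ℝ)..G.T μ, S (μ, s)) := by
  obtain ⟨C, hC, hpar⟩ := exists_param_const m hm B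
  refine ⟨C * (|Tmax| / Tmin + 1), by positivity, ?_⟩
  intro E _ _ _ G hα hTc hT hTd w hw Q hQ S hS hwS l hl α hαm
  have hL : 0 < G.L := by omega
  have hT0 : ∀ α ∈ Icc G.α₀ G.αL, 0 < G.T α := fun α hα => hTmin.trans_le (hT α hα).1
  have hnl : G.paramNode l ∈ Icc G.α₀ G.αL := paramNode_mem hα hL (by omega)
  have hnr : G.paramNode (l + m - 1) ∈ Icc G.α₀ G.αL := paramNode_mem hα hL hl
  have hαm' : α ∈ Icc G.α₀ G.αL := ⟨hnl.1.trans hαm.1, hαm.2.trans hnr.2⟩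
  have hle : G.paramNode l ≤ G.paramNode (l + m - 1) := hαm.1.trans hαm.2
  have hsub : Icc (G.paramNode l) (G.paramNode (l + m - 1)) ⊆ Icc G.α₀ G.αL :=
    Icc_subset_Icc hnl.1 hnr.2
  have hTα := hT0 α hαm'
  have hTmax : 0 < Tmax := hTα.trans_le (hT α hαm').2
  have hstep := paramStep_pos hα hL
  have hregu := uniqueDiffOn_region hα hT0 (hTc.differentiableOn (by simp; omega))
  have hS0 : ∀ p ∈ G.region, 0 ≤ S p := fun p hp => (mixedSq_nonneg _ _ _ _).trans (hwS p hp)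
  obtain ⟨hSi, hSle⟩ := integral_rescaled_le hTmin hT hTc.continuousOn hS hS0 hαm' hnl.1 hnr.2 hle
  -- the pointwise estimate with `S` in place of the mixed derivatives of `w`
  have hpt : ∀ t ∈ Icc 0 (G.T α), ‖Q (w (α, t))‖ ^ 2 ≤ C * (∑ j ∈ Finset.Ico l (l + m),
            ‖Q (w (G.paramNode j, G.T (G.paramNode j) * t / G.T α))‖ ^ 2
          + G.paramStep ^ (2 * m - 1) * ∫ μ in G.paramNode l..G.paramNode (l + m - 1),
              S (μ, G.T μ * t / G.T α)) := by
    intro t ht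
    refine (hpar G hα hTc hT0 hTd w hw Q hQ l hl α hαm t ht).trans ?_
    have hmaps := mapsTo_region hT0 hαm' ht
    have hcurve : ContinuousOn (fun μ => (μ, G.T μ * t / G.T α))
        (Icc (G.paramNode l) (G.paramNode (l + m - 1))) :=
      continuousOn_id.prodMk (((hTc.continuousOn.mono hsub).mul continuousOn_const).div_const _)
    have h1 : ∫ μ in G.paramNode l..G.paramNode (l + m - 1),
        mixedSq G.region m w (μ, G.T μ * t / G.T α)
          ≤ ∫ μ in G.paramNode l..G.paramNode (l + m - 1), S (μ, G.T μ * t / G.T α) := by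
      refine intervalIntegral.integral_mono_on (μ := volume) hle ?_ ?_
        fun μ hμ => hwS _ (hmaps (hsub hμ))
      · exact ((continuousOn_mixedSq hregu hw).comp hcurve
          fun μ hμ => hmaps (hsub hμ)).intervalIntegrable_of_Icc hle
      · exact (hS.comp hcurve fun μ hμ => hmaps (hsub hμ)).intervalIntegrable_of_Icc hle
    gcongr
  have hline : ∀ μ ∈ Icc G.α₀ G.αL, ContinuousOn (fun s => ‖Q (w (μ, s))‖ ^ 2) (Icc 0 (G.T μ)) :=
    fun μ hμ => ((Q.continuous.comp_continuousOn (hw.continuousOn.comp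
      (continuousOn_const.prodMk continuousOn_id) fun s hs => ⟨hμ, hs⟩)).norm).pow 2
  have hji : ∀ j ∈ Finset.Ico l (l + m), IntervalIntegrable
      (fun t => ‖Q (w (G.paramNode j, G.T (G.paramNode j) * t / G.T α))‖ ^ 2) volume 0 (G.T α) := by
    intro j hj
    have hj' : j ≤ G.L := by have := Finset.mem_Ico.1 hj; omega
    have hnj := paramNode_mem hα hL hj'
    refine ContinuousOn.intervalIntegrable_of_Icc hTα.le ?_
    refine (hline _ hnj).comp ((continuousOn_const.mul continuousOn_id).div_const _) fun t ht => ?_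
    exact (mapsTo_region hT0 hαm' ht hnj).2
  let f : ℕ → ℝ → ℝ := fun j t => ‖Q (w (G.paramNode j, G.T (G.paramNode j) * t / G.T α))‖ ^ 2
  let g : ℝ → ℝ := fun t => ∫ μ in G.paramNode l..G.paramNode (l + m - 1), S (μ, G.T μ * t / G.T α)
  set p := G.paramStep ^ (2 * m - 1) with hp
  have hp0 : 0 ≤ p := by positivity
  have hfi : IntervalIntegrable (fun t => ∑ j ∈ Finset.Ico l (l + m), f j t) volume 0 (G.T α) := by
    have := IntervalIntegrable.sum (Finset.Ico l (l + m)) hji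
    rwa [Finset.sum_fn] at this
  have hI : ∫ t in (0 : ℝ)..G.T α, ‖Q (w (α, t))‖ ^ 2
      ≤ ∫ t in (0 : ℝ)..G.T α, C * (∑ j ∈ Finset.Ico l (l + m), f j t + p * g t) :=
    intervalIntegral.integral_mono_on (μ := volume) hTα.le
      ((hline α hαm').intervalIntegrable_of_Icc hTα.le)
      ((hfi.add (hSi.const_mul p)).const_mul C) hpt
  rw [intervalIntegral.integral_const_mul, intervalIntegral.integral_add hfi (hSi.const_mul p),
    intervalIntegral.integral_const_mul, intervalIntegral.integral_finsetSum hji] at hI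
  have hκ : 0 ≤ Tmax / Tmin := by positivity
  have hf : ∑ j ∈ Finset.Ico l (l + m), ∫ t in (0 : ℝ)..G.T α, f j t
      ≤ Tmax / Tmin * ∑ j ∈ Finset.Ico l (l + m),
        ∫ s in (0 : ℝ)..G.finalTime j, ‖Q (w (G.paramNode j, s))‖ ^ 2 := by
    rw [Finset.mul_sum]
    refine Finset.sum_le_sum fun j hj => ?_
    have hnj := paramNode_mem hα hL (by have := Finset.mem_Ico.1 hj; omega : j ≤ G.L)
    have h1 := hT _ hnj
    have h2 := integral_rescale hTα (hT0 _ hnj) (fun s => ‖Q (w (G.paramNode j, s))‖ ^ 2)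
    refine h2.trans_le (mul_le_mul_of_nonneg_right ?_
      (intervalIntegral.integral_nonneg (hT0 _ hnj).le fun _ _ => sq_nonneg _))
    exact div_le_div₀ hTmax.le (hT α hαm').2 hTmin h1.1
  have hA0 : 0 ≤ ∑ j ∈ Finset.Ico l (l + m),
      ∫ s in (0 : ℝ)..G.finalTime j, ‖Q (w (G.paramNode j, s))‖ ^ 2 := by
    refine Finset.sum_nonneg fun j hj => ?_
    have hnj := paramNode_mem hα hL (by have := Finset.mem_Ico.1 hj; omega : j ≤ G.L)
    exact intervalIntegral.integral_nonneg (hT0 _ hnj).le fun _ _ => sq_nonneg _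
  have hB0 : 0 ≤ ∫ μ in G.paramNode l..G.paramNode (l + m - 1),
      ∫ s in (0 : ℝ)..G.T μ, S (μ, s) :=
    intervalIntegral.integral_nonneg hle fun μ hμ =>
      intervalIntegral.integral_nonneg (hT0 _ (hsub hμ)).le fun s hs => hS0 _ ⟨hsub hμ, hs⟩
  rw [abs_of_pos hTmax]
  refine hI.trans ?_
  rw [mul_assoc C]
  refine mul_le_mul_of_nonneg_left ?_ hC.le
  have h3 := mul_le_mul_of_nonneg_left hSle hp0
  have h4 := mul_nonneg hp0 hB0
  simp only [f] at hf
  have h5 := mul_nonneg hκ h4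
  linarith

end Projection

/-! ### The error of a Galerkin solution in a subspace -/

/-- `∑_{j=l}^{l+m-1} ∫₀^{T^j} ‖∂ₜ^{q+1} W(α_j, ·)‖²`. -/
noncomputable def timeEnergy {E : Type} [NormedAddCommGroup E] [NormedSpace ℝ E] (G : SampleGrid)
    (m q l : ℕ) (W : ℝ × ℝ → E) : ℝ :=
  ∑ j ∈ Finset.Ico l (l + m), nodeEnergy G q W j

/-- The counterpart of `paramConst` in a normed space. -/
noncomputable def paramEnergy {E : Type} [NormedAddCommGroup E] [NormedSpace ℝ E] (G : SampleGrid)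
    (m l : ℕ) (W Wt : ℝ × ℝ → E) (α t : ℝ) : ℝ :=
  (∫ μ in G.paramNode l..G.paramNode (l + m - 1), ∫ s in (0 : ℝ)..G.T μ,
      (mixedSq G.region m Wt (μ, s) + mixedSq G.region m W (μ, s)))
  + ∫ μ in G.paramNode l..G.paramNode (l + m - 1), mixedSq G.region m W (μ, G.T μ * t / G.T α)

/-- A contraction `Q` that is small on the snapshots in the mean square is small on the whole family
and, in `L²` in time, on its time derivative, in the sample or between its nodes. -/
theorem exists_projection_const (m q : ℕ) (hm : 2 ≤ m) (hq : 2 ≤ q) (len Tmin Tmax B : ℝ)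
    (hTmin : 0 < Tmin) :
    ∃ C : ℝ, 0 < C ∧ ∀ {E : Type} [NormedAddCommGroup E] [NormedSpace ℝ E] [CompleteSpace E]
      (G : SampleGrid) (W Wt : ℝ × ℝ → E), G.αL - G.α₀ = len → q ≤ G.M →
      IsSmoothFamily G m q Tmin Tmax B W Wt → ∀ (Q : E →L[ℝ] E), (∀ v, ‖Q v‖ ≤ ‖v‖) →
      ∀ σ : ℝ, 0 ≤ σ → SnapshotBound G W Q σ → ∀ (l : ℕ), l + m - 1 ≤ G.L →
      ∀ α ∈ Icc (G.paramNode l) (G.paramNode (l + m - 1)), ∀ t ∈ Icc 0 (G.T α),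
      ‖Q (W (α, t))‖ ^ 2 ≤ C * (σ + timeEnergy G m q l W * G.maxTimeStep ^ (2 * q)
        + paramEnergy G m l W Wt α t * G.paramStep ^ (2 * m - 1)) ∧
      (∫ s in (0 : ℝ)..G.T α, ‖Q (W (α, s))‖ ^ 2)
        ≤ C * (σ + timeEnergy G m q l W * G.maxTimeStep ^ (2 * q)
        + paramEnergy G m l W Wt α t * G.paramStep ^ (2 * m - 1)) ∧
      (∫ s in (0 : ℝ)..G.T α, ‖Q (Wt (α, s))‖ ^ 2)
        ≤ C * (σ + timeEnergy G m q l W * G.maxTimeStep ^ (2 * q)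
        + paramEnergy G m l W Wt α t * G.paramStep ^ (2 * m - 1)) := by
  obtain ⟨C₁, hC₁, hnodeC⟩ := exists_node_const m q hq len Tmin Tmax B hTmin
  obtain ⟨C₂, hC₂, hpar⟩ := exists_param_const m hm B
  obtain ⟨C₃, hC₃, hparI⟩ := exists_param_const_integral m hm Tmin Tmax B hTmin
  refine ⟨C₂ * (C₁ * m + 1) + C₃ * (C₁ * m * |Tmax| + 1) + C₃ * (C₁ * m + 1), by positivity, ?_⟩
  intro E _ _ _ G W Wt hlen hqM hW Q hQ σ hσ hx l hl α hαm t ht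
  have hα := hW.lt
  have hL : 0 < G.L := by omega
  have hT0 : ∀ α ∈ Icc G.α₀ G.αL, 0 < G.T α := fun α hα => hTmin.trans_le (hW.T_mem α hα).1
  have hnl : G.paramNode l ∈ Icc G.α₀ G.αL := paramNode_mem hα hL (by omega)
  have hnr : G.paramNode (l + m - 1) ∈ Icc G.α₀ G.αL := paramNode_mem hα hL hl
  have hαm' : α ∈ Icc G.α₀ G.αL := ⟨hnl.1.trans hαm.1, hαm.2.trans hnr.2⟩
  have hle : G.paramNode l ≤ G.paramNode (l + m - 1) := hαm.1.trans hαm.2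
  have hsub : Icc (G.paramNode l) (G.paramNode (l + m - 1)) ⊆ Icc G.α₀ G.αL :=
    Icc_subset_Icc hnl.1 hnr.2
  have hTα := hT0 α hαm'
  have hTmax : 0 < Tmax := hTα.trans_le (hW.T_mem α hαm').2
  have hstep := paramStep_pos hα hL
  have hregu := uniqueDiffOn_region hα hT0 (hW.T_contDiff.differentiableOn (by simp; omega))
  have hmaps := mapsTo_region hT0 hαm' ht
  have hnode : ∀ j ∈ Finset.Ico l (l + m), j ≤ G.L := fun j hj => by
    have := Finset.mem_Ico.1 hj; omega
  set h := G.maxTimeStep ^ (2 * q) with hh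
  have hh0 : 0 ≤ h := by rw [hh, pow_mul]; positivity
  set p := G.paramStep ^ (2 * m - 1) with hp
  have hp0 : 0 ≤ p := by positivity
  set τ := timeEnergy G m q l W with hτ
  have hE0 : ∀ j ∈ Finset.Ico l (l + m), 0 ≤ nodeEnergy G q W j := fun j hj =>
    intervalIntegral.integral_nonneg (hT0 _ (paramNode_mem hα hL (hnode j hj))).le
      fun _ _ => sq_nonneg _
  have hτ0 : 0 ≤ τ := Finset.sum_nonneg hE0
  -- the contribution of the sampled parameters
  set A := ∑ j ∈ Finset.Ico l (l + m), (σ + h * nodeEnergy G q W j) with hA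
  have hAeq : A = m * σ + h * τ := by
    rw [hA, Finset.sum_add_distrib, ← Finset.mul_sum]; simp [hτ, timeEnergy]
  have hm1 : (1 : ℝ) ≤ m := by exact_mod_cast (by omega : 1 ≤ m)
  have hAle : A ≤ m * (σ + τ * h) := by
    rw [hAeq]
    nlinarith [mul_nonneg hτ0 hh0]
  have hA0 : 0 ≤ A := by rw [hAeq]; positivity
  set S : ℝ × ℝ → ℝ := fun p => mixedSq G.region m Wt p + mixedSq G.region m W p with hS
  have hSc : ContinuousOn S G.region :=
    (continuousOn_mixedSq hregu hW.contDiff').add (continuousOn_mixedSq hregu hW.contDiff)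
  set I₂ := ∫ μ in G.paramNode l..G.paramNode (l + m - 1), ∫ s in (0 : ℝ)..G.T μ, S (μ, s) with hI₂
  set I₁ := ∫ μ in G.paramNode l..G.paramNode (l + m - 1),
    mixedSq G.region m W (μ, G.T μ * t / G.T α) with hI₁
  have hI₁0 : 0 ≤ I₁ := intervalIntegral.integral_nonneg hle fun _ _ => mixedSq_nonneg _ _ _ _
  have hI₂0 : 0 ≤ I₂ := intervalIntegral.integral_nonneg hle fun μ hμ =>
      intervalIntegral.integral_nonneg (hT0 _ (hsub hμ)).le fun s hs =>
        add_nonneg (mixedSq_nonneg _ _ _ _) (mixedSq_nonneg _ _ _ _)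
  have hP : paramEnergy G m l W Wt α t = I₂ + I₁ := rfl
  rw [hP]
  set R := σ + τ * h + (I₂ + I₁) * p with hR
  have hR0 : 0 ≤ R := by positivity
  have hRA : A ≤ m * R := hAle.trans (by
    have : 0 ≤ (I₂ + I₁) * p := by positivity
    exact mul_le_mul_of_nonneg_left (by rw [hR]; linarith) (by positivity))
  have hR1 : p * I₁ ≤ R := by
    have : 0 ≤ τ * h := by positivity
    have : 0 ≤ I₂ * p := by positivity
    rw [hR]; linarith
  have hR2 : p * I₂ ≤ R := by
    have : 0 ≤ τ * h := by positivity
    have : 0 ≤ I₁ * p := by positivity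
    rw [hR]; linarith
  have e1 : 0 ≤ C₂ * (C₁ * m + 1) := by positivity
  have e2 : 0 ≤ C₃ * (C₁ * m * |Tmax| + 1) := by positivity
  have e3 : 0 ≤ C₃ * (C₁ * m + 1) := by positivity
  have hnd := hnodeC G W Wt hlen hqM hL hW Q hQ σ hσ hx
  refine ⟨?_, ?_, ?_⟩
  · have h1 := hpar G hα hW.T_contDiff hT0 hW.T_deriv W hW.contDiff Q hQ l hl α hαm t ht
    have h2 : ∑ j ∈ Finset.Ico l (l + m),
        ‖Q (W (G.paramNode j, G.T (G.paramNode j) * t / G.T α))‖ ^ 2 ≤ C₁ * A := by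
      rw [hA, Finset.mul_sum]
      refine Finset.sum_le_sum fun j hj => (hnd j (hnode j hj)).2 _ ?_
      exact (hmaps (paramNode_mem hα hL (hnode j hj))).2
    calc _ ≤ C₂ * (C₁ * (m * R) + R) := by
          refine h1.trans ?_
          gcongr
          exact h2.trans (by gcongr)
      _ = C₂ * (C₁ * m + 1) * R := by ring
      _ ≤ _ := by gcongr; linarith
  · have h1 := hparI G hα hW.T_contDiff hW.T_mem hW.T_deriv W hW.contDiff Q hQ S hSc
      (fun p _ => le_add_of_nonneg_left (mixedSq_nonneg _ _ _ _)) l hl α hαm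
    have h2 : ∑ j ∈ Finset.Ico l (l + m),
        ∫ s in (0 : ℝ)..G.finalTime j, ‖Q (W (G.paramNode j, s))‖ ^ 2 ≤ C₁ * A * |Tmax| := by
      rw [hA, Finset.mul_sum, Finset.sum_mul]
      refine Finset.sum_le_sum fun j hj => ?_
      have hnj := paramNode_mem hα hL (hnode j hj)
      have hTj := hT0 _ hnj
      have hc : ContinuousOn (fun s => ‖Q (W (G.paramNode j, s))‖ ^ 2) (Icc 0 (G.finalTime j)) :=
        ((Q.continuous.comp_continuousOn (hW.contDiff.continuousOn.comp
          (continuousOn_const.prodMk continuousOn_id) fun s hs => ⟨hnj, hs⟩)).norm).pow 2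
      have h3 := intervalIntegral.integral_mono_on (μ := volume) hTj.le
        (hc.intervalIntegrable_of_Icc hTj.le) (by simp) (hnd j (hnode j hj)).2
      refine h3.trans ?_
      have h4 := hE0 j hj
      rw [intervalIntegral.integral_const, smul_eq_mul, sub_zero, mul_comm]
      gcongr
      exact (hW.T_mem _ hnj).2.trans (le_abs_self _)
    calc _ ≤ C₃ * (C₁ * (m * R) * |Tmax| + R) := by
          refine h1.trans ?_
          gcongr
          exact h2.trans (by gcongr)
      _ = C₃ * (C₁ * m * |Tmax| + 1) * R := by ring
      _ ≤ _ := by gcongr; linarith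
  · have h1 := hparI G hα hW.T_contDiff hW.T_mem hW.T_deriv Wt hW.contDiff' Q hQ S hSc
      (fun p _ => le_add_of_nonneg_right (mixedSq_nonneg _ _ _ _)) l hl α hαm
    have h2 : ∑ j ∈ Finset.Ico l (l + m),
        ∫ s in (0 : ℝ)..G.finalTime j, ‖Q (Wt (G.paramNode j, s))‖ ^ 2 ≤ C₁ * A := by
      rw [hA, Finset.mul_sum]
      exact Finset.sum_le_sum fun j hj => (hnd j (hnode j hj)).1
    calc _ ≤ C₃ * (C₁ * (m * R) + R) := by
          refine h1.trans ?_
          gcongr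
          exact h2.trans (by gcongr)
      _ = C₃ * (C₁ * m + 1) * R := by ring
      _ ≤ _ := by gcongr; linarith

/-- The error estimate for a Galerkin solution in a subspace `U` of a finite-dimensional inner
product space, in terms of a bound `σ` for the projection errors of the snapshots. -/
theorem exists_galerkin_const (m q : ℕ) (hm : 2 ≤ m) (hq : 2 ≤ q) (len Tmin Tmax B Λ Cp : ℝ)
    (hTmin : 0 < Tmin) (hΛ : 0 ≤ Λ) :
    ∃ C : ℝ, 0 < C ∧ ∀ {E H : Type} [NormedAddCommGroup E] [InnerProductSpace ℝ E]
      [FiniteDimensional ℝ E] [NormedAddCommGroup H] [InnerProductSpace ℝ H]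
      (G : SampleGrid) (W Wt : ℝ × ℝ → E), G.αL - G.α₀ = len → q ≤ G.M →
      IsSmoothFamily G m q Tmin Tmax B W Wt → ∀ (κ : E →L[ℝ] H), (∀ v, ‖κ v‖ ≤ Cp * ‖v‖) →
      ∀ (U : Submodule ℝ E) (σ : ℝ), 0 ≤ σ → SnapshotBound G W Uᗮ.starProjection σ →
      ∀ (l : ℕ), l + m - 1 ≤ G.L → ∀ α ∈ Icc (G.paramNode l) (G.paramNode (l + m - 1)),
      ∀ (ν : ℝ), 0 ≤ ν → ∀ (ur ur' : ℝ → E), ContinuousOn ur (Icc 0 (G.T α)) →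
      (∀ t ∈ Ioo 0 (G.T α), HasDerivAt ur (ur' t) t) → (∀ t ∈ Icc 0 (G.T α), ur t ∈ U) →
      ur 0 = U.starProjection (W (α, 0)) → ∀ n : ℝ → E → ℝ,
      (∀ t ∈ Ioo 0 (G.T α), ∀ v, |n t v| ≤ Λ * (‖κ (ur t - W (α, t))‖ * ‖κ v‖)) →
      (∀ t ∈ Ioo 0 (G.T α), ∀ v ∈ U, inner ℝ (κ (ur' t - Wt (α, t))) (κ v)
        + ν * inner ℝ (ur t - W (α, t)) v + n t v = 0) →
      ∀ t ∈ Icc 0 (G.T α),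
        ‖κ (ur t - W (α, t))‖ ^ 2 ≤ C * (σ + timeEnergy G m q l W * G.maxTimeStep ^ (2 * q)
          + paramEnergy G m l W Wt α t * G.paramStep ^ (2 * m - 1)) := by
  obtain ⟨C, hC, hproj⟩ := exists_projection_const m q hm hq len Tmin Tmax B hTmin
  refine ⟨2 * Cp ^ 2 * C + 2 * Real.exp ((3 * Λ + 1) * |Tmax|) * Cp ^ 2 * (Λ * C + C) + 1,
    by positivity, ?_⟩
  intro E H _ _ _ _ _ G W Wt hlen hqM hW κ hκ U σ hσ hx l hl α hαm ν hν ur ur' hurc hur hurU h0 n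
    hn heq t ht
  have hα := hW.lt
  have hL : 0 < G.L := by omega
  have hnl : G.paramNode l ∈ Icc G.α₀ G.αL := paramNode_mem hα hL (by omega)
  have hnr : G.paramNode (l + m - 1) ∈ Icc G.α₀ G.αL := paramNode_mem hα hL hl
  have hαm' : α ∈ Icc G.α₀ G.αL := ⟨hnl.1.trans hαm.1, hαm.2.trans hnr.2⟩
  have hTα : 0 < G.T α := hTmin.trans_le (hW.T_mem α hαm').1
  obtain ⟨h1, h2, h3⟩ := hproj G W Wt hlen hqM hW Uᗮ.starProjection
    (fun v => Uᗮ.norm_starProjection_apply_le v) σ hσ hx l hl α hαm t ht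
  set R := σ + timeEnergy G m q l W * G.maxTimeStep ^ (2 * q)
          + paramEnergy G m l W Wt α t * G.paramStep ^ (2 * m - 1) with hR
  have hR0 : 0 ≤ R := by
    have := (sq_nonneg _).trans h1
    exact nonneg_of_mul_nonneg_right this hC
  have hline : ∀ {w : ℝ × ℝ → E}, ContDiffOn ℝ m w G.region →
      ContinuousOn (fun s => w (α, s)) (Icc 0 (G.T α)) := fun hw =>
    hw.continuousOn.comp (continuousOn_const.prodMk continuousOn_id) fun s hs => ⟨hαm', hs⟩
  have hQi : ∀ {w : ℝ × ℝ → E}, ContDiffOn ℝ m w G.region → IntervalIntegrable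
      (fun s => ‖Uᗮ.starProjection (w (α, s))‖ ^ 2) volume 0 (G.T α) := fun hw =>
    ((Uᗮ.starProjection.continuous.comp_continuousOn (hline hw)).norm.pow 2).intervalIntegrable_of_Icc
      hTα.le
  have h4 := galerkin_error_le hν hΛ κ hκ U (hW.hasDeriv α hαm') (hline hW.contDiff') hurc hur hurU
    h0 n hn heq ht
  rw [intervalIntegral.integral_add ((hQi hW.contDiff).const_mul Λ) (hQi hW.contDiff'),
    intervalIntegral.integral_const_mul] at h4
  have h5 : Real.exp ((3 * Λ + 1) * G.T α) ≤ Real.exp ((3 * Λ + 1) * |Tmax|) := by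
    refine Real.exp_le_exp.2 (mul_le_mul_of_nonneg_left ?_ (by positivity))
    exact (hW.T_mem α hαm').2.trans (le_abs_self _)
  calc _ ≤ 2 * Cp ^ 2 * (C * R)
        + 2 * Real.exp ((3 * Λ + 1) * |Tmax|) * Cp ^ 2 * (Λ * (C * R) + C * R) := by
        refine h4.trans ?_
        gcongr
        exact add_nonneg
          (mul_nonneg hΛ (intervalIntegral.integral_nonneg hTα.le fun _ _ => sq_nonneg _))
          (intervalIntegral.integral_nonneg hTα.le fun _ _ => sq_nonneg _)
    _ = (2 * Cp ^ 2 * C + 2 * Real.exp ((3 * Λ + 1) * |Tmax|) * Cp ^ 2 * (Λ * C + C)) * R := by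
        ring
    _ ≤ _ := mul_le_mul_of_nonneg_right (by linarith) hR0

/-! ### Lipschitz functions that vanish outside a bounded domain -/

section Lipschitz

open scoped NNReal

/-- A function that is Lipschitz near every point, with one constant, is Lipschitz: along a segment
this is the mean value inequality. -/
theorem lipschitzWith_of_eventually_dist_le {F : Type*} [NormedAddCommGroup F] [NormedSpace ℝ F]
    {v : F → ℝ} {K : ℝ≥0} (h : ∀ x, ∀ᶠ y in 𝓝 x, |v y - v x| ≤ K * ‖y - x‖) :
    LipschitzWith K v := by
  have hc : Continuous v := by
    refine continuous_iff_continuousAt.2 fun x => ?_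
    have h1 : Tendsto (fun y => (K : ℝ) * ‖y - x‖) (𝓝 x) (𝓝 0) := by
      have : Tendsto (fun y => (K : ℝ) * ‖y - x‖) (𝓝 x) (𝓝 (K * ‖x - x‖)) :=
        (Continuous.tendsto (by fun_prop) x)
      simpa using this
    have h2 : Tendsto (fun y => v y - v x) (𝓝 x) (𝓝 0) := squeeze_zero_norm' (h x) h1
    simpa [ContinuousAt] using h2.add_const (v x)
  have key : ∀ x y, v y - v x ≤ K * ‖y - x‖ := by
    intro x y
    let γ : ℝ → F := fun t => x + t • (y - x)
    have hγ : Continuous γ := by fun_prop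
    have hb := image_le_of_liminf_slope_right_le_deriv_boundary (f := fun t => v (γ t)) (a := 0)
      (b := 1) (hc.comp hγ).continuousOn (B := fun t => v x + t * (K * ‖y - x‖))
      (B' := fun _ => K * ‖y - x‖) (by simp [γ]) (by fun_prop)
      (fun t _ => by
        simpa using ((hasDerivWithinAt_id t (Ici t)).mul_const (K * ‖y - x‖)).const_add (v x)) ?_
      (right_mem_Icc.2 zero_le_one)
    · simpa [γ, add_comm] using sub_left_le_of_le_add hb
    · intro t _ r hr
      refine Eventually.frequently ?_
      have h1 : ∀ᶠ z in 𝓝[>] t, |v (γ z) - v (γ t)| ≤ K * ‖γ z - γ t‖ :=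
        (hγ.continuousWithinAt (s := Ioi t)).eventually (h (γ t))
      filter_upwards [h1, self_mem_nhdsWithin] with z hz hzt
      have hzt' : 0 < z - t := sub_pos.2 hzt
      have h2 : γ z - γ t = (z - t) • (y - x) := by simp only [γ]; module
      rw [h2, norm_smul, Real.norm_of_nonneg hzt'.le] at hz
      refine lt_of_le_of_lt ?_ hr
      rw [slope_def_field, div_le_iff₀ hzt']
      calc _ ≤ |v (γ z) - v (γ t)| := le_abs_self _
        _ ≤ _ := hz.trans_eq (by ring)
  refine LipschitzWith.of_dist_le_mul fun x y => ?_
  rw [Real.dist_eq, dist_eq_norm]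
  refine abs_le.2 ⟨?_, key y x⟩
  have := key x y
  rw [norm_sub_rev] at this
  linarith

/-- A function that is Lipschitz on each set of a finite closed cover of a normed space is
Lipschitz. -/
theorem lipschitzWith_of_finite_closed_cover {F ι : Type*} [NormedAddCommGroup F]
    [NormedSpace ℝ F] [Finite ι] {A : ι → Set F} (hA : ∀ i, IsClosed (A i)) (hU : ∀ x, ∃ i, x ∈ A i)
    {v : F → ℝ} {K : ℝ≥0} (h : ∀ i, LipschitzOnWith K v (A i)) : LipschitzWith K v := by
  refine lipschitzWith_of_eventually_dist_le fun x => ?_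
  have h1 : ∀ᶠ y in 𝓝 x, ∀ i, y ∈ A i → x ∈ A i := by
    refine eventually_all.2 fun i => ?_
    by_cases hx : x ∈ A i
    · exact Eventually.of_forall fun _ _ => hx
    · filter_upwards [(hA i).isOpen_compl.mem_nhds hx] with y hy hy'
      exact absurd hy' hy
  filter_upwards [h1] with y hy
  obtain ⟨i, hi⟩ := hU y
  simpa [Real.dist_eq, dist_eq_norm] using (h i).dist_le_mul y hi x (hy i hi)

end Lipschitz

section FiniteElements

open scoped NNReal

variable {d : ℕ} {K : Geometry.SimplicialComplex ℝ (Eu d)} {Ω : Set (Eu d)} {k : ℕ}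

theorem contDiff_eval_mvPolynomial (p : MvPolynomial (Fin d) ℝ) :
    ContDiff ℝ 1 fun x : Eu d => MvPolynomial.eval (fun i => x i) p := by
  have h := AnalyticOnNhd.eval_continuousLinearMap (𝕜 := ℝ)
    (EuclideanSpace.equiv (Fin d) ℝ : Eu d →L[ℝ] Fin d → ℝ) p
  exact (h.contDiff : ContDiff ℝ 1 _)

/-- Every point of the closure of `Ω` lies in a `d`-simplex of the triangulation. -/
theorem _root_.IsTriangulation.exists_facet (hK : IsTriangulation K Ω) {x : Eu d}
    (hx : x ∈ closure Ω) :
    ∃ s ∈ K.faces, s.card = d + 1 ∧ x ∈ convexHull ℝ (s : Set (Eu d)) := by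
  rw [← hK.cover] at hx
  obtain ⟨s, hs, hxs⟩ := Geometry.SimplicialComplex.mem_space_iff.1 hx
  obtain ⟨s', hs', hss', hc⟩ := hK.pure s hs
  exact ⟨s', hs', hc, convexHull_mono (Finset.coe_subset.2 hss') hxs⟩

/-- A finite element function is Lipschitz on each simplex and vanishes on the complement of `Ω`;
these finitely many closed sets cover the space. -/
theorem exists_lipschitzWith_of_mem_feSpace (hK : IsTriangulation K Ω) (hΩ : IsOpen Ω)
    {v : Eu d → ℝ} (hv : v ∈ feSpace K Ω k) : ∃ C : ℝ≥0, LipschitzWith C v := by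
  obtain ⟨-, hv0, hvp⟩ := hv
  have hloc : ∀ s ∈ K.faces, s.card = d + 1 →
      ∃ C : ℝ≥0, LipschitzOnWith C v (convexHull ℝ (s : Set (Eu d))) := by
    intro s hs hc
    obtain ⟨p, -, hp⟩ := hvp s hs hc
    obtain ⟨C, hC⟩ := (contDiff_eval_mvPolynomial p).contDiffOn.exists_lipschitzOnWith one_ne_zero
      (convex_convexHull ℝ (s : Set (Eu d))) (s.finite_toSet.isCompact_convexHull ℝ)
    exact ⟨C, fun x hx y hy => by rw [hp x hx, hp y hy]; exact hC hx hy⟩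
  choose! C hC using hloc
  let F : Set (Finset (Eu d)) := {s ∈ K.faces | s.card = d + 1}
  have hF : F.Finite := hK.finite.subset (sep_subset _ _)
  have := hF.fintype
  let A : Option F → Set (Eu d) := fun i => i.elim Ωᶜ fun s => convexHull ℝ (s.1 : Set (Eu d))
  refine ⟨∑ s : F, C s, lipschitzWith_of_finite_closed_cover (A := A) ?_ ?_ ?_⟩
  · rintro (_ | s)
    · exact hΩ.isClosed_compl
    · exact (s.1.finite_toSet.isCompact_convexHull ℝ).isClosed
  · intro x
    by_cases hx : x ∈ Ω
    · obtain ⟨s, hs, hc, hxs⟩ := hK.exists_facet (subset_closure hx)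
      exact ⟨some ⟨s, hs, hc⟩, hxs⟩
    · exact ⟨none, hx⟩
  · rintro (_ | s)
    · intro x hx y hy
      rw [hv0 x hx, hv0 y hy, edist_self]
      exact zero_le
    · refine (hC s.1 s.2.1 s.2.2).weaken ?_
      exact Finset.single_le_sum (f := fun s : F => C s) (fun _ _ => zero_le) (Finset.mem_univ s)

variable (K Ω k) in
/-- The finite element space as a subspace. -/
def feSubmodule : Submodule ℝ (Eu d → ℝ) where
  carrier := feSpace K Ω k
  add_mem' := by
    rintro v w ⟨hv, hv0, hvp⟩ ⟨hw, hw0, hwp⟩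
    refine ⟨hv.add hw, fun x hx => by simp [hv0 x hx, hw0 x hx], fun s hs hc => ?_⟩
    obtain ⟨p, hp, hp'⟩ := hvp s hs hc
    obtain ⟨p₂, hp₂, hp₂'⟩ := hwp s hs hc
    exact ⟨p + p₂, (MvPolynomial.totalDegree_add _ _).trans (max_le hp hp₂),
      fun x hx => by simp [hp' x hx, hp₂' x hx]⟩
  zero_mem' := ⟨continuousOn_const, fun _ _ => rfl, fun _ _ _ => ⟨0, by simp, by simp⟩⟩
  smul_mem' := by
    rintro c v ⟨hv, hv0, hvp⟩
    refine ⟨hv.const_smul c, fun x hx => by simp [hv0 x hx], fun s hs hc => ?_⟩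
    obtain ⟨p, hp, hp'⟩ := hvp s hs hc
    exact ⟨c • p, (MvPolynomial.totalDegree_smul_le _ _).trans hp,
      fun x hx => by simp [hp' x hx]⟩

/-- A finite element function is determined by one polynomial of bounded degree on each simplex. -/
theorem finiteDimensional_feSubmodule (hK : IsTriangulation K Ω) :
    FiniteDimensional ℝ (feSubmodule K Ω k) := by
  classical
  let F : Set (Finset (Eu d)) := {s ∈ K.faces | s.card = d + 1}
  have hF : F.Finite := hK.finite.subset (sep_subset _ _)
  have := hF.fintype
  have hσ : ∀ x ∈ Ω, ∃ s : F, x ∈ convexHull ℝ (s.1 : Set (Eu d)) := fun x hx => by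
    obtain ⟨s, hs, hc, hxs⟩ := hK.exists_facet (subset_closure hx)
    exact ⟨⟨s, hs, hc⟩, hxs⟩
  choose σ hσ using hσ
  -- a family of polynomials, glued along a choice of one simplex for each point
  let Ψ : (F → MvPolynomial.restrictTotalDegree (Fin d) ℝ k) →ₗ[ℝ] Eu d → ℝ :=
    { toFun := fun p x => if hx : x ∈ Ω then
        MvPolynomial.eval (fun i => x i) (p (σ x hx) : MvPolynomial (Fin d) ℝ) else 0
      map_add' := fun p p' => by ext x; by_cases hx : x ∈ Ω <;> simp [hx]
      map_smul' := fun c p => by ext x; by_cases hx : x ∈ Ω <;> simp [hx] }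
  have hle : feSubmodule K Ω k ≤ LinearMap.range Ψ := by
    rintro v ⟨-, hv0, hvp⟩
    choose! p hp hp' using hvp
    refine ⟨fun s => ⟨p s.1, (MvPolynomial.mem_restrictTotalDegree _ _ _).2 (hp _ s.2.1 s.2.2)⟩, ?_⟩
    ext x
    by_cases hx : x ∈ Ω
    · simpa [Ψ, hx] using (hp' _ (σ x hx).2.1 (σ x hx).2.2 x (hσ x hx)).symm
    · simp [Ψ, hx, hv0 x hx]
  exact Submodule.finiteDimensional_of_le hle

end FiniteElements

/-! ### Poincaré's inequality for Lipschitz functions that vanish outside the domain -/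

section Poincare

open scoped NNReal Convolution

variable {d : ℕ} {Ω : Set (Eu d)}

theorem norm_gradient_eq (v : Eu d → ℝ) (x : Eu d) : ‖gradient v x‖ = ‖fderiv ℝ v x‖ := by
  simp [gradient]

theorem measurable_gradient (v : Eu d → ℝ) : Measurable (gradient v) :=
  (InnerProductSpace.toDual ℝ (Eu d)).symm.continuous.measurable.comp (measurable_fderiv ℝ v)

theorem norm_gradient_le {v : Eu d → ℝ} {C : ℝ≥0} (hv : LipschitzWith C v) (x : Eu d) :
    ‖gradient v x‖ ≤ C :=
  (norm_gradient_eq v x).trans_le (norm_fderiv_le_of_lipschitz ℝ hv)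

/-- Poincaré's inequality passes to limits: if bounded functions with bounded gradients converge
almost everywhere together with their gradients, dominated convergence applies to both sides. -/
theorem poincare_of_tendsto {Cp M K : ℝ} (hΩb : Bornology.IsBounded Ω)
    {w : ℕ → Eu d → ℝ} {v : Eu d → ℝ} (hw : ∀ n, Continuous (w n)) (hM : ∀ n x, |w n x| ≤ M)
    (hK : ∀ n x, ‖fderiv ℝ (w n) x‖ ≤ K)
    (hlim : ∀ᵐ x, Tendsto (fun n => w n x) atTop (𝓝 (v x)))
    (hlim' : ∀ᵐ x, Tendsto (fun n => fderiv ℝ (w n) x) atTop (𝓝 (fderiv ℝ v x)))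
    (h : ∀ n, √(∫ x in Ω, w n x ^ 2) ≤ Cp * √(∫ x in Ω, ‖fderiv ℝ (w n) x‖ ^ 2)) :
    √(∫ x in Ω, v x ^ 2) ≤ Cp * √(∫ x in Ω, ‖fderiv ℝ v x‖ ^ 2) := by
  have : IsFiniteMeasure ((volume : Measure (Eu d)).restrict Ω) :=
    isFiniteMeasure_restrict.2 hΩb.measure_lt_top.ne
  have h1 : Tendsto (fun n => ∫ x in Ω, w n x ^ 2) atTop (𝓝 (∫ x in Ω, v x ^ 2)) := by
    refine tendsto_integral_of_dominated_convergence (fun _ => M ^ 2)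
      (fun n => ((hw n).pow 2).aestronglyMeasurable) (integrable_const _)
      (fun n => Eventually.of_forall fun x => ?_) ?_
    · rw [Real.norm_eq_abs, abs_pow]
      exact pow_le_pow_left₀ (abs_nonneg _) (hM n x) 2
    · exact ae_restrict_of_ae (hlim.mono fun x hx => hx.pow 2)
  have h2 : Tendsto (fun n => ∫ x in Ω, ‖fderiv ℝ (w n) x‖ ^ 2) atTop
      (𝓝 (∫ x in Ω, ‖fderiv ℝ v x‖ ^ 2)) := by
    refine tendsto_integral_of_dominated_convergence (fun _ => K ^ 2)
      (fun n => (((measurable_fderiv ℝ (w n)).norm).pow_const 2).aestronglyMeasurable)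
      (integrable_const _) (fun n => Eventually.of_forall fun x => ?_) ?_
    · rw [norm_pow, norm_norm]
      exact pow_le_pow_left₀ (norm_nonneg _) (hK n x) 2
    · exact ae_restrict_of_ae (hlim'.mono fun x hx => hx.norm.pow 2)
  exact le_of_tendsto_of_tendsto' h1.sqrt (h2.sqrt.const_mul Cp) h

/-- Test functions belong to `H¹₀(Ω)`, with the constant approximating sequence. -/
theorem _root_.PoincareIneq.of_testFunction {Cp : ℝ} (hP : PoincareIneq Ω Cp)
    (hΩb : Bornology.IsBounded Ω) {φ : Eu d → ℝ} {C : ℝ} (hφ : ContDiff ℝ (⊤ : ℕ∞) φ)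
    (hc : HasCompactSupport φ) (hs : tsupport φ ⊆ Ω) (hC : ∀ x, ‖fderiv ℝ φ x‖ ≤ C) :
    √(∫ x in Ω, φ x ^ 2) ≤ Cp * √(∫ x in Ω, ‖fderiv ℝ φ x‖ ^ 2) := by
  have : IsFiniteMeasure ((volume : Measure (Eu d)).restrict Ω) :=
    isFiniteMeasure_restrict.2 hΩb.measure_lt_top.ne
  have h := hP φ (gradient φ) ⟨hφ.continuous.memLp_of_hasCompactSupport hc,
    MemLp.of_bound (measurable_gradient φ).aestronglyMeasurable C
      (Eventually.of_forall fun x => (norm_gradient_eq φ x).trans_le (hC x)),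
    fun _ => φ, fun _ => ⟨hφ, hc, hs⟩, by simp, by simp⟩
  simpa only [norm_gradient_eq] using h

/-- The derivative of the mollification of a Lipschitz function is the mollification of its
derivative. -/
theorem hasFDerivAt_normed_convolution (b : ContDiffBump (0 : Eu d)) {w : Eu d → ℝ} {C : ℝ≥0}
    (hw : LipschitzWith C w) (x : Eu d) :
    HasFDerivAt (b.normed volume ⋆[ContinuousLinearMap.lsmul ℝ ℝ, volume] w)
      ((b.normed volume ⋆[ContinuousLinearMap.lsmul ℝ ℝ, volume] fderiv ℝ w) x) x := by
  have hb := b.integrable_normed (μ := volume)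
  have hm : ∀ y, AEStronglyMeasurable (fun t => b.normed volume t • w (y - t)) volume := fun y =>
    (b.continuous_normed.smul (hw.continuous.comp (continuous_const.sub continuous_id))).aestronglyMeasurable
  have hd : ∀ᵐ t, DifferentiableAt ℝ w (x - t) :=
    (Measure.measurePreserving_sub_left volume x).quasiMeasurePreserving.ae hw.ae_differentiableAt
  refine (hasFDerivAt_integral_of_dominated_loc_of_lip (s := univ)
    (F := fun y t => b.normed volume t • w (y - t))
    (F' := fun t => b.normed volume t • fderiv ℝ w (x - t)) (bound := fun t => b.normed volume t * C)
    univ_mem (Eventually.of_forall hm) ?_ ?_ ?_ (hb.mul_const _) ?_).2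
  · refine Continuous.integrable_of_hasCompactSupport ?_ ?_
    · exact b.continuous_normed.smul (hw.continuous.comp (continuous_const.sub continuous_id))
    · exact b.hasCompactSupport_normed.smul_right
  · exact (b.continuous_normed.measurable.smul
      ((measurable_fderiv ℝ w).comp (measurable_const.sub measurable_id))).aestronglyMeasurable
  · refine Eventually.of_forall fun t => LipschitzOnWith.of_dist_le_mul fun y _ z _ => ?_
    have h1 := hw.dist_le_mul (y - t) (z - t)
    have h0 := b.nonneg_normed (μ := volume) t
    rw [dist_sub_right] at h1
    rw [Real.coe_nnabs, abs_of_nonneg (by positivity), dist_smul₀, Real.norm_of_nonneg h0, mul_assoc]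
    exact mul_le_mul_of_nonneg_left h1 h0
  · filter_upwards [hd] with t ht
    have h1 : HasFDerivAt (fun y => w (y - t)) (fderiv ℝ w (x - t)) x :=
      (hasFDerivAt_comp_sub t).2 ht.hasFDerivAt
    exact h1.const_smul (b.normed volume t)

/-- For a Lipschitz function with compact support in `Ω` the mollifications are test functions, and
they converge together with their gradients. -/
theorem _root_.PoincareIneq.of_lipschitz_of_compact {Cp : ℝ} (hP : PoincareIneq Ω Cp) (hΩ : IsOpen Ω)
    (hΩb : Bornology.IsBounded Ω) {w : Eu d → ℝ} {C : ℝ≥0} (hw : LipschitzWith C w)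
    (hc : HasCompactSupport w) (hs : tsupport w ⊆ Ω) :
    √(∫ x in Ω, w x ^ 2) ≤ Cp * √(∫ x in Ω, ‖fderiv ℝ w x‖ ^ 2) := by
  obtain ⟨δ, hδ, hδΩ⟩ := IsCompact.exists_cthickening_subset_open hc hΩ hs
  obtain ⟨M, hM⟩ := hw.continuous.bounded_above_of_compact_support hc
  let b : ℕ → ContDiffBump (0 : Eu d) := fun n =>
    ⟨δ / (n + 1) / 2, δ / (n + 1), by positivity, half_lt_self (by positivity)⟩
  let φ : ℕ → Eu d → ℝ := fun n =>
    (b n).normed volume ⋆[ContinuousLinearMap.lsmul ℝ ℝ, volume] w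
  have hout : ∀ n, (b n).rOut ≤ δ := fun n =>
    div_le_self hδ.le (by linarith [(Nat.cast_nonneg n : (0 : ℝ) ≤ n)])
  have hlim0 : Tendsto (fun n => (b n).rOut) atTop (𝓝 0) := by
    have := tendsto_one_div_add_atTop_nhds_zero_nat (𝕜 := ℝ)
    simpa [b, div_eq_mul_inv] using this.const_mul δ
  have hder : ∀ n x, HasFDerivAt (φ n)
      (((b n).normed volume ⋆[ContinuousLinearMap.lsmul ℝ ℝ, volume] fderiv ℝ w) x) x :=
    fun n x => hasFDerivAt_normed_convolution (b n) hw x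
  have hint : LocallyIntegrable (fderiv ℝ w) volume := by
    intro x
    refine ⟨Metric.closedBall x 1, Metric.closedBall_mem_nhds x one_pos, ?_⟩
    refine Measure.integrableOn_of_bounded (M := C) (Metric.isBounded_closedBall.measure_lt_top.ne)
      (measurable_fderiv ℝ w).aestronglyMeasurable
      (Eventually.of_forall fun y => norm_fderiv_le_of_lipschitz ℝ hw)
  have hφK : ∀ n x, ‖fderiv ℝ (φ n) x‖ ≤ C := by
    intro n x
    rw [(hder n x).fderiv]
    have hb := (b n).integrable_normed (μ := volume)
    have h1 := norm_integral_le_of_norm_le (hb.mul_const C)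
      (f := fun t => (b n).normed volume t • fderiv ℝ w (x - t)) (Eventually.of_forall fun t => by
        rw [norm_smul, Real.norm_of_nonneg ((b n).nonneg_normed t)]
        exact mul_le_mul_of_nonneg_left (norm_fderiv_le_of_lipschitz ℝ hw)
          ((b n).nonneg_normed t))
    rw [integral_mul_const, (b n).integral_normed, one_mul] at h1
    exact h1
  have hsupp : ∀ n, tsupport (φ n) ⊆ Metric.cthickening δ (tsupport w) := by
    intro n
    refine closure_minimal ?_ Metric.isClosed_cthickening
    refine (support_convolution_subset _).trans ?_
    rintro _ ⟨y, hy, z, hz, rfl⟩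
    rw [(b n).support_normed_eq] at hy
    refine Metric.mem_cthickening_of_dist_le _ z _ _ (subset_tsupport w hz) ?_
    simpa using (mem_ball_zero_iff.1 hy).le.trans (hout n)
  refine poincare_of_tendsto hΩb (w := φ) (M := M + C * δ) (K := C)
    (fun n => continuous_iff_continuousAt.2 fun x => (hder n x).continuousAt) ?_ hφK ?_ ?_ ?_
  · intro n x
    have h1 := ContDiffBump.dist_normed_convolution_le (φ := b n) (μ := volume) (g := w) (x₀ := x)
      (ε := C * δ) hw.continuous.aestronglyMeasurable fun y hy =>
        (hw.dist_le_mul y x).trans (by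
          gcongr
          exact (Metric.mem_ball.1 hy).le.trans (hout n))
    have h2 := hM x
    rw [Real.dist_eq] at h1
    rw [Real.norm_eq_abs] at h2
    have h3 := abs_add_le (φ n x - w x) (w x)
    rw [sub_add_cancel] at h3
    simp only [φ] at h3 ⊢
    linarith
  · exact Eventually.of_forall fun x =>
      ContDiffBump.convolution_tendsto_right_of_continuous hlim0 hw.continuous x
  · have h1 := ContDiffBump.ae_convolution_tendsto_right_of_locallyIntegrable (K := 2) hlim0
      (Eventually.of_forall fun n => by simp only [b]; linarith) hint
    filter_upwards [h1] with x hx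
    simpa only [(hder _ x).fderiv] using hx
  · intro n
    refine hP.of_testFunction hΩb ?_ ?_ ((hsupp n).trans hδΩ) (hφK n)
    · exact HasCompactSupport.contDiff_convolution_left _ (b n).hasCompactSupport_normed
        (b n).contDiff_normed hw.continuous.locallyIntegrable
    · exact (b n).hasCompactSupport_normed.convolution _ hc

/-- The derivative of a Lipschitz function vanishes almost everywhere on its zero set. -/
theorem ae_fderiv_eq_zero (hd : 1 ≤ d) {v : Eu d → ℝ} {C : ℝ≥0} (hv : LipschitzWith C v) :
    ∀ᵐ x, v x = 0 → fderiv ℝ v x = 0 := by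
  let e : Eu d := EuclideanSpace.single ⟨0, hd⟩ 1
  have he : ‖e‖ = 1 := by simp [e]
  let s : Set (Eu d) := {x | v x = 0} ∩ {x | DifferentiableAt ℝ v x}
  have hs : MeasurableSet s :=
    (isClosed_eq hv.continuous continuous_const).measurableSet.inter
      (measurableSet_of_differentiableAt ℝ v)
  -- on the zero set, `v` is approximated by the zero map with constant `0`; the factor `e` makes
  -- it a map from the space to itself
  have h1 : ApproximatesLinearOn (fun x => v x • e) (0 : Eu d →L[ℝ] Eu d) s 0 :=
    fun x hx y hy => by simp [show v x = 0 from hx.1, show v y = 0 from hy.1]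
  have h2 := h1.norm_fderiv_sub_le volume hs (fun x => (fderiv ℝ v x).smulRight e)
    fun x hx => (hx.2.hasFDerivAt.smul_const e).hasFDerivWithinAt
  rw [ae_restrict_iff' hs] at h2
  filter_upwards [h2, hv.ae_differentiableAt] with x hx hdx hvx
  have h3 := hx ⟨hvx, hdx⟩
  rw [sub_zero, nonpos_iff_eq_zero, nnnorm_eq_zero] at h3
  ext y
  have h4 := congrArg (fun L : Eu d →L[ℝ] Eu d => ‖L y‖) h3
  simpa [norm_smul, he] using h4

/-- Poincaré's inequality for a Lipschitz function `v` that vanishes outside `Ω`. The functions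
`v - max (-ε) (min ε v)` have compact support in `Ω`, and for small `ε` their derivative at a point
is that of `v` where `v ≠ 0` and zero where `v = 0`. -/
theorem _root_.PoincareIneq.of_lipschitz {Cp : ℝ} (hP : PoincareIneq Ω Cp) (hd : 1 ≤ d) (hΩ : IsOpen Ω)
    (hΩb : Bornology.IsBounded Ω) {v : Eu d → ℝ} {C : ℝ≥0} (hv : LipschitzWith C v)
    (hv0 : ∀ x, x ∉ Ω → v x = 0) :
    √(∫ x in Ω, v x ^ 2) ≤ Cp * √(∫ x in Ω, ‖fderiv ℝ v x‖ ^ 2) := by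
  have hcomp : IsCompact (closure Ω) := hΩb.isCompact_closure
  have hcs : HasCompactSupport v := HasCompactSupport.intro hcomp fun x hx =>
    hv0 x fun h => hx (subset_closure h)
  obtain ⟨M, hM⟩ := hv.continuous.bounded_above_of_compact_support hcs
  let ε : ℕ → ℝ := fun n => 1 / ((n : ℝ) + 1)
  have hε : ∀ n, 0 < ε n := fun n => Nat.one_div_pos_of_nat
  have hε1 : ∀ n, ε n ≤ 1 := fun n =>
    div_le_one_of_le₀ (by linarith [(Nat.cast_nonneg n : (0 : ℝ) ≤ n)]) (by positivity)
  have hε0 : Tendsto ε atTop (𝓝 0) := tendsto_one_div_add_atTop_nhds_zero_nat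
  let w : ℕ → Eu d → ℝ := fun n x => v x - max (-ε n) (min (ε n) (v x))
  have hcl : ∀ n x, |max (-ε n) (min (ε n) (v x))| ≤ ε n := fun n x =>
    abs_le.2 ⟨le_max_left _ _, max_le (by linarith [hε n]) (min_le_left _ _)⟩
  have hwL : ∀ n, LipschitzWith (C + C) (w n) := fun n =>
    hv.sub ((hv.const_min (ε n)).const_max (-ε n))
  have hwz : ∀ n x, |v x| ≤ ε n → w n x = 0 := fun n x hx => by
    obtain ⟨h1, h2⟩ := abs_le.1 hx
    simp [w, min_eq_right h2, max_eq_right h1]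
  have hsupp : ∀ n, tsupport (w n) ⊆ {x | ε n ≤ |v x|} := fun n => by
    refine closure_minimal (fun x hx => ?_) (isClosed_le continuous_const hv.continuous.abs)
    by_contra h
    exact hx (hwz n x (not_le.1 h).le)
  have hsub : ∀ n, {x | ε n ≤ |v x|} ⊆ Ω := fun n x hx => by
    by_contra h
    have : ε n ≤ |v x| := hx
    rw [hv0 x h, abs_zero] at this
    linarith [hε n]
  refine poincare_of_tendsto hΩb (w := w) (M := M + 1) (K := (C + C : ℝ≥0))
    (fun n => (hwL n).continuous) ?_ (fun n x => norm_fderiv_le_of_lipschitz ℝ (hwL n)) ?_ ?_ ?_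
  · intro n x
    have h1 := hM x
    rw [Real.norm_eq_abs] at h1
    exact (abs_sub _ _).trans (add_le_add h1 ((hcl n x).trans (hε1 n)))
  · refine Eventually.of_forall fun x => ?_
    have h1 : Tendsto (fun n => max (-ε n) (min (ε n) (v x))) atTop (𝓝 0) :=
      squeeze_zero_norm (fun n => hcl n x) hε0
    simpa [w] using h1.const_sub (v x)
  · filter_upwards [ae_fderiv_eq_zero hd hv] with x hx
    refine tendsto_const_nhds.congr' ?_
    by_cases hvx : v x = 0
    · refine Eventually.of_forall fun n => ?_
      have h1 : w n =ᶠ[𝓝 x] fun _ => 0 := by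
        have h2 : ∀ᶠ y in 𝓝 x, |v y| < ε n :=
          (hv.continuous.abs.tendsto x).eventually_lt_const (by simpa [hvx] using hε n)
        filter_upwards [h2] with y hy using hwz n y hy.le
      simp only [hx hvx, h1.fderiv_eq]
      simp
    · filter_upwards [hε0.eventually_lt_const (abs_pos.2 hvx)] with n hn
      rcases lt_or_gt_of_ne hvx with h | h
      · have h1 : w n =ᶠ[𝓝 x] fun y => v y - -ε n := by
          have h2 : ∀ᶠ y in 𝓝 x, v y < -ε n :=
            (hv.continuous.tendsto x).eventually_lt_const (by rw [abs_of_neg h] at hn; linarith)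
          filter_upwards [h2] with y hy
          have := hε n
          simp only [w]
          rw [min_eq_right (by linarith), max_eq_left hy.le]
        simp only [h1.fderiv_eq, fderiv_sub_const]
      · have h1 : w n =ᶠ[𝓝 x] fun y => v y - ε n := by
          have h2 : ∀ᶠ y in 𝓝 x, ε n < v y :=
            (hv.continuous.tendsto x).eventually_const_lt (by rwa [abs_of_pos h] at hn)
          filter_upwards [h2] with y hy
          have := hε n
          simp only [w]
          rw [min_eq_left hy.le, max_eq_right (by linarith)]
        simp only [h1.fderiv_eq, fderiv_sub_const]
  · intro n
    refine hP.of_lipschitz_of_compact hΩ hΩb (hwL n) ?_ ((hsupp n).trans (hsub n))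
    exact hcomp.of_isClosed_subset (isClosed_tsupport _)
      (((hsupp n).trans (hsub n)).trans subset_closure)

end Poincare

/-! ### Coordinates on a finite-dimensional space of Lipschitz functions -/

section Coordinates

open scoped NNReal

variable {d : ℕ} {Ω : Set (Eu d)}

variable (Ω) in
/-- The Lipschitz functions on `ℝ^d` that vanish outside `Ω`. -/
def lipSpace : Submodule ℝ (Eu d → ℝ) where
  carrier := {v | (∃ C : ℝ≥0, LipschitzWith C v) ∧ ∀ x, x ∉ Ω → v x = 0}
  add_mem' := by
    rintro v w ⟨⟨C, hv⟩, hv0⟩ ⟨⟨D, hw⟩, hw0⟩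
    exact ⟨⟨C + D, hv.add hw⟩, fun x hx => by simp [hv0 x hx, hw0 x hx]⟩
  zero_mem' := ⟨⟨0, LipschitzWith.const 0⟩, fun _ _ => rfl⟩
  smul_mem' := by
    rintro c v ⟨⟨C, hv⟩, hv0⟩
    exact ⟨⟨‖c‖₊ * C, (lipschitzWith_smul c).comp hv⟩, fun x hx => by simp [hv0 x hx]⟩

theorem feSubmodule_le_lipSpace {K : Geometry.SimplicialComplex ℝ (Eu d)} {k : ℕ}
    (hK : IsTriangulation K Ω) (hΩ : IsOpen Ω) : feSubmodule K Ω k ≤ lipSpace Ω :=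
  fun _ hv => ⟨exists_lipschitzWith_of_mem_feSpace hK hΩ hv, hv.2.1⟩

theorem continuous_of_mem_lipSpace {v : Eu d → ℝ} (hv : v ∈ lipSpace Ω) : Continuous v :=
  hv.1.choose_spec.continuous

theorem memLp_of_mem_lipSpace (hΩb : Bornology.IsBounded Ω) {v : Eu d → ℝ} (hv : v ∈ lipSpace Ω) :
    MemLp v 2 (volume.restrict Ω) :=
  (continuous_of_mem_lipSpace hv).memLp_of_hasCompactSupport
    (HasCompactSupport.intro hΩb.isCompact_closure fun x hx => hv.2 x fun h => hx (subset_closure h))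

theorem memLp_gradient (hΩb : Bornology.IsBounded Ω) {v : Eu d → ℝ} (hv : v ∈ lipSpace Ω) :
    MemLp (gradient v) 2 (volume.restrict Ω) := by
  have : IsFiniteMeasure ((volume : Measure (Eu d)).restrict Ω) :=
    isFiniteMeasure_restrict.2 hΩb.measure_lt_top.ne
  obtain ⟨⟨C, hC⟩, -⟩ := hv
  exact MemLp.of_bound (measurable_gradient v).aestronglyMeasurable C
    (Eventually.of_forall (norm_gradient_le hC))

theorem integrable_inner_gradient (hΩb : Bornology.IsBounded Ω) {v w : Eu d → ℝ}
    (hv : v ∈ lipSpace Ω) (hw : w ∈ lipSpace Ω) :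
    Integrable (fun x => inner ℝ (gradient v x) (gradient w x)) (volume.restrict Ω) :=
  ((memLp_gradient hΩb hv).norm.integrable_mul (memLp_gradient hΩb hw).norm).mono'
    ((measurable_gradient v).inner (measurable_gradient w)).aestronglyMeasurable
    (Eventually.of_forall fun _ => norm_inner_le_norm _ _)

theorem ae_differentiableAt_of_mem_lipSpace {v : Eu d → ℝ} (hv : v ∈ lipSpace Ω) :
    ∀ᵐ x ∂(volume.restrict Ω), DifferentiableAt ℝ v x :=
  ae_restrict_of_ae hv.1.choose_spec.ae_differentiableAt

theorem gradient_add {v w : Eu d → ℝ} {x : Eu d} (hv : DifferentiableAt ℝ v x)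
    (hw : DifferentiableAt ℝ w x) : gradient (v + w) x = gradient v x + gradient w x := by
  simp only [gradient, fderiv_add hv hw, map_add]

theorem gradient_smul {v : Eu d → ℝ} {x : Eu d} (hv : DifferentiableAt ℝ v x) (c : ℝ) :
    gradient (c • v) x = c • gradient v x := by
  simp only [gradient, fderiv_const_smul hv c, map_smulₛₗ]
  simp

theorem gradInner_comm (v w : Eu d → ℝ) : gradInner Ω v w = gradInner Ω w v :=
  integral_congr_ae (Eventually.of_forall fun _ => real_inner_comm _ _)

theorem gradInner_add_left (hΩb : Bornology.IsBounded Ω) {v w z : Eu d → ℝ} (hv : v ∈ lipSpace Ω)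
    (hw : w ∈ lipSpace Ω) (hz : z ∈ lipSpace Ω) :
    gradInner Ω (v + w) z = gradInner Ω v z + gradInner Ω w z := by
  simp only [gradInner]
  rw [← integral_add (integrable_inner_gradient hΩb hv hz) (integrable_inner_gradient hΩb hw hz)]
  refine integral_congr_ae ?_
  filter_upwards [ae_differentiableAt_of_mem_lipSpace hv, ae_differentiableAt_of_mem_lipSpace hw]
    with x h1 h2
  rw [gradient_add h1 h2, inner_add_left]

theorem gradInner_smul_left {v z : Eu d → ℝ} (hv : v ∈ lipSpace Ω) (c : ℝ) :
    gradInner Ω (c • v) z = c * gradInner Ω v z := by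
  simp only [gradInner]
  rw [← integral_const_mul]
  refine integral_congr_ae ?_
  filter_upwards [ae_differentiableAt_of_mem_lipSpace hv] with x h1
  rw [gradient_smul h1, real_inner_smul_left]

theorem gradInner_self (v : Eu d → ℝ) : gradInner Ω v v = gradNormSq Ω v := by
  simp only [gradInner, gradNormSq, real_inner_self_eq_norm_sq]

theorem gradNormSq_nonneg (v : Eu d → ℝ) : 0 ≤ gradNormSq Ω v :=
  integral_nonneg fun _ => sq_nonneg _

theorem _root_.PoincareIneq.l2NormSq_le {Cp : ℝ} (hP : PoincareIneq Ω Cp) (hd : 1 ≤ d)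
    (hΩ : IsOpen Ω) (hΩb : Bornology.IsBounded Ω) {v : Eu d → ℝ} (hv : v ∈ lipSpace Ω) :
    l2NormSq Ω v ≤ Cp ^ 2 * gradNormSq Ω v := by
  obtain ⟨⟨C, hC⟩, hv0⟩ := hv
  have h := hP.of_lipschitz hd hΩ hΩb hC hv0
  simp only [← norm_gradient_eq] at h
  have h1 : 0 ≤ ∫ x in Ω, v x ^ 2 := integral_nonneg fun _ => sq_nonneg _
  have h2 := pow_le_pow_left₀ (Real.sqrt_nonneg _) h 2
  have h3 : 0 ≤ ∫ x in Ω, ‖gradient v x‖ ^ 2 := gradNormSq_nonneg v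
  rwa [mul_pow, Real.sq_sqrt h1, Real.sq_sqrt h3] at h2

/-- The inner product of the gradients is definite, by Poincaré's inequality and continuity. -/
theorem eq_zero_of_gradInner_self {Cp : ℝ} (hP : PoincareIneq Ω Cp) (hd : 1 ≤ d)
    (hΩ : IsOpen Ω) (hΩb : Bornology.IsBounded Ω) {v : Eu d → ℝ} (hv : v ∈ lipSpace Ω)
    (h : gradInner Ω v v = 0) : v = 0 := by
  have h1 := hP.l2NormSq_le hd hΩ hΩb hv
  rw [← gradInner_self, h, mul_zero] at h1
  have h2 : l2NormSq Ω v = 0 := le_antisymm h1 (integral_nonneg fun _ => sq_nonneg _)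
  have hm := memLp_of_mem_lipSpace hΩb hv
  rw [l2NormSq, integral_eq_zero_iff_of_nonneg (fun _ => sq_nonneg _) hm.integrable_sq] at h2
  have h3 : v =ᵐ[volume.restrict Ω] 0 := h2.mono fun x hx => by simpa using hx
  have h4 : EqOn v 0 Ω := MeasureTheory.Measure.eqOn_open_of_ae_eq h3 hΩ
    (continuous_of_mem_lipSpace hv).continuousOn continuousOn_const
  ext x
  by_cases hx : x ∈ Ω
  · exact h4 hx
  · exact hv.2 x hx

/-- A finite-dimensional space of Lipschitz functions that vanish outside `Ω`, with the inner
product of the gradients, is isometric to a Euclidean space. -/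
theorem exists_isometric_coordinates {Cp : ℝ} (hP : PoincareIneq Ω Cp) (hd : 1 ≤ d)
    (hΩ : IsOpen Ω) (hΩb : Bornology.IsBounded Ω) (V : Submodule ℝ (Eu d → ℝ))
    [FiniteDimensional ℝ V] (hV : V ≤ lipSpace Ω) :
    ∃ (n : ℕ) (J : EuclideanSpace ℝ (Fin n) →ₗ[ℝ] Eu d → ℝ), Function.Injective J ∧
      LinearMap.range J = V ∧ ∀ v w, gradInner Ω (J v) (J w) = inner ℝ v w := by
  let core : InnerProductSpace.Core ℝ V :=
    { inner := fun v w => gradInner Ω v w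
      conj_inner_symm := fun v w => gradInner_comm _ _
      re_inner_nonneg := fun v => by
        change 0 ≤ gradInner Ω v v
        rw [gradInner_self]; exact gradNormSq_nonneg _
      add_left := fun v w z => gradInner_add_left hΩb (hV v.2) (hV w.2) (hV z.2)
      smul_left := fun v w c => gradInner_smul_left (hV v.2) c
      definite := fun v hv => Subtype.ext (eq_zero_of_gradInner_self hP hd hΩ hΩb (hV v.2) hv) }
  let _ : NormedAddCommGroup V := core.toNormedAddCommGroup
  let _ : InnerProductSpace ℝ V := InnerProductSpace.ofCore core.toCore
  let b := stdOrthonormalBasis ℝ V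
  let e : EuclideanSpace ℝ (Fin (Module.finrank ℝ V)) →ₗ[ℝ] V := b.repr.symm.toLinearEquiv.toLinearMap
  refine ⟨_, V.subtype ∘ₗ e, ?_, ?_, fun v w => ?_⟩
  · exact V.injective_subtype.comp b.repr.symm.injective
  · rw [LinearMap.range_comp, LinearMap.range_eq_top.2 b.repr.symm.surjective, Submodule.map_top,
      Submodule.range_subtype]
  · exact b.repr.symm.inner_map_map v w

end Coordinates

/-! ### Derivatives in coordinates -/

/-- An isometry `J` of the inner product space `E` onto the space `V` of Lipschitz functions, with the
inner product of the gradients. Point values at the finitely many points `P` determine an element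
of `V`, and `D` computes its coordinates from them. -/
structure LipCoordinates {d : ℕ} (Ω : Set (Eu d)) (V : Submodule ℝ (Eu d → ℝ)) (E : Type)
    [NormedAddCommGroup E] [InnerProductSpace ℝ E] where
  J : E →ₗ[ℝ] Eu d → ℝ
  range : LinearMap.range J = V
  mem_lip : ∀ v, J v ∈ lipSpace Ω
  inner_eq : ∀ v w, gradInner Ω (J v) (J w) = inner ℝ v w
  P : Finset (Eu d)
  D : (P → ℝ) →L[ℝ] E
  D_J : ∀ v, D (fun x => J v x) = v

/-- An injective linear map from a finite-dimensional space to a space of functions stays injective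
when the functions are restricted to suitable finitely many points. -/
theorem exists_finset_leftInverse {X E : Type*} [NormedAddCommGroup E] [NormedSpace ℝ E]
    [FiniteDimensional ℝ E] {J : E →ₗ[ℝ] X → ℝ} (hJ : Function.Injective J) :
    ∃ (P : Finset X) (D : (P → ℝ) →L[ℝ] E), ∀ v, D (fun x => J v x) = v := by
  classical
  let N : Finset X → Submodule ℝ E := fun P => ⨅ x ∈ P, LinearMap.ker (LinearMap.proj x ∘ₗ J)
  have hN : ∀ P v, v ∈ N P ↔ ∀ x ∈ P, J v x = 0 := fun P v => by simp [N]
  -- a finite set of points with the smallest common kernel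
  obtain ⟨_, ⟨P, rfl⟩, hmin⟩ := IsArtinian.set_has_minimal (range N) (range_nonempty N)
  have hbot : ∀ v ∈ N P, v = 0 := by
    intro v hv
    by_contra hv0
    have : J v ≠ 0 := fun h => hv0 (hJ (by rw [h, map_zero]))
    obtain ⟨x, hx⟩ := Function.ne_iff.1 this
    refine hmin _ ⟨insert x P, rfl⟩ (lt_of_le_of_ne ?_ ?_)
    · intro w hw
      rw [hN] at hw ⊢
      exact fun y hy => hw y (Finset.mem_insert_of_mem hy)
    · intro h
      rw [← h, hN] at hv
      exact hx (hv x (Finset.mem_insert_self _ _))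
  let R : E →ₗ[ℝ] P → ℝ := LinearMap.pi fun x => LinearMap.proj (x : X) ∘ₗ J
  obtain ⟨D, hD⟩ := LinearMap.exists_leftInverse_of_injective R <|
    LinearMap.ker_eq_bot'.2 fun v hv => hbot v <| (hN P v).2 fun x hx => congrFun hv ⟨x, hx⟩
  exact ⟨P, D.toContinuousLinearMap, fun v => LinearMap.congr_fun hD v⟩

theorem exists_lipCoordinates {d : ℕ} {Ω : Set (Eu d)} {Cp : ℝ} (hP : PoincareIneq Ω Cp)
    (hd : 1 ≤ d) (hΩ : IsOpen Ω) (hΩb : Bornology.IsBounded Ω) (V : Submodule ℝ (Eu d → ℝ))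
    [FiniteDimensional ℝ V] (hV : V ≤ lipSpace Ω) :
    ∃ n : ℕ, Nonempty (LipCoordinates Ω V (EuclideanSpace ℝ (Fin n))) := by
  obtain ⟨n, J, hJ, hr, hi⟩ := exists_isometric_coordinates hP hd hΩ hΩb V hV
  obtain ⟨P, D, hD⟩ := exists_finset_leftInverse hJ
  exact ⟨n, ⟨J, hr, fun v => hV (hr ▸ LinearMap.mem_range_self J v), hi, P, D, hD⟩⟩

namespace LipCoordinates

variable {d : ℕ} {Ω : Set (Eu d)} {V : Submodule ℝ (Eu d → ℝ)} {E : Type}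
  [NormedAddCommGroup E] [InnerProductSpace ℝ E] (c : LipCoordinates Ω V E)

/-- The coordinates of a function. -/
def coord (u : Eu d → ℝ) : E := c.D fun x => u x

@[simp]
theorem coord_J (v : E) : c.coord (c.J v) = v := c.D_J v

theorem J_mem (v : E) : c.J v ∈ V := c.range.le (LinearMap.mem_range_self c.J v)

theorem J_coord {u : Eu d → ℝ} (hu : u ∈ V) : c.J (c.coord u) = u := by
  rw [← c.range] at hu
  obtain ⟨v, rfl⟩ := hu
  rw [coord_J]

theorem gradNormSq_J (v : E) : gradNormSq Ω (c.J v) = ‖v‖ ^ 2 := by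
  rw [← gradInner_self, c.inner_eq, real_inner_self_eq_norm_sq]

/-- Pointwise smoothness of a family of functions gives smoothness of its coordinates, because these
are computed from finitely many point values. -/
theorem contDiffOn_coord {F : Type*} [NormedAddCommGroup F] [NormedSpace ℝ F] {s : Set F}
    {n : WithTop ℕ∞} {u : F → Eu d → ℝ} (h : ∀ x, ContDiffOn ℝ n (fun p => u p x) s) :
    ContDiffOn ℝ n (fun p => c.coord (u p)) s :=
  c.D.contDiff.comp_contDiffOn (contDiffOn_pi.2 fun x => h x)

theorem continuousOn_coord {F : Type*} [TopologicalSpace F] {s : Set F} {u : F → Eu d → ℝ}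
    (h : ∀ x, ContinuousOn (fun p => u p x) s) : ContinuousOn (fun p => c.coord (u p)) s :=
  c.D.continuous.comp_continuousOn (continuousOn_pi.2 fun x => h x)

theorem hasDerivWithinAt_coord {u : ℝ → Eu d → ℝ} {s : Set ℝ} {t : ℝ}
    (h : ∀ x, DifferentiableWithinAt ℝ (fun τ => u τ x) s t) :
    HasDerivWithinAt (fun τ => c.coord (u τ))
      (c.coord fun x => derivWithin (fun τ => u τ x) s t) s t :=
  c.D.hasFDerivAt.comp_hasDerivWithinAt t
    (hasDerivWithinAt_pi.2 fun x => (h x).hasDerivWithinAt)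

variable [FiniteDimensional ℝ E]

/-- The value at `x` as a functional of the coordinates. -/
noncomputable def eval (x : Eu d) : E →L[ℝ] ℝ := (LinearMap.proj x ∘ₗ c.J).toContinuousLinearMap

@[simp]
theorem eval_apply (x : Eu d) (v : E) : c.eval x v = c.J v x := rfl

/-- Iterated derivatives taken pointwise in `x` are those of the coordinates. -/
theorem iteratedFDerivWithin_eq {F : Type*} [NormedAddCommGroup F] [NormedSpace ℝ F] {s : Set F}
    (hs : UniqueDiffOn ℝ s) {m n : ℕ} (hn : n ≤ m) {U : F → E} {u : F → Eu d → ℝ}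
    (hU : ContDiffOn ℝ m U s) (hu : ∀ p ∈ s, c.J (U p) = u p) {p : F} (hp : p ∈ s) (w : Fin n → F) :
    (fun x => iteratedFDerivWithin ℝ n (fun p => u p x) s p w)
      = c.J (iteratedFDerivWithin ℝ n U s p w) := by
  ext x
  have h1 : iteratedFDerivWithin ℝ n (fun p => u p x) s p
      = iteratedFDerivWithin ℝ n (c.eval x ∘ U) s p :=
    iteratedFDerivWithin_congr (fun q hq => by simp [hu q hq]) hp n
  rw [h1, (c.eval x).iteratedFDerivWithin_comp_left (hU p hp) hs hp (by exact_mod_cast hn)]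
  rfl

theorem iteratedDerivWithin_eq {a b : ℝ} (hab : a < b) {m n : ℕ} (hn : n ≤ m) {U : ℝ → E}
    {u : ℝ → Eu d → ℝ} (hU : ContDiffOn ℝ m U (Icc a b)) (hu : ∀ t ∈ Icc a b, c.J (U t) = u t)
    {t : ℝ} (ht : t ∈ Icc a b) :
    (fun x => iteratedDerivWithin n (fun s => u s x) (Icc a b) t)
      = c.J (iteratedDerivWithin n U (Icc a b) t) := by
  simp only [iteratedDerivWithin_eq_iteratedFDerivWithin]
  exact c.iteratedFDerivWithin_eq (uniqueDiffOn_Icc hab) hn hU hu ht _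

/-- The derivative of a curve in `V` lies in `V`. -/
theorem derivWithin_mem (c : LipCoordinates Ω V E) {u : ℝ → Eu d → ℝ} {s : Set ℝ}
    (hu : ∀ τ ∈ s, u τ ∈ V) {t : ℝ} (ht : t ∈ s)
    (hs : UniqueDiffWithinAt ℝ s t) (h : ∀ x, DifferentiableWithinAt ℝ (fun τ => u τ x) s t) :
    (fun x => derivWithin (fun τ => u τ x) s t) ∈ V := by
  have h1 := c.hasDerivWithinAt_coord h
  have h2 : (fun x => derivWithin (fun τ => u τ x) s t)
      = c.J (c.coord fun x => derivWithin (fun τ => u τ x) s t) := by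
    ext x
    have h3 := (c.eval x).hasFDerivAt.comp_hasDerivWithinAt t h1
    refine HasDerivWithinAt.derivWithin (h3.congr (fun τ hτ => ?_) ?_) hs
    · simp [c.J_coord (hu τ hτ)]
    · simp [c.J_coord (hu t ht)]
  rw [h2]
  exact c.J_mem _

end LipCoordinates

/-! ### The finite element family in coordinates -/

section L2

variable {d : ℕ} {Ω : Set (Eu d)} {V : Submodule ℝ (Eu d → ℝ)} {E : Type}
  [NormedAddCommGroup E] [InnerProductSpace ℝ E]

theorem inner_toLp {f g : Eu d → ℝ} (hf : MemLp f 2 (volume.restrict Ω))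
    (hg : MemLp g 2 (volume.restrict Ω)) : inner ℝ (hf.toLp f) (hg.toLp g) = l2Inner Ω f g := by
  rw [L2.inner_def]
  refine integral_congr_ae ?_
  filter_upwards [hf.coeFn_toLp, hg.coeFn_toLp] with x h1 h2
  rw [h1, h2]
  simp [mul_comm]

theorem norm_toLp_sq {f : Eu d → ℝ} (hf : MemLp f 2 (volume.restrict Ω)) :
    ‖hf.toLp f‖ ^ 2 = l2NormSq Ω f := by
  rw [← real_inner_self_eq_norm_sq, inner_toLp]
  simp only [l2Inner, l2NormSq, sq]

theorem memLp_comp_lipschitz (hΩb : Bornology.IsBounded Ω) {g : ℝ → ℝ} {Λ : ℝ}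
    (hg : ∀ s t, |g s - g t| ≤ Λ * |s - t|) {v : Eu d → ℝ} (hv : v ∈ lipSpace Ω) :
    MemLp (fun x => g (v x)) 2 (volume.restrict Ω) := by
  have : IsFiniteMeasure ((volume : Measure (Eu d)).restrict Ω) :=
    isFiniteMeasure_restrict.2 hΩb.measure_lt_top.ne
  have hgc : Continuous g := by
    refine continuous_iff_continuousAt.2 fun s => ?_
    have h1 : Tendsto (fun t => Λ * |t - s|) (𝓝 s) (𝓝 0) := by
      have : Tendsto (fun t => Λ * |t - s|) (𝓝 s) (𝓝 (Λ * |s - s|)) :=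
        Continuous.tendsto (by fun_prop) s
      simpa using this
    have h2 : Tendsto (fun t => g t - g s) (𝓝 s) (𝓝 0) :=
      squeeze_zero_norm (fun t => hg t s) h1
    simpa [ContinuousAt] using h2.add_const (g s)
  have hm : MemLp (fun x => g (v x) - g 0) 2 (volume.restrict Ω) := by
    refine (memLp_of_mem_lipSpace hΩb hv).of_le_mul (c := Λ)
      ((hgc.comp (continuous_of_mem_lipSpace hv)).sub continuous_const).aestronglyMeasurable
      (Eventually.of_forall fun x => ?_)
    simpa using hg (v x) 0
  have h := hm.add (memLp_const (g 0))
  rwa [show ((fun x => g (v x) - g 0) + fun _ => g 0) = fun x => g (v x) by ext; simp] at h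

variable [FiniteDimensional ℝ E] (c : LipCoordinates Ω V E)

/-- The embedding of the coordinate space in `L²(Ω)`. -/
noncomputable def LipCoordinates.toL2 (hΩb : Bornology.IsBounded Ω) :
    E →L[ℝ] Lp ℝ 2 (volume.restrict Ω) :=
  LinearMap.toContinuousLinearMap
    { toFun := fun v => (memLp_of_mem_lipSpace hΩb (c.mem_lip v)).toLp (c.J v)
      map_add' := fun v w => by
        rw [← MemLp.toLp_add]
        exact MemLp.toLp_congr _ _ (by rw [map_add])
      map_smul' := fun a v => by
        rw [RingHom.id_apply, ← MemLp.toLp_const_smul]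
        exact MemLp.toLp_congr _ _ (by rw [map_smul]) }

theorem LipCoordinates.inner_toL2 (hΩb : Bornology.IsBounded Ω) (v w : E) :
    inner ℝ (c.toL2 hΩb v) (c.toL2 hΩb w) = l2Inner Ω (c.J v) (c.J w) :=
  inner_toLp (memLp_of_mem_lipSpace hΩb (c.mem_lip v)) (memLp_of_mem_lipSpace hΩb (c.mem_lip w))

theorem LipCoordinates.norm_toL2_sq (hΩb : Bornology.IsBounded Ω) (v : E) :
    ‖c.toL2 hΩb v‖ ^ 2 = l2NormSq Ω (c.J v) :=
  norm_toLp_sq (memLp_of_mem_lipSpace hΩb (c.mem_lip v))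

theorem LipCoordinates.norm_toL2_le {Cp : ℝ} (hCp : 0 ≤ Cp) (hP : PoincareIneq Ω Cp) (hd : 1 ≤ d)
    (hΩ : IsOpen Ω) (hΩb : Bornology.IsBounded Ω) (v : E) : ‖c.toL2 hΩb v‖ ≤ Cp * ‖v‖ := by
  have h1 := hP.l2NormSq_le hd hΩ hΩb (c.mem_lip v)
  rw [← c.norm_toL2_sq hΩb, c.gradNormSq_J, ← mul_pow] at h1
  exact (pow_le_pow_iff_left₀ (norm_nonneg _) (by positivity) two_ne_zero).1 h1

/-- The Cauchy-Schwarz inequality for the difference of the nonlinear terms. -/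
theorem LipCoordinates.abs_nonlinear_le (hΩb : Bornology.IsBounded Ω) {g : ℝ → ℝ} {Λ : ℝ}
    (hg : ∀ s t, |g s - g t| ≤ Λ * |s - t|) (v w z : E) :
    |l2Inner Ω (fun x => g (c.J v x)) (c.J z) - l2Inner Ω (fun x => g (c.J w x)) (c.J z)|
      ≤ Λ * (‖c.toL2 hΩb (v - w)‖ * ‖c.toL2 hΩb z‖) := by
  have hv := memLp_comp_lipschitz hΩb hg (c.mem_lip v)
  have hw := memLp_comp_lipschitz hΩb hg (c.mem_lip w)
  have hz := memLp_of_mem_lipSpace hΩb (c.mem_lip z)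
  rw [← inner_toLp hv hz, ← inner_toLp hw hz, ← inner_sub_left, ← mul_assoc]
  refine (abs_real_inner_le_norm _ _).trans ?_
  refine mul_le_mul_of_nonneg_right ?_ (norm_nonneg (c.toL2 hΩb z))
  refine Lp.norm_le_mul_norm_of_ae_le_mul ?_
  have h1 : c.toL2 hΩb (v - w) =ᵐ[volume.restrict Ω] c.J (v - w) :=
    (memLp_of_mem_lipSpace hΩb (c.mem_lip (v - w))).coeFn_toLp
  filter_upwards [Lp.coeFn_sub (hv.toLp _) (hw.toLp _), hv.coeFn_toLp, hw.coeFn_toLp, h1]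
    with x h2 h3 h4 h5
  rw [h2, Pi.sub_apply, h3, h4, h5, map_sub, Pi.sub_apply, Real.norm_eq_abs, Real.norm_eq_abs]
  exact hg _ _

end L2

section Family

variable {d : ℕ} {Ω : Set (Eu d)} {V : Submodule ℝ (Eu d → ℝ)} {E : Type}
  [NormedAddCommGroup E] [InnerProductSpace ℝ E]
  (c : LipCoordinates Ω V E) {G : SampleGrid} {m q : ℕ} {uh : ℝ → ℝ → Eu d → ℝ}

theorem timeDeriv_one (T : ℝ → ℝ) (u : ℝ → ℝ → Eu d → ℝ) (μ t : ℝ) :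
    timeDeriv T 1 u μ t = fun x => derivWithin (fun s => u μ s x) (Icc 0 (T μ)) t := by
  ext x
  simp only [timeDeriv, iteratedDerivWithin_one]

theorem differentiableWithinAt_slice (hm : 1 ≤ m)
    (huc : ∀ x, ContDiffOn ℝ m (fun p : ℝ × ℝ => uh p.1 p.2 x) G.region) {μ : ℝ}
    (hμ : μ ∈ Icc G.α₀ G.αL) {t : ℝ} (ht : t ∈ Icc 0 (G.T μ)) (x : Eu d) :
    DifferentiableWithinAt ℝ (fun s => uh μ s x) (Icc 0 (G.T μ)) t := by
  have h1 := (huc x).differentiableOn (by exact_mod_cast (by omega : m ≠ 0)) (μ, t) ⟨hμ, ht⟩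
  exact h1.comp (f := fun s : ℝ => (μ, s)) t
    ((differentiableAt_const μ).prodMk differentiableAt_id).differentiableWithinAt
    fun s hs => ⟨hμ, hs⟩

/-- The coordinates of the finite element solutions inherit their smoothness. -/
theorem LipCoordinates.isSmoothFamily {Tmin Tmax B : ℝ} (hm : 1 ≤ m) (hα : G.α₀ < G.αL)
    (hTc : ContDiffOn ℝ m G.T (Icc G.α₀ G.αL))
    (hT : ∀ α ∈ Icc G.α₀ G.αL, Tmin ≤ G.T α ∧ G.T α ≤ Tmax)
    (hTd : ∀ α ∈ Icc G.α₀ G.αL, ∀ i : ℕ, 1 ≤ i → i ≤ m →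
        |iteratedDerivWithin i G.T (Icc G.α₀ G.αL) α| ≤ B)
    (huc : ∀ x, ContDiffOn ℝ m (fun p : ℝ × ℝ => uh p.1 p.2 x) G.region)
    (huc' : ∀ x, ContDiffOn ℝ m (fun p : ℝ × ℝ => timeDeriv G.T 1 uh p.1 p.2 x) G.region)
    (hun : ∀ j ≤ G.L, ∀ x, ContDiffOn ℝ (q + 1 : ℕ) (fun t => uh (G.paramNode j) t x)
        (Icc 0 (G.finalTime j))) :
    IsSmoothFamily G m q Tmin Tmax B (fun p => c.coord (uh p.1 p.2))
      (fun p => c.coord (timeDeriv G.T 1 uh p.1 p.2)) where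
  lt := hα
  T_contDiff := hTc
  T_mem := hT
  T_deriv := hTd
  contDiff := c.contDiffOn_coord huc
  contDiff' := c.contDiffOn_coord huc'
  hasDeriv := fun μ hμ t ht => by
    simp only [timeDeriv_one]
    exact c.hasDerivWithinAt_coord (differentiableWithinAt_slice hm huc hμ ht)
  node_contDiff := fun j hj => c.contDiffOn_coord (hun j hj)

theorem LipCoordinates.J_gridSnapshot {x : ℕ → ℕ → E}
    (hx : ∀ l ≤ G.L, ∀ j ≤ G.M, c.J (x l j) = G.sample uh l j)
    (i : Fin (G.M + 1) × Fin (G.L + 1)) : c.J (gridSnapshot G x i.1 i.2) = G.snapshot uh i := by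
  have h1 : (i.1 : ℕ) ≤ G.M := Nat.lt_succ_iff.1 i.1.2
  have h2 : (i.2 : ℕ) ≤ G.L := Nat.lt_succ_iff.1 i.2.2
  simp only [gridSnapshot, SampleGrid.snapshot, SampleGrid.Dt, SampleGrid.Dα]
  split_ifs with h h'
  · rw [map_smul, hx _ h2 _ (Nat.zero_le _)]
  · rw [map_smul, map_smul, map_sub, hx _ (Nat.zero_le _) _ h1,
      hx _ (Nat.zero_le _) _ ((Nat.sub_le _ _).trans h1)]
  · rw [map_smul, map_sub, map_smul, map_smul, map_sub, map_sub, hx _ h2 _ h1,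
      hx _ ((Nat.sub_le _ _).trans h2) _ h1, hx _ h2 _ ((Nat.sub_le _ _).trans h1),
      hx _ ((Nat.sub_le _ _).trans h2) _ ((Nat.sub_le _ _).trans h1)]

variable [FiniteDimensional ℝ E]

/-- The time derivative of the family takes values in the space. -/
theorem LipCoordinates.timeDeriv_mem (c : LipCoordinates Ω V E) (hm : 1 ≤ m)
    (hT0 : ∀ α ∈ Icc G.α₀ G.αL, 0 < G.T α)
    (hV : ∀ μ ∈ Icc G.α₀ G.αL, ∀ t ∈ Icc 0 (G.T μ), uh μ t ∈ V)
    (huc : ∀ x, ContDiffOn ℝ m (fun p : ℝ × ℝ => uh p.1 p.2 x) G.region) {μ : ℝ}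
    (hμ : μ ∈ Icc G.α₀ G.αL) {t : ℝ} (ht : t ∈ Icc 0 (G.T μ)) : timeDeriv G.T 1 uh μ t ∈ V := by
  rw [timeDeriv_one]
  exact c.derivWithin_mem (hV μ hμ) ht (uniqueDiffOn_Icc (hT0 μ hμ) t ht)
    (differentiableWithinAt_slice hm huc hμ ht)

theorem LipCoordinates.mixedSum_eq (hreg : UniqueDiffOn ℝ G.region) {U : ℝ × ℝ → E}
    {u : ℝ → ℝ → Eu d → ℝ} (hU : ContDiffOn ℝ m U G.region)
    (hu : ∀ p ∈ G.region, c.J (U p) = u p.1 p.2) {μ t : ℝ} (hp : (μ, t) ∈ G.region) :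
    mixedSum Ω G.region m u μ t = mixedSq G.region m U (μ, t) := by
  refine Finset.sum_congr rfl fun n hn => Finset.sum_congr rfl fun ij hij => ?_
  have h1 : ij.1 + ij.2 ≤ m := by
    rw [Finset.HasAntidiagonal.mem_antidiagonal.1 hij]; exact Nat.lt_succ_iff.1 (Finset.mem_range.1 hn)
  have h2 : mixedDeriv G.region ij.1 ij.2 u μ t = _ :=
    c.iteratedFDerivWithin_eq (u := fun p => u p.1 p.2) hreg h1 hU hu hp
      (sortedWord ((0 : ℝ), (1 : ℝ)) ((1 : ℝ), (0 : ℝ)) (ij.1 + ij.2) ij.1)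
  rw [h2, c.gradNormSq_J]

theorem LipCoordinates.paramConst_eq (hα : G.α₀ < G.αL) (hm : 1 ≤ m)
    (hT0 : ∀ α ∈ Icc G.α₀ G.αL, 0 < G.T α) (hTc : ContDiffOn ℝ m G.T (Icc G.α₀ G.αL))
    (hV : ∀ μ ∈ Icc G.α₀ G.αL, ∀ t ∈ Icc 0 (G.T μ), uh μ t ∈ V)
    (huc : ∀ x, ContDiffOn ℝ m (fun p : ℝ × ℝ => uh p.1 p.2 x) G.region)
    (huc' : ∀ x, ContDiffOn ℝ m (fun p : ℝ × ℝ => timeDeriv G.T 1 uh p.1 p.2 x) G.region)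
    {l : ℕ} (hl : l + m - 1 ≤ G.L) (hL : 0 < G.L) {α t : ℝ}
    (hαm : α ∈ Icc (G.paramNode l) (G.paramNode (l + m - 1))) (ht : t ∈ Icc 0 (G.T α)) :
    paramConst Ω G m l uh α t = paramEnergy G m l (fun p => c.coord (uh p.1 p.2))
      (fun p => c.coord (timeDeriv G.T 1 uh p.1 p.2)) α t := by
  have hreg := uniqueDiffOn_region hα hT0 (hTc.differentiableOn (by
    exact_mod_cast (by omega : m ≠ 0)))
  have hnl : G.paramNode l ∈ Icc G.α₀ G.αL := paramNode_mem hα hL (by omega)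
  have hnr : G.paramNode (l + m - 1) ∈ Icc G.α₀ G.αL := paramNode_mem hα hL hl
  have hle : G.paramNode l ≤ G.paramNode (l + m - 1) := hαm.1.trans hαm.2
  have hsub : Icc (G.paramNode l) (G.paramNode (l + m - 1)) ⊆ Icc G.α₀ G.αL :=
    Icc_subset_Icc hnl.1 hnr.2
  have h1 : ∀ {μ s : ℝ}, (μ, s) ∈ G.region → mixedSum Ω G.region m uh μ s
      = mixedSq G.region m (fun p => c.coord (uh p.1 p.2)) (μ, s) :=
    c.mixedSum_eq hreg (c.contDiffOn_coord huc) fun p hp => c.J_coord (hV _ hp.1 _ hp.2)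
  have h2 : ∀ {μ s : ℝ}, (μ, s) ∈ G.region → mixedSum Ω G.region m (timeDeriv G.T 1 uh) μ s
      = mixedSq G.region m (fun p => c.coord (timeDeriv G.T 1 uh p.1 p.2)) (μ, s) :=
    c.mixedSum_eq hreg (c.contDiffOn_coord huc') fun p hp =>
      c.J_coord (c.timeDeriv_mem hm hT0 hV huc hp.1 hp.2)
  rw [paramConst, paramEnergy]
  congr 1
  · refine intervalIntegral.integral_congr fun μ hμ => ?_
    rw [uIcc_of_le hle] at hμ
    refine intervalIntegral.integral_congr fun s hs => ?_
    rw [uIcc_of_le (hT0 μ (hsub hμ)).le] at hs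
    simp only [h1 ⟨hsub hμ, hs⟩, h2 ⟨hsub hμ, hs⟩]
  · refine intervalIntegral.integral_congr fun μ hμ => ?_
    rw [uIcc_of_le hle] at hμ
    exact h1 (mapsTo_region hT0 (hsub hαm) ht (hsub hμ))

/-- Of the terms of `timeConst` the estimate uses the integral of the derivative of order `q + 1`; the
others are nonnegative. -/
theorem LipCoordinates.timeEnergy_le (hα : G.α₀ < G.αL) (hL : 0 < G.L)
    (hT0 : ∀ α ∈ Icc G.α₀ G.αL, 0 < G.T α)
    (hV : ∀ μ ∈ Icc G.α₀ G.αL, ∀ t ∈ Icc 0 (G.T μ), uh μ t ∈ V)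
    (hun : ∀ j ≤ G.L, ∀ x, ContDiffOn ℝ (q + 1 : ℕ) (fun t => uh (G.paramNode j) t x)
        (Icc 0 (G.finalTime j))) {l : ℕ} (hl : l + m - 1 ≤ G.L) :
    timeEnergy G m q l (fun p => c.coord (uh p.1 p.2)) ≤ timeConst Ω G m q l uh := by
  refine Finset.sum_le_sum fun j hj => ?_
  have hj' : j ≤ G.L := by have := Finset.mem_Ico.1 hj; omega
  have hnj := paramNode_mem hα hL hj'
  have hTj : 0 < G.finalTime j := hT0 _ hnj
  have hU := c.contDiffOn_coord (hun j hj')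
  have hchain := isDerivChain_iteratedDerivWithin hTj hU
  have h1 : ∀ n ≤ q + 1, ∀ t ∈ Icc 0 (G.finalTime j),
      gradNormSq Ω (timeDeriv G.T n uh (G.paramNode j) t) = ‖iteratedDerivWithin n
        (fun s => c.coord (uh (G.paramNode j) s)) (Icc 0 (G.finalTime j)) t‖ ^ 2 := by
    intro n hn t ht
    have h2 : timeDeriv G.T n uh (G.paramNode j) t = _ := c.iteratedDerivWithin_eq hTj hn hU
      (fun s hs => c.J_coord (hV _ hnj s hs)) ht
    rw [h2, c.gradNormSq_J]
  have h3 : 0 ≤ sSup ((fun t => gradNormSq Ω (timeDeriv G.T q uh (G.paramNode j) t)) ''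
      Icc 0 (G.finalTime j)) :=
    Real.sSup_nonneg (by rintro _ ⟨t, -, rfl⟩; exact gradNormSq_nonneg _)
  refine le_add_of_nonneg_of_le h3 ?_
  have h4 : ∫ t in (0 : ℝ)..G.finalTime j, (gradNormSq Ω (timeDeriv G.T q uh (G.paramNode j) t)
      + gradNormSq Ω (timeDeriv G.T (q + 1) uh (G.paramNode j) t))
      = ∫ t in (0 : ℝ)..G.finalTime j, (‖iteratedDerivWithin q
        (fun s => c.coord (uh (G.paramNode j) s)) (Icc 0 (G.finalTime j)) t‖ ^ 2
        + ‖iteratedDerivWithin (q + 1)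
        (fun s => c.coord (uh (G.paramNode j) s)) (Icc 0 (G.finalTime j)) t‖ ^ 2) := by
    refine intervalIntegral.integral_congr fun t ht => ?_
    rw [uIcc_of_le hTj.le] at ht
    simp only [h1 q (by omega) t ht, h1 (q + 1) le_rfl t ht]
  rw [h4]
  have h5 := ((hchain.continuousOn (by omega : q ≤ q + 1)).norm.pow 2)
  have h6 := ((hchain.continuousOn (le_refl (q + 1))).norm.pow 2)
  exact intervalIntegral.integral_mono_on (μ := volume) hTj.le
    (h6.intervalIntegrable_of_Icc hTj.le) ((h5.add h6).intervalIntegrable_of_Icc hTj.le)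
    fun t _ => le_add_of_nonneg_left (sq_nonneg _)

theorem timeNode_mem (hT : ∀ l ≤ G.L, 0 < G.finalTime l) {l j : ℕ} (hl : l ≤ G.L) (hj : j ≤ G.M) :
    G.timeNode l j ∈ Icc 0 (G.finalTime l) := by
  have hTl := hT l hl
  rcases Nat.eq_zero_or_pos G.M with hM | hM
  · obtain rfl : j = 0 := by omega
    simp [SampleGrid.timeNode, hTl.le]
  · have hM' : (0 : ℝ) < G.M := by exact_mod_cast hM
    have hj' : (j : ℝ) ≤ G.M := by exact_mod_cast hj
    refine ⟨by simp only [SampleGrid.timeNode, SampleGrid.timeStep]; positivity, ?_⟩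
    calc (j : ℝ) * (G.finalTime l / G.M) ≤ G.M * (G.finalTime l / G.M) := by gcongr
      _ = G.finalTime l := mul_div_cancel₀ _ hM'.ne'

theorem podSpace_le {dr : ℕ} {lam : Fin dr → ℝ}
    {vec : Fin dr → EuclideanSpace ℝ (Fin (G.M + 1) × Fin (G.L + 1))} {r : ℕ}
    (h : ∀ i, G.snapshot uh i ∈ V) : podSpace G uh lam vec r ≤ V := by
  refine Submodule.span_le.2 ?_
  rintro _ ⟨k, -, rfl⟩
  exact V.smul_mem _ (V.sum_mem fun i _ => V.smul_mem _ (h i))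

/-- The eigenvalues that are left out bound the projection errors of the snapshots. -/
theorem LipCoordinates.snapshotBound {W : ℝ × ℝ → E}
    (hx : ∀ l ≤ G.L, ∀ j ≤ G.M, c.J (W (G.paramNode l, G.timeNode l j)) = G.sample uh l j)
    {dr : ℕ} {lam : Fin dr → ℝ}
    {vec : Fin dr → EuclideanSpace ℝ (Fin (G.M + 1) × Fin (G.L + 1))}
    (hS : IsPosEigensystem (G.correlation Ω uh) lam vec) (r : ℕ) :
    SnapshotBound G W ((podSpace G uh lam vec r).comap c.J)ᗮ.starProjection
      (∑ k ∈ Finset.univ.filter (fun k : Fin dr => r ≤ (k : ℕ)), lam k) := by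
  set U := (podSpace G uh lam vec r).comap c.J
  let y : Fin (G.M + 1) × Fin (G.L + 1) → E := fun i =>
    gridSnapshot G (fun l j => W (G.paramNode l, G.timeNode l j)) i.1 i.2
  have hy : ∀ i, c.J (y i) = G.snapshot uh i := c.J_gridSnapshot hx
  have hN : (0 : ℝ) < G.numSnapshots := by
    simp only [SampleGrid.numSnapshots, Nat.cast_mul, Nat.cast_add, Nat.cast_one]; positivity
  have h1 := hS.sum_norm_sq_le (y := y) (r := r) (Q := Uᗮ.starProjection) hN
    (fun i j => by simp only [SampleGrid.correlation, Matrix.of_apply, ← hy, c.inner_eq])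
    (fun v => Uᗮ.norm_starProjection_apply_le v) fun k hk => by
      refine Submodule.starProjection_orthogonal_apply_eq_zero ?_
      have h2 : (1 / √(G.numSnapshots : ℝ)) * (1 / √(lam k)) ≠ 0 := by
        have := hS.pos k
        positivity
      have h3 : c.J (∑ i, vec k i • y i)
          = ((1 / √(G.numSnapshots : ℝ)) * (1 / √(lam k)))⁻¹ • G.podMode uh (lam k) (vec k) := by
        simp only [SampleGrid.podMode, map_sum, map_smul, hy]
        rw [inv_smul_smul₀ h2]
      refine Submodule.mem_comap.2 ?_
      rw [h3]
      exact Submodule.smul_mem _ _ (Submodule.subset_span ⟨k, hk, rfl⟩)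
  refine le_trans (le_of_eq (Finset.sum_congr rfl fun i _ => ?_)) h1
  exact congrArg (‖·‖ ^ 2) (map_gridSnapshot G _ i.1 i.2 Uᗮ.starProjection.toLinearMap).symm

/-- In coordinates the `H¹₀`-projection is the orthogonal projection. -/
theorem LipCoordinates.coord_eq_starProjection (hΩb : Bornology.IsBounded Ω)
    {R : Submodule ℝ (Eu d → ℝ)} (hR : R ≤ V) (hV : V ≤ lipSpace Ω) {v p : Eu d → ℝ} (hv : v ∈ V)
    (h : IsH10Projection Ω R v p) : c.coord p = (R.comap c.J).starProjection (c.coord v) := by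
  have hp : p ∈ V := hR h.1
  refine (Submodule.eq_starProjection_of_mem_of_inner_eq_zero ?_ fun w hw => ?_).symm
  · rw [Submodule.mem_comap, c.J_coord hp]; exact h.1
  · have h1 := h.2 (c.J w) hw
    simp only [inner_sub_left] at h1
    rw [integral_sub (integrable_inner_gradient hΩb (hV hv) (c.mem_lip w))
      (integrable_inner_gradient hΩb (hV hp) (c.mem_lip w))] at h1
    rw [inner_sub_left, ← c.inner_eq, ← c.inner_eq, c.J_coord hv, c.J_coord hp]
    exact h1

end Family

end PODError

theorem mainTheorem1 (m q : ℕ) (hm : 2 ≤ m) (hq : 2 ≤ q)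
    (len Tmin Tmax B Λ Cp : ℝ) (hlen : 0 < len) (hTmin : 0 < Tmin) (hΛ : 0 ≤ Λ) (hCp : 0 ≤ Cp) :
    ∃ C : ℝ, 0 < C ∧
      ∀ (d : ℕ), 1 ≤ d → d ≤ 3 →
      ∀ (Ω : Set (Eu d)), IsOpen Ω → IsConnected Ω → Bornology.IsBounded Ω → PoincareIneq Ω Cp →
      ∀ (K : Geometry.SimplicialComplex ℝ (Eu d)), IsTriangulation K Ω →
      ∀ (k : ℕ) (G : SampleGrid), G.αL - G.α₀ = len → q ≤ G.M →
      ContDiffOn ℝ m G.T (Icc G.α₀ G.αL) →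
      (∀ α ∈ Icc G.α₀ G.αL, Tmin ≤ G.T α ∧ G.T α ≤ Tmax) →
      (∀ α ∈ Icc G.α₀ G.αL, ∀ i : ℕ, 1 ≤ i → i ≤ m →
        |iteratedDerivWithin i G.T (Icc G.α₀ G.αL) α| ≤ B) →
      ∀ (ν : ℝ → ℝ) (g : ℝ → ℝ → ℝ) (f : ℝ → ℝ → Eu d → ℝ),
      (∀ α ∈ Icc G.α₀ G.αL, 0 < ν α) →
      (∀ α ∈ Icc G.α₀ G.αL, ∀ s t : ℝ, |g α s - g α t| ≤ Λ * |s - t|) →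
      (∀ α ∈ Icc G.α₀ G.αL, ∀ t ∈ Ioc 0 (G.T α), MemLp (f α t) 2 (volume.restrict Ω)) →
      -- the finite element solutions and their smoothness
      ∀ (uh : ℝ → ℝ → Eu d → ℝ),
      (∀ α ∈ Icc G.α₀ G.αL,
        IsGalerkinSolution Ω (feSpace K Ω k) (G.T α) (ν α) (g α) (f α) (uh α)) →
      (∀ x, ContDiffOn ℝ m (fun p : ℝ × ℝ => uh p.1 p.2 x) G.region) →
      (∀ x, ContDiffOn ℝ m (fun p : ℝ × ℝ => timeDeriv G.T 1 uh p.1 p.2 x) G.region) →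
      (∀ j ≤ G.L, ∀ x, ContDiffOn ℝ (q + 1 : ℕ) (fun t => uh (G.paramNode j) t x)
        (Icc 0 (G.finalTime j))) →
      -- the POD modes
      ∀ (dr : ℕ) (lam : Fin dr → ℝ)
        (vec : Fin dr → EuclideanSpace ℝ (Fin (G.M + 1) × Fin (G.L + 1))),
      IsPosEigensystem (G.correlation Ω uh) lam vec →
      ∀ (r : ℕ), 1 ≤ r → r ≤ dr →
      -- the parameter, sampled or not, and the reduced order solution
      ∀ (l : ℕ), l + m - 1 ≤ G.L →
      ∀ α ∈ Icc (G.paramNode l) (G.paramNode (l + m - 1)),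
      ∀ (ur : ℝ → Eu d → ℝ),
      IsGalerkinSolution Ω (podSpace G uh lam vec r : Set (Eu d → ℝ)) (G.T α) (ν α) (g α) (f α) ur →
      IsH10Projection Ω (podSpace G uh lam vec r) (uh α 0) (ur 0) →
      ∀ t ∈ Icc 0 (G.T α),
        l2NormSq Ω (ur t - uh α t) ≤
          C * ((m + 1) + q * m) * ∑ k ∈ Finset.univ.filter (fun k : Fin dr => r ≤ (k : ℕ)), lam k
          + C * timeConst Ω G m q l uh * G.maxTimeStep ^ (2 * q)
          + C * paramConst Ω G m l uh α t * G.paramStep ^ (2 * m - 1) := by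
  have hm1 : 1 ≤ m := by omega
  obtain ⟨C, hC, hmain⟩ := PODError.exists_galerkin_const m q hm hq len Tmin Tmax B Λ Cp hTmin hΛ
  refine ⟨C, hC, ?_⟩
  intro d hd _ Ω hΩ _ hΩb hP K hK k G hGlen hqM hTc hT hTd ν g f hν hg _ uh huh huc huc' hun dr lam
    vec hS r _ _ l hl α hαm ur hur hur0 t ht
  have hα : G.α₀ < G.αL := by linarith
  have hL : 0 < G.L := by omega
  have hT0 : ∀ α ∈ Icc G.α₀ G.αL, 0 < G.T α := fun α hα => hTmin.trans_le (hT α hα).1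
  have hnl := PODError.paramNode_mem hα hL (by omega : l ≤ G.L)
  have hnr := PODError.paramNode_mem hα hL hl
  have hα' : α ∈ Icc G.α₀ G.αL := ⟨hnl.1.trans hαm.1, hαm.2.trans hnr.2⟩
  have hTα := hT0 α hα'
  -- the finite element space is a Euclidean space, for the inner product of the gradients
  have hfin := PODError.finiteDimensional_feSubmodule (k := k) hK
  have hVL := PODError.feSubmodule_le_lipSpace (k := k) hK hΩ
  set V := PODError.feSubmodule K Ω k
  obtain ⟨n, ⟨c⟩⟩ := PODError.exists_lipCoordinates hP hd hΩ hΩb V hVL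
  have hV : ∀ μ ∈ Icc G.α₀ G.αL, ∀ t ∈ Icc 0 (G.T μ), uh μ t ∈ V := fun μ hμ => (huh μ hμ).mem
  let W : ℝ × ℝ → EuclideanSpace ℝ (Fin n) := fun p => c.coord (uh p.1 p.2)
  let Wt : ℝ × ℝ → EuclideanSpace ℝ (Fin n) := fun p => c.coord (timeDeriv G.T 1 uh p.1 p.2)
  have hW : PODError.IsSmoothFamily G m q Tmin Tmax B W Wt :=
    c.isSmoothFamily hm1 hα hTc hT hTd huc huc' hun
  have hJW : ∀ μ ∈ Icc G.α₀ G.αL, ∀ t ∈ Icc 0 (G.T μ), c.J (W (μ, t)) = uh μ t :=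
    fun μ hμ t ht => c.J_coord (hV μ hμ t ht)
  have hx : ∀ l ≤ G.L, ∀ j ≤ G.M, c.J (W (G.paramNode l, G.timeNode l j)) = G.sample uh l j :=
    fun l hl j hj => hJW _ (PODError.paramNode_mem hα hL hl) _
      (PODError.timeNode_mem (fun l hl => hT0 _ (PODError.paramNode_mem hα hL hl)) hl hj)
  have hsnap : ∀ i, G.snapshot uh i ∈ V := fun i => by
    rw [← c.J_gridSnapshot hx i]; exact c.J_mem _
  have hRV : podSpace G uh lam vec r ≤ V := PODError.podSpace_le hsnap
  set R := podSpace G uh lam vec r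
  have hurV : ∀ s ∈ Icc 0 (G.T α), ur s ∈ V := fun s hs => hRV (hur.mem s hs)
  set σ := ∑ k ∈ Finset.univ.filter (fun k : Fin dr => r ≤ (k : ℕ)), lam k
  have hσ : 0 ≤ σ := Finset.sum_nonneg fun k _ => (hS.pos k).le
  -- the reduced order solution and its time derivative in coordinates
  let Ur : ℝ → EuclideanSpace ℝ (Fin n) := fun s => c.coord (ur s)
  let Ur' : ℝ → EuclideanSpace ℝ (Fin n) := fun s =>
    c.coord fun x => derivWithin (fun τ => ur τ x) (Icc 0 (G.T α)) s
  have hJU : ∀ s ∈ Icc 0 (G.T α), c.J (Ur s) = ur s := fun s hs => c.J_coord (hurV s hs)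
  have hJU' : ∀ s ∈ Ioo 0 (G.T α),
      c.J (Ur' s) = fun x => derivWithin (fun τ => ur τ x) (Icc 0 (G.T α)) s := fun s hs =>
    c.J_coord (c.derivWithin_mem hurV (Ioo_subset_Icc_self hs)
      (uniqueDiffOn_Icc hTα s (Ioo_subset_Icc_self hs)) fun x => hur.diff x s (Ioo_subset_Ioc_self hs))
  have hJWt : ∀ s ∈ Icc 0 (G.T α),
      c.J (Wt (α, s)) = fun x => derivWithin (fun τ => uh α τ x) (Icc 0 (G.T α)) s := fun s hs => by
    rw [← PODError.timeDeriv_one]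
    exact c.J_coord (c.timeDeriv_mem hm1 hT0 hV huc hα' hs)
  have herr := hmain G W Wt hGlen hqM hW (c.toL2 hΩb) (c.norm_toL2_le hCp hP hd hΩ hΩb) (R.comap c.J) σ
    hσ (c.snapshotBound hx hS r) l hl α hαm (ν α) (hν α hα').le Ur Ur'
    (c.continuousOn_coord hur.cont)
    (fun s hs => (c.hasDerivWithinAt_coord fun x => hur.diff x s (Ioo_subset_Ioc_self hs)).hasDerivAt
      (Icc_mem_nhds hs.1 hs.2))
    (fun s hs => by
      rw [Submodule.mem_comap, hJU s hs]; exact hur.mem s hs)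
    (c.coord_eq_starProjection hΩb hRV hVL (hV α hα' 0 (left_mem_Icc.2 hTα.le)) hur0)
    (fun s v => l2Inner Ω (fun x => g α (c.J (Ur s) x)) (c.J v)
      - l2Inner Ω (fun x => g α (c.J (W (α, s)) x)) (c.J v))
    (fun s _ v => c.abs_nonlinear_le hΩb (hg α hα') _ _ _)
    (fun s hs v hv => by
      have hs' := Ioo_subset_Icc_self hs
      have h1 := hur.eqn s (Ioo_subset_Ioc_self hs) (c.J v) hv
      have h2 := (huh α hα').eqn s (Ioo_subset_Ioc_self hs) (c.J v) (c.J_mem v)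
      rw [← hJU' s hs, ← hJU s hs', ← c.inner_toL2 hΩb, c.inner_eq] at h1
      rw [← hJWt s hs', ← hJW α hα' s hs', ← c.inner_toL2 hΩb, c.inner_eq] at h2
      rw [map_sub, inner_sub_left, inner_sub_left]
      linarith)
    t ht
  rw [c.norm_toL2_sq, map_sub, hJU t ht, hJW α hα' t ht] at herr
  refine herr.trans ?_
  have hpar : paramConst Ω G m l uh α t = PODError.paramEnergy G m l W Wt α t :=
    c.paramConst_eq hα hm1 hT0 hTc hV huc huc' hl hL hαm ht
  have htime : PODError.timeEnergy G m q l W ≤ timeConst Ω G m q l uh :=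
    c.timeEnergy_le hα hL hT0 hV hun hl
  have h1 : C * σ ≤ C * ((m + 1) + q * m) * σ := by
    refine mul_le_mul_of_nonneg_right (le_mul_of_one_le_right hC.le ?_) hσ
    have : (0 : ℝ) ≤ m := Nat.cast_nonneg m
    have : (0 : ℝ) ≤ q * m := by positivity
    linarith
  have h2 : C * (PODError.timeEnergy G m q l W * G.maxTimeStep ^ (2 * q))
      ≤ C * (timeConst Ω G m q l uh * G.maxTimeStep ^ (2 * q)) :=
    mul_le_mul_of_nonneg_left (mul_le_mul_of_nonneg_right htime ((even_two_mul q).pow_nonneg _)) hC.le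
  rw [hpar]
  linarith
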